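/- Write $B_r=\{x\in\mathbf R^3: |x|\le r\}$, let $B_r^\circ$ be the open ball, and write $D_s=\{z\in\mathbf C: |z|\le s\}$. Let $A_\Sigma$ and $\mathbf n_\Sigma$ be the second fundamental form and unit normal of a surface $\Sigma\subset\mathbf R^3$. Let $\mathcal P=\{(\rho,\theta):\rho>0,\ \theta\in\mathbf R\}$ be the universal cover of $\mathbf C\setminus\{0\}$. A *multi-valued graph* is a set $\{(\rho\cos\theta,\rho\sin\theta,u(\rho,\theta)):(\rho,\theta)\in W\}$, where $W\subset\mathcal P$ is connected and meets every line $\rho=\mathrm{const}$ in an interval, $u$ is a smooth function on a neighbourhood of $W$, and the parametrization by $W$ is injective. Up to a rotation, it contains an $N$-valued graph over $D_s\setminus\{0\}$ if $W\supset\{0<\rho\le s,\ |\theta-c|\le N\pi\}$ for some $c$. It *spirals into* $\{x_3=0\}$ (and is $\infty$-valued) if there is $\sigma\in\{1,-1\}$ such that for every $s\in(0,1)$ there is $\theta_0$ with $\{0<\rho\le s,\ \sigma\theta\ge\theta_0\}\subset W$, and $u(\rho,\theta)\to0$ uniformly in $\rho$ as $\sigma\theta\to\infty$ in $W$. An *embedded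 minimal disk* is the image, under a smooth embedding with mean curvature zero, of the open unit disk together with a relatively open (possibly empty, possibly full) part of the unit circle; the image of that part is its boundary. **Theorem.** There is a sequence of compact embedded minimal disks $\Sigma_i\subset B_1\subset\mathbf R^3$ with $\partial\Sigma_i\subset\partial B_1$ and $\{(0,0,t):|t|<1\}\subset\Sigma_i$ such that: 1. $\lim_{i\to\infty}|A_{\Sigma_i}|^2(0)=\infty$. 2. $\sup_i\sup_{\Sigma_i\setminus B_\delta^\circ}|A_{\Sigma_i}|^2<\infty$ for every $\delta>0$. 3. $\Sigma_i\setminus\{x_3\text{-axis}\}=\Sigma_{1,i}\cup\Sigma_{2,i}$ for two disjoint multi-valued graphs $\Sigma_{1,i},\Sigma_{2,i}$; moreover, for every $N$ and every $s\in(0,1)$, for all large $i$ each of them contains (up to a rotation) an $N$-valued graph over $D_s\setminus\{0\}$. 4. $\Sigma_i\setminus\{x_3=0\}$ converges, smoothly with multiplicity one on compact subsets of $\{x_3\ne0\}$, to two embedded minimal disks $\Sigma^\pm\subset B_1\cap\{\pm x_3>0\}$ with boundary in $\partial B_1$ and with $\overline{\Sigma^\pm}\setminus\Sigma^\pm=B_1\cap\{x_3=0\}$.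 Moreover $\Sigma^\pm\setminus\{x_3\text{-axis}\}=\Sigma_1^\pm\cup\Sigma_2^\pm$ for disjoint multi-valued graphs $\Sigma_1^\pm,\Sigma_2^\pm$, each of which is $\infty$-valued and spirals into $\{x_3=0\}$. Consequently the limit is neither proper nor smooth: $\Sigma^+$ and $\Sigma^-$ are not proper (each has a non-compact intersection with some compact set). Away from $0$ the $\Sigma_i$ also converge, with their tangent planes, to the leaf $\{x_3=0\}$: for all $\delta,\eta>0$ there is $h>0$ such that, for all large $i$, $|\langle\mathbf n_{\Sigma_i},e_3\rangle|>1-\eta$ on $\{|x_3|<h\}\cap\Sigma_i\setminus B_\delta^\circ$. The surfaces $\Sigma^+\cap B_1^\circ$, $\Sigma^-\cap B_1^\circ$ and $(B_1^\circ\cap\{x_3=0\})\setminus\{0\}$ are the leaves of a lamination of $B_1^\circ\setminus\{0\}$, and there is no lamination of $B_1^\circ$ whose leaves, with the point $0$ removed, are exactly these. Here a lamination of an open set $M\subset\mathbf R^3$ is a collection of pairwise disjoint connected smooth surfaces (leaves) in $M$ whose union is closed in $M$, such that every point of $M$ lies in a (continuous) coordinate chart in which each leaf is a union of at most countably many horizontal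 slices. -/

import Mathlib

open Set Filter Topology
open scoped ContDiff

noncomputable section

namespace SpiralDisk

/-- The parameter plane `ℝ²` with its Euclidean norm. -/
abbrev Plane := EuclideanSpace ℝ (Fin 2)

/-- Euclidean space `ℝ³`; the coordinates `x₁, x₂, x₃` of `p` are `p 0, p 1, p 2`. -/
abbrev Space := EuclideanSpace ℝ (Fin 3)

/-! ### Local geometry of a parametrized surface `f : ℝ² → ℝ³` -/

/-- The partial derivative `∂ f / ∂ x_j`. -/
def partialD (j : Fin 2) (f : Plane → Space) (q : Plane) : Space :=
  fderiv ℝ f q (EuclideanSpace.single j (1 : ℝ))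

/-- The vector product of `ℝ³`. -/
def cross (v w : Space) : Space :=
  WithLp.toLp 2 (crossProduct (WithLp.ofLp v) (WithLp.ofLp w))

/-- The unit normal `(∂₁ f × ∂₂ f) / |∂₁ f × ∂₂ f|`. -/
def unitNormal (f : Plane → Space) (q : Plane) : Space :=
  ‖cross (partialD 0 f q) (partialD 1 f q)‖⁻¹ • cross (partialD 0 f q) (partialD 1 f q)

/-- The first fundamental form `⟨∂_j f, ∂_k f⟩`. -/
def firstForm (f : Plane → Space) (q : Plane) : Matrix (Fin 2) (Fin 2) ℝ :=
  Matrix.of fun j k => inner ℝ (partialD j f q) (partialD k f q)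

/-- The second fundamental form `⟨∂_j ∂_k f, n⟩`. -/
def secondForm (f : Plane → Space) (q : Plane) : Matrix (Fin 2) (Fin 2) ℝ :=
  Matrix.of fun j k => inner ℝ (partialD j (partialD k f) q) (unitNormal f q)

/-- The matrix of the shape operator; its eigenvalues are the principal curvatures. -/
def shapeOperator (f : Plane → Space) (q : Plane) : Matrix (Fin 2) (Fin 2) ℝ :=
  (firstForm f q)⁻¹ * secondForm f q

/-- The mean curvature, half the sum of the principal curvatures. -/
def meanCurvature (f : Plane → Space) (q : Plane) : ℝ :=
  (shapeOperator f q).trace / 2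

/-- `|A|²`, the sum of the squares of the principal curvatures. -/
def normSqA (f : Plane → Space) (q : Plane) : ℝ :=
  (shapeOperator f q * shapeOperator f q).trace

/-- `f` restricts to a smooth embedding of `D ⊆ ℝ²`: it is smooth on a neighbourhood of `D`,
an immersion at every point of `D`, and a homeomorphism of `D` onto its image. -/
structure IsSmoothEmbeddingOn (f : Plane → Space) (D : Set Plane) : Prop where
  smooth : ∃ V : Set Plane, IsOpen V ∧ D ⊆ V ∧ ContDiffOn ℝ ∞ f V
  immersion : ∀ q ∈ D, Function.Injective (fderiv ℝ f q)
  embedding : IsEmbedding (D.domRestrict f)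

/-! ### Embedded minimal disks, possibly with boundary -/

/-- An embedded minimal disk in `ℝ³`. The parameter domain is the open unit disk together with
a relatively open part of the unit circle, which parametrizes the boundary of the surface.
The whole unit circle gives a compact disk, the empty part a disk without boundary. -/
structure EmbeddedMinimalDisk where
  dom : Set Plane
  ball_subset_dom : Metric.ball 0 1 ⊆ dom
  dom_eq : ∃ U : Set Plane, IsOpen U ∧ dom = U ∩ Metric.closedBall 0 1
  toFun : Plane → Space
  embedded : IsSmoothEmbeddingOn toFun dom
  minimal : ∀ q ∈ dom, meanCurvature toFun q = 0

namespace EmbeddedMinimalDisk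

/-- The surface as a subset of `ℝ³`. -/
def carrier (S : EmbeddedMinimalDisk) : Set Space := S.toFun '' S.dom

/-- The boundary `∂S` of the surface. -/
def boundary (S : EmbeddedMinimalDisk) : Set Space :=
  S.toFun '' (S.dom ∩ Metric.sphere 0 1)

/-- The parameter of a point of the surface. -/
def param (S : EmbeddedMinimalDisk) (p : Space) : Plane := Function.invFunOn S.toFun S.dom p

/-- `|A_S|²(p)` for `p` in the surface. -/
def curvSq (S : EmbeddedMinimalDisk) (p : Space) : ℝ := normSqA S.toFun (S.param p)

/-- The unit normal at a point `p` of the surface. -/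
def normal (S : EmbeddedMinimalDisk) (p : Space) : Space := unitNormal S.toFun (S.param p)

end EmbeddedMinimalDisk

/-! ### Multi-valued graphs -/

/-- The `x₃`-axis. -/
def axis : Set Space := {p | p 0 = 0 ∧ p 1 = 0}

/-- The plane `x₃ = 0`. -/
def plane₀ : Set Space := {p | p 2 = 0}

/-- The half space `{x₃ > 0}` for `ε = 1` and `{x₃ < 0}` for `ε = -1`. -/
def halfSpace (ε : ℝ) : Set Space := {p | 0 < ε * p 2}

/-- The point of the graph of `u` over the point with polar coordinates `q = (ρ, θ)` of the
universal cover of the punctured plane. -/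
def graphPt (u : ℝ × ℝ → ℝ) (q : ℝ × ℝ) : Space :=
  !₂[q.1 * Real.cos q.2, q.1 * Real.sin q.2, u q]

/-- The surface `{graphPt u q | q ∈ W}` is an embedded multi-valued graph: a single-valued graph
of a smooth function `u` over a connected part `W` of the universal cover
`{(ρ, θ) | ρ > 0, θ ∈ ℝ}` of the punctured plane, such that `W` meets each line `ρ = const` in an
interval, and the sheets over the same point of the punctured plane are disjoint. -/
structure IsMultivaluedGraph (W : Set (ℝ × ℝ)) (u : ℝ × ℝ → ℝ) : Prop where
  pos : ∀ q ∈ W, 0 < q.1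
  connected : IsConnected W
  interval : ∀ ρ : ℝ, {θ : ℝ | (ρ, θ) ∈ W}.OrdConnected
  smooth : ∃ V : Set (ℝ × ℝ), IsOpen V ∧ W ⊆ V ∧ ContDiffOn ℝ ∞ u V
  embedded : InjOn (graphPt u) W

/-- Up to a rotation, the graph contains an `N`-valued graph over `D_s \ {0}`. -/
def ContainsNValued (W : Set (ℝ × ℝ)) (N s : ℝ) : Prop :=
  ∃ c : ℝ, ∀ ρ θ : ℝ, 0 < ρ → ρ ≤ s → |θ - c| ≤ N * Real.pi → (ρ, θ) ∈ W

/-- The surface `S` without the `x₃`-axis is the disjoint union of the two multi-valued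
graphs of `u 0`, `u 1`. -/
def IsTwoMultivaluedGraphs (S : Set Space) (W : Fin 2 → Set (ℝ × ℝ))
    (u : Fin 2 → ℝ × ℝ → ℝ) : Prop :=
  (∀ j, IsMultivaluedGraph (W j) (u j)) ∧
  S \ axis = graphPt (u 0) '' W 0 ∪ graphPt (u 1) '' W 1 ∧
  Disjoint (graphPt (u 0) '' W 0) (graphPt (u 1) '' W 1)

/-- A multi-valued graph over (part of) the universal cover of `D_1 \ {0}` is `∞`-valued and
spirals into `{x₃ = 0}`: over each `D_s \ {0}` with `s < 1` it makes infinitely many turns in one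
direction, and along these turns its height tends to `0`, uniformly. -/
def SpiralsIntoPlane (W : Set (ℝ × ℝ)) (u : ℝ × ℝ → ℝ) : Prop :=
  ∃ σ : ℝ, (σ = 1 ∨ σ = -1) ∧
    (∀ s ∈ Ioo (0 : ℝ) 1, ∃ θ₀ : ℝ, ∀ ρ ∈ Ioc (0 : ℝ) s, ∀ θ : ℝ, θ₀ ≤ σ * θ → (ρ, θ) ∈ W) ∧
    (∀ η > 0, ∃ Θ : ℝ, ∀ q ∈ W, Θ ≤ σ * q.2 → |u q| < η)

/-! ### Convergence -/

/-- In the open set `U`, the surfaces `S i` converge smoothly and with multiplicity one to `T`,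
uniformly on compact subsets: there are parametrizations `g i` of larger and larger parts of
`S i` by the parameter domain of `T` which converge with all derivatives, uniformly on compact
subsets, to the parametrization of `T`, and which exhaust `S i` in every compact subset
of `U`. -/
def SmoothlyConverges (S : ℕ → EmbeddedMinimalDisk) (U : Set Space)
    (T : EmbeddedMinimalDisk) : Prop :=
  ∃ g : ℕ → Plane → Space,
    (∀ Q ⊆ T.dom, IsCompact Q → ∀ᶠ i in atTop,
      (∃ V : Set Plane, IsOpen V ∧ Q ⊆ V ∧ ContDiffOn ℝ ∞ (g i) V) ∧
      InjOn (g i) Q ∧ MapsTo (g i) Q ((S i).carrier ∩ U)) ∧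
    (∀ k : ℕ, TendstoLocallyUniformlyOn (fun i => iteratedFDeriv ℝ k (g i))
      (iteratedFDeriv ℝ k T.toFun) atTop T.dom) ∧
    (∀ K ⊆ U, IsCompact K → ∃ Q ⊆ T.dom, IsCompact Q ∧
      ∀ᶠ i in atTop, (S i).carrier ∩ K ⊆ g i '' Q)

/-- A surface is proper if its intersection with every compact set is compact. -/
def IsProperSet (S : Set Space) : Prop := ∀ K : Set Space, IsCompact K → IsCompact (S ∩ K)

/-- In `{x₃ > 0}` (for `ε = 1`) or `{x₃ < 0}` (for `ε = -1`), the disks `S i` converge to the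
disk `T`, whose closure adds exactly the horizontal unit disk, and `T` without the axis
consists of two multi-valued graphs, each of which spirals into `{x₃ = 0}`. -/
def IsSpiralingLimit (S : ℕ → EmbeddedMinimalDisk) (ε : ℝ) (T : EmbeddedMinimalDisk) : Prop :=
  T.carrier ⊆ Metric.closedBall 0 1 ∩ halfSpace ε ∧
  T.boundary ⊆ Metric.sphere 0 1 ∧
  SmoothlyConverges S (halfSpace ε) T ∧
  closure T.carrier \ T.carrier = Metric.closedBall 0 1 ∩ plane₀ ∧
  ∃ (W : Fin 2 → Set (ℝ × ℝ)) (u : Fin 2 → ℝ × ℝ → ℝ),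
    IsTwoMultivaluedGraphs T.carrier W u ∧ ∀ j, SpiralsIntoPlane (W j) (u j)

/-! ### Laminations -/

/-- `L` is (the set of leaves of) a lamination of the open set `M ⊆ ℝ³` by surfaces: the leaves are
disjoint connected smooth surfaces whose union is closed in `M`, and around every point of `M`
there is a coordinate chart in which each leaf consists of (countably many) horizontal slices. -/
structure IsLamination (M : Set Space) (L : Set (Set Space)) : Prop where
  subset : ∀ Λ ∈ L, Λ ⊆ M
  connected : ∀ Λ ∈ L, IsPathConnected Λ
  smooth : ∀ Λ ∈ L, ∀ p ∈ Λ, ∃ f : Plane → Space,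
    IsSmoothEmbeddingOn f (Metric.ball 0 1) ∧ f 0 = p ∧ f '' Metric.ball 0 1 ⊆ Λ
  disjoint : L.PairwiseDisjoint id
  closed : closure (⋃₀ L) ∩ M ⊆ ⋃₀ L
  chart : ∀ x ∈ M, ∃ Φ : OpenPartialHomeomorph Space (Plane × ℝ),
    x ∈ Φ.source ∧ Φ.source ⊆ M ∧
    ∀ Λ ∈ L, ∃ T : Set ℝ, T.Countable ∧
      Φ '' (Φ.source ∩ Λ) = {y | y ∈ Φ.target ∧ y.2 ∈ T}

/-- The leaves in the punctured open unit ball: the two limit disks and the punctured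
horizontal disk. -/
def limitLeaves (Tp Tm : EmbeddedMinimalDisk) : Set (Set Space) :=
  {Tp.carrier ∩ Metric.ball 0 1, Tm.carrier ∩ Metric.ball 0 1,
    (Metric.ball 0 1 ∩ plane₀) \ {0}}

end SpiralDisk

end

open SpiralDisk

noncomputable section

namespace SpiralDisk

/-! ### Averages along vertical segments -/

/-! The surfaces come from Weierstrass data. For 0 < a < 1 let u + iv be a primitive of k(z) = lam /
(z² + a²), z = x + iy, that is real on the real axis. Gauss map exp(i(u + iv)) (up to a constant
factor) and height differential dz give a surface F with x₃ = x and ∂_y F = (cosh v cos u, cosh v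
sin u, 0). Its first fundamental form is cosh² v times the identity, and its second fundamental form
is traceless with entries built from Re k and Im k. So F is minimal, |A|² = 2|k|² / cosh⁴ v, the
real axis goes to the x₃-axis, and |A|²(0) = 2 lam² / a⁴ blows up as a → 0.

Write sz = x² + a². All work takes place on the thin domain |y| < kap sz^(3/4), whose exponent
balances two demands. It is small enough that u differs from its value U(x) on the real axis by at
most 4 lam kap² = 1/4 (`abs_wf_le`), so each horizontal slice x = const is nearly straight. It is
large enough that v grows like sz^(-1/4) towards the edge, so that cosh v carries each slice out to
distance 2 from the axis (`exists_two_le_rf`).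

Hence the signed distance r to the axis can replace y as a coordinate, and the surface consists of
the points (r cos t, r sin t, x) with t = U(x) + ψ(x, r) and |ψ| < π/2. This parametrization
preserves norms, so its part in the unit ball is the image of the unit disk of the (x, r)-plane, and
it is visibly injective. At fixed r ≠ 0 the angle t increases strictly with x
(`exists_hasDerivAt_psiR`), so the halves r > 0 and r < 0 are multi-valued graphs.

For the compact disks U(x) = (lam/a) arctan(x/a). For ±x > 0 this is ±(lam/a)π/2 minus a function
that extends smoothly to a = 0 with value lam/x. The sequence a_i makes the constant a multiple of
2π, so over each half space the disks belong to one jointly smooth family whose member at a = 0 is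
the limit (`contDiffOn_family`). The limit phase -lam/x is unbounded at x = 0, which makes the limit
spiral into the plane.

Away from 0, either sz is bounded below, which bounds k, or r is; in the latter case cosh v must be
large when sz is small, which bounds |A|² and makes the tangent planes nearly horizontal
(`pow_four_le`). Near a point of the punctured plane, minus the reciprocal of the angle between the
limit surface and a point is a transverse coordinate in which the sheets are the slices 1/(kπ),
accumulating at the plane 0. No lamination extends across 0, because each half axis would force 0
into its own leaf. -/

theorem hasFDerivAt_integral_unit {H G : Type} [NormedAddCommGroup H] [NormedSpace ℝ H]
    [NormedAddCommGroup G] [NormedSpace ℝ G] {f : H × ℝ → G} {O : Set (H × ℝ)} (hO : IsOpen O)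
    (hf : ContDiffOn ℝ 1 f O) {x₀ : H} (hx₀ : ∀ s ∈ Icc (0 : ℝ) 1, (x₀, s) ∈ O) :
    HasFDerivAt (fun x => ∫ s in (0 : ℝ)..1, f (x, s))
      (∫ s in (0 : ℝ)..1, (fderiv ℝ f (x₀, s)).comp (ContinuousLinearMap.inl ℝ H ℝ)) x₀ := by
  have hfd : ContinuousOn (fderiv ℝ f) O := hf.continuousOn_fderiv_of_isOpen hO le_rfl
  have hsec : ∀ x : H, Continuous fun s : ℝ => (x, s) := fun x => by fun_prop
  obtain ⟨C, hC⟩ : ∃ C, ∀ s ∈ Icc (0 : ℝ) 1, ‖fderiv ℝ f (x₀, s)‖ ≤ C :=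
    isCompact_Icc.exists_bound_of_continuousOn
      (hfd.comp (hsec x₀).continuousOn fun s hs => hx₀ s hs)
  have hO' : IsOpen (O ∩ (fun p => ‖fderiv ℝ f p‖) ⁻¹' Iio (C + 1)) :=
    hfd.norm.isOpen_inter_preimage hO isOpen_Iio
  -- Compactness of the segment: the bound C on the derivative over it persists, as C + 1, on a
  -- whole tube, and the constant then serves as the dominating function.
  obtain ⟨u, v, hu, -, hxu, hv, huv⟩ := generalized_tube_lemma
    (isCompact_singleton (x := x₀)) (isCompact_Icc (a := (0 : ℝ)) (b := 1)) hO' (by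
      rintro ⟨x, s⟩ ⟨hx, hs⟩
      obtain rfl : x = x₀ := hx
      exact ⟨hx₀ s hs, by simpa using (hC s hs).trans_lt (lt_add_one C)⟩)
  have hI : uIoc (0 : ℝ) 1 ⊆ Icc 0 1 := by
    rw [uIoc_of_le zero_le_one]; exact Ioc_subset_Icc_self
  have hcf : ∀ x ∈ u, ContinuousOn (fun s => f (x, s)) (Icc (0 : ℝ) 1) := fun x hx =>
    hf.continuousOn.comp (hsec x).continuousOn fun s hs => (huv ⟨hx, hv hs⟩).1
  have hcd : ContinuousOn (fun s => (fderiv ℝ f (x₀, s)).comp (ContinuousLinearMap.inl ℝ H ℝ))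
      (Icc (0 : ℝ) 1) :=
    (hfd.comp (hsec x₀).continuousOn fun s hs => hx₀ s hs).clm_comp continuousOn_const
  refine intervalIntegral.hasFDerivAt_integral_of_dominated_of_fderiv_le
    (F := fun x s => f (x, s))
    (F' := fun x s => (fderiv ℝ f (x, s)).comp (ContinuousLinearMap.inl ℝ H ℝ))
    (s := u) (bound := fun _ => (C + 1) * ‖ContinuousLinearMap.inl ℝ H ℝ‖)
    (hu.mem_nhds (hxu rfl)) ?_ ?_ ?_ ?_ ?_ ?_
  · filter_upwards [hu.mem_nhds (hxu rfl)] with x hx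
    exact ((hcf x hx).mono hI).aestronglyMeasurable measurableSet_uIoc
  · exact ((hcf x₀ (hxu rfl)).mono (by simp)).intervalIntegrable
  · exact (hcd.mono hI).aestronglyMeasurable measurableSet_uIoc
  · refine Eventually.of_forall fun s hs x hx => ?_
    refine (ContinuousLinearMap.opNorm_comp_le _ _).trans ?_
    gcongr
    exact (huv ⟨hx, hv (hI hs)⟩).2.le
  · exact intervalIntegrable_const
  · refine Eventually.of_forall fun s hs x hx => ?_
    have h1 : HasFDerivAt f (fderiv ℝ f (x, s)) (x, s) :=
      ((hf.contDiffAt (hO.mem_nhds (huv ⟨hx, hv (hI hs)⟩).1)).differentiableAt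
        one_ne_zero).hasFDerivAt
    exact h1.comp x (hasFDerivAt_prodMk_left x s)

/-- Induction on `n` with the target space left free, since the derivative is an integral of the
same kind with values in a space of linear maps. -/
theorem contDiffOn_integral_unit {H : Type} [NormedAddCommGroup H] [NormedSpace ℝ H] (n : ℕ) :
    ∀ {G : Type} [NormedAddCommGroup G] [NormedSpace ℝ G] {f : H × ℝ → G} {O : Set (H × ℝ)}
    {U : Set H}, IsOpen O → IsOpen U → ContDiffOn ℝ ∞ f O →
    (∀ x ∈ U, ∀ s ∈ Icc (0 : ℝ) 1, (x, s) ∈ O) →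
    ContDiffOn ℝ n (fun x => ∫ s in (0 : ℝ)..1, f (x, s)) U := by
  induction n with
  | zero =>
    intro G _ _ f O U hO hU hf hx
    rw [Nat.cast_zero, contDiffOn_zero]
    exact fun x hxU => (hasFDerivAt_integral_unit hO (hf.of_le (by norm_cast))
      (hx x hxU)).continuousAt.continuousWithinAt
  | succ n ih =>
    intro G _ _ f O U hO hU hf hx
    have hd := fun x hxU => hasFDerivAt_integral_unit hO
      (hf.of_le (by norm_cast)) (hx x hxU)
    rw [Nat.cast_succ, contDiffOn_succ_iff_fderiv_of_isOpen hU]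
    refine ⟨fun x hxU => (hd x hxU).differentiableAt.differentiableWithinAt, by simp, ?_⟩
    have hfd : ContDiffOn ℝ ∞ (fun p => (fderiv ℝ f p).comp (ContinuousLinearMap.inl ℝ H ℝ)) O :=
      (hf.fderiv_of_isOpen hO (by simp)).clm_comp contDiffOn_const
    exact (ih hO hU hfd hx).congr fun x hxU => (hd x hxU).fderiv

/-- The average of `k` over the vertical segment from `(p.1, 0)` to `p`. -/
def avg {H G : Type} [NormedAddCommGroup G] [NormedSpace ℝ G] (k : H × ℝ → G) (p : H × ℝ) : G :=
  ∫ s in (0 : ℝ)..1, k (p.1, s * p.2)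

/-- Star-shapedness in the vertical direction. -/
def VertStar {H : Type} (O : Set (H × ℝ)) : Prop :=
  ∀ p ∈ O, ∀ s ∈ Icc (0 : ℝ) 1, (p.1, s * p.2) ∈ O

section Avg

set_option linter.unusedSectionVars false

variable {H G : Type} [NormedAddCommGroup H] [NormedSpace ℝ H] [NormedAddCommGroup G]
  [NormedSpace ℝ G] {k : H × ℝ → G} {O : Set (H × ℝ)}

theorem contDiff_scaleMap : ContDiff ℝ ∞ fun q : (H × ℝ) × ℝ => (q.1.1, q.2 * q.1.2) := by
  fun_prop

/-- Vertical primitives are written as `p.2 • avg k p`, because the factor `p.2` can then be divided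
out smoothly at height 0; the distance to the axis and the angle of a slice are defined in this way.
-/
theorem contDiffOn_avg (hO : IsOpen O) (hs : VertStar O) (hk : ContDiffOn ℝ ∞ k O) :
    ContDiffOn ℝ ∞ (avg k) O := by
  rw [contDiffOn_infty]
  intro n
  refine contDiffOn_integral_unit n (f := fun q : (H × ℝ) × ℝ => k (q.1.1, q.2 * q.1.2))
    (hO.preimage contDiff_scaleMap.continuous) hO
    (hk.comp contDiff_scaleMap.contDiffOn fun q hq => hq) fun p hp s hs' => hs p hp s hs'

theorem continuousOn_segment (hs : VertStar O) (hk : ContinuousOn k O) {p : H × ℝ} (hp : p ∈ O) :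
    ContinuousOn (fun s : ℝ => k (p.1, s * p.2)) (Icc 0 1) :=
  hk.comp (by fun_prop) fun s hs' => hs p hp s hs'

theorem intervalIntegrable_segment (hs : VertStar O) (hk : ContinuousOn k O) {p : H × ℝ}
    (hp : p ∈ O) :
    IntervalIntegrable (fun s : ℝ => k (p.1, s * p.2)) MeasureTheory.volume 0 1 :=
  ((continuousOn_segment hs hk hp).mono (by simp)).intervalIntegrable

/-- The derivative of `p.2 • avg k p` in a horizontal direction. -/
theorem hasFDerivAt_avg (hO : IsOpen O) (hs : VertStar O) (hk : ContDiffOn ℝ ∞ k O) {p : H × ℝ}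
    (hp : p ∈ O) (ξ : H) : fderiv ℝ (avg k) p (ξ, 0) =
      avg (fun q => fderiv ℝ k q (ξ, 0)) p := by
  have h := hasFDerivAt_integral_unit (f := fun q : (H × ℝ) × ℝ => k (q.1.1, q.2 * q.1.2))
    (hO.preimage contDiff_scaleMap.continuous)
    ((hk.comp contDiff_scaleMap.contDiffOn fun q hq => hq).of_le (by norm_cast))
    (x₀ := p) fun s hs' => hs p hp s hs'
  have h2 : fderiv ℝ (avg k) p = _ := h.fderiv
  rw [h2, ContinuousLinearMap.intervalIntegral_apply]
  · refine intervalIntegral.integral_congr fun s hs' => ?_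
    rw [uIcc_of_le zero_le_one] at hs'
    have h3 : HasFDerivAt k (fderiv ℝ k (p.1, s * p.2)) (p.1, s * p.2) :=
      ((hk.contDiffAt (hO.mem_nhds (hs p hp s hs'))).differentiableAt (by simp)).hasFDerivAt
    have h4 : HasFDerivAt (fun q : (H × ℝ) × ℝ => (q.1.1, q.2 * q.1.2)) _ (p, s) :=
      ((hasFDerivAt_fst (𝕜 := ℝ) (p := (p, s))).fst).prodMk
        ((hasFDerivAt_snd (𝕜 := ℝ) (p := (p, s))).mul (hasFDerivAt_fst (𝕜 := ℝ) (p := (p, s))).snd)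
    have h5 := (h3.comp (p, s) h4).fderiv
    simp only [ContinuousLinearMap.comp_apply]
    have : (fun q : (H × ℝ) × ℝ => k (q.1.1, q.2 * q.1.2)) =
      k ∘ fun q : (H × ℝ) × ℝ => (q.1.1, q.2 * q.1.2) := rfl
    rw [this, h5]
    simp
  · have hc := ((hk.comp contDiff_scaleMap.contDiffOn fun q hq => hq)
      ).continuousOn_fderiv_of_isOpen (hO.preimage contDiff_scaleMap.continuous) (by simp)
    refine ContinuousOn.intervalIntegrable ?_
    refine ContinuousOn.clm_comp (hc.comp (by fun_prop) fun s hs' => ?_) continuousOn_const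
    rw [uIcc_of_le zero_le_one] at hs'
    exact hs p hp s hs'

variable [CompleteSpace G]

theorem smul_avg_eq_integral (p : H × ℝ) :
    p.2 • avg k p = ∫ t in (0 : ℝ)..p.2, k (p.1, t) := by
  have := intervalIntegral.smul_integral_comp_mul_right (a := (0 : ℝ)) (b := 1)
    (fun t => k (p.1, t)) p.2
  simpa [avg] using this

theorem hasDerivAt_smul_avg (hO : IsOpen O) (hs : VertStar O) (hk : ContinuousOn k O)
    {m : H} {y : ℝ} (hp : (m, y) ∈ O) : HasDerivAt (fun t => t • avg k (m, t)) (k (m, y)) y := by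
  have hopen : IsOpen ((fun t : ℝ => (m, t)) ⁻¹' O) := hO.preimage (by fun_prop)
  have hcont : ContinuousOn (fun t => k (m, t)) ((fun t : ℝ => (m, t)) ⁻¹' O) :=
    hk.comp (by fun_prop) fun t ht => ht
  have h1 : ContinuousOn (fun t => k (m, t)) (uIcc 0 y) := by
    refine hcont.mono fun t ht => ?_
    obtain ⟨s, hs', rfl⟩ : ∃ s ∈ Icc (0 : ℝ) 1, s * y = t := by
      rw [← segment_eq_uIcc, segment_eq_image] at ht
      obtain ⟨s, hs', rfl⟩ := ht
      exact ⟨s, hs', by simp⟩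
    exact hs _ hp s hs'
  have h2 : HasDerivAt (fun t => ∫ τ in (0 : ℝ)..t, k (m, τ)) (k (m, y)) y :=
    intervalIntegral.integral_hasDerivAt_right h1.intervalIntegrable
      (hcont.stronglyMeasurableAtFilter hopen y hp)
      (hcont.continuousAt (hopen.mem_nhds hp))
  exact h2.congr_of_eventuallyEq (Eventually.of_forall fun t => smul_avg_eq_integral (m, t))

theorem smul_avg_deriv_eq_sub (hs : VertStar O) {ℓ : H × ℝ → G} (hk : ContinuousOn k O)
    (hℓ : ∀ p ∈ O, HasDerivAt (fun t => ℓ (p.1, t)) (k p) p.2) {p : H × ℝ} (hp : p ∈ O) :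
    p.2 • avg k p = ℓ p - ℓ (p.1, 0) := by
  have h := intervalIntegral.integral_eq_sub_of_hasDerivAt
    (f := fun s : ℝ => ℓ (p.1, s * p.2)) (f' := fun s => p.2 • k (p.1, s * p.2)) (a := 0) (b := 1)
    (fun s hs' => by
      rw [uIcc_of_le zero_le_one] at hs'
      have h1 := hℓ _ (hs p hp s hs')
      have h2 : HasDerivAt (fun s : ℝ => s * p.2) p.2 s := by
        simpa using (hasDerivAt_id s).mul_const p.2
      exact h1.scomp s h2)
    ((intervalIntegrable_segment hs hk hp).smul p.2)
  simpa [avg] using h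

end Avg

/-! ### Fiberwise monotone maps -/

section FiberHomeo

variable {X : Type} [TopologicalSpace X] {g : X × ℝ → ℝ} {O : Set (X × ℝ)}

/-- The intermediate value theorem in each fibre: the values at `y - r` and `y + r` lie strictly on
both sides of the target value, and still do so over nearby base points. Only continuity of `g` is
needed, which matters for the lamination chart. -/
theorem image_mem_nhds_of_fiberMono (hg : ContinuousOn g O)
    (hm : ∀ m, StrictMonoOn (fun y => g (m, y)) {y | (m, y) ∈ O}) {p : X × ℝ} {V : Set (X × ℝ)}
    (hV : IsOpen V) (hVO : V ⊆ O) (hp : p ∈ V) :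
    (fun q => (q.1, g q)) '' V ∈ 𝓝 (p.1, g p) := by
  obtain ⟨m, y⟩ := p
  have h1 : (fun t : ℝ => (m, t)) ⁻¹' V ∈ 𝓝 y := (hV.preimage (by fun_prop)).mem_nhds hp
  obtain ⟨r, hr, hball⟩ := Metric.nhds_basis_closedBall.mem_iff.1 h1
  rw [Real.closedBall_eq_Icc] at hball
  have hsub : ({m} : Set X) ×ˢ Icc (y - r) (y + r) ⊆ V := by
    rintro ⟨m', t⟩ ⟨hm', ht⟩
    obtain rfl : m' = m := hm'
    exact hball ht
  obtain ⟨u, v, hu, -, hmu, hv, huv⟩ := generalized_tube_lemma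
    (isCompact_singleton (x := m)) isCompact_Icc hV hsub
  have hmem : ∀ m' ∈ u, ∀ t ∈ Icc (y - r) (y + r), (m', t) ∈ O :=
    fun m' hm' t ht => hVO (huv ⟨hm', hv ht⟩)
  have hmu' : m ∈ u := hmu rfl
  have hl : y - r ∈ Icc (y - r) (y + r) := ⟨le_rfl, by linarith⟩
  have hr' : y + r ∈ Icc (y - r) (y + r) := ⟨by linarith, le_rfl⟩
  have hyy : y ∈ Icc (y - r) (y + r) := ⟨by linarith, by linarith⟩
  have hc : ∀ t ∈ Icc (y - r) (y + r), ContinuousAt (fun q : X × ℝ => g (q.1, t)) (m, g (m, y)) := by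
    intro t ht
    have h2 : ContinuousOn (fun q : X × ℝ => g (q.1, t)) (u ×ˢ univ) :=
      hg.comp (by fun_prop) fun q hq => hmem q.1 hq.1 t ht
    exact h2.continuousAt ((hu.prod isOpen_univ).mem_nhds ⟨hmu', mem_univ _⟩)
  have e1 := (hc _ hl).eventually_lt continuousAt_snd
    (hm m (hmem m hmu' _ hl) (hmem m hmu' y hyy) (by linarith))
  have e2 := (continuousAt_snd (X := X)).eventually_lt (hc _ hr')
    (hm m (hmem m hmu' y hyy) (hmem m hmu' _ hr') (by linarith))
  have e3 : ∀ᶠ q : X × ℝ in 𝓝 (m, g (m, y)), q.1 ∈ u :=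
    continuousAt_fst.eventually (hu.mem_nhds hmu')
  filter_upwards [e1, e2, e3] with q h1 h2 h3
  have hcont : ContinuousOn (fun t => g (q.1, t)) (Icc (y - r) (y + r)) :=
    hg.comp (by fun_prop) fun t ht => hmem q.1 h3 t ht
  obtain ⟨t, ht, hgt⟩ := intermediate_value_Icc (by linarith) hcont ⟨h1.le, h2.le⟩
  exact ⟨(q.1, t), huv ⟨h3, hv ht⟩, Prod.ext rfl hgt⟩

/-- The local homeomorphism `(m, y) ↦ (m, g (m, y))` for `g` strictly increasing in `y`. -/
def fiberHomeo (g : X × ℝ → ℝ) (O : Set (X × ℝ)) (hO : IsOpen O) (hg : ContinuousOn g O)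
    (hm : ∀ m, StrictMonoOn (fun y => g (m, y)) {y | (m, y) ∈ O}) :
    OpenPartialHomeomorph (X × ℝ) (X × ℝ) where
  toFun q := (q.1, g q)
  invFun q := (q.1, Function.invFunOn (fun y => g (q.1, y)) {y | (q.1, y) ∈ O} q.2)
  source := O
  target := (fun q => (q.1, g q)) '' O
  map_source' q hq := ⟨q, hq, rfl⟩
  map_target' := by
    rintro _ ⟨q, hq, rfl⟩
    exact Function.invFunOn_mem (f := fun y => g (q.1, y)) (s := {y | (q.1, y) ∈ O}) ⟨q.2, hq, rfl⟩
  left_inv' q hq := Prod.ext rfl ((hm q.1).injOn.leftInvOn_invFunOn hq)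
  right_inv' := by
    rintro _ ⟨q, hq, rfl⟩
    exact Prod.ext rfl (Function.invFunOn_eq (f := fun y => g (q.1, y)) ⟨q.2, hq, rfl⟩)
  open_source := hO
  open_target := by
    rw [isOpen_iff_mem_nhds]
    rintro _ ⟨q, hq, rfl⟩
    exact image_mem_nhds_of_fiberMono hg hm hO subset_rfl hq
  continuousOn_toFun := continuousOn_fst.prodMk hg
  continuousOn_invFun := by
    rintro _ ⟨q, hq, rfl⟩
    refine ContinuousAt.continuousWithinAt fun V hV => ?_
    rw [show (q.1, Function.invFunOn (fun y => g (q.1, y)) {y | (q.1, y) ∈ O} (g q)) = q from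
      Prod.ext rfl ((hm q.1).injOn.leftInvOn_invFunOn hq)] at hV
    obtain ⟨V', hV', hopen, hqV⟩ := mem_nhds_iff.1 hV
    refine mem_map.2 (mem_of_superset (image_mem_nhds_of_fiberMono hg hm (hopen.inter hO)
      inter_subset_right ⟨hqV, hq⟩) ?_)
    rintro _ ⟨z, hz, rfl⟩
    refine hV' ?_
    change (z.1, Function.invFunOn (fun y => g (z.1, y)) {y | (z.1, y) ∈ O} (g z)) ∈ V'
    rw [show (z.1, Function.invFunOn (fun y => g (z.1, y)) {y | (z.1, y) ∈ O} (g z)) = z from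
      Prod.ext rfl ((hm z.1).injOn.leftInvOn_invFunOn hz.2)]
    exact hz.1

variable (hO : IsOpen O) (hg : ContinuousOn g O)
    (hm : ∀ m, StrictMonoOn (fun y => g (m, y)) {y | (m, y) ∈ O})

theorem fiberHomeo_symm_spec {q : X × ℝ} (hq : q ∈ (fiberHomeo g O hO hg hm).target) :
    (q.1, ((fiberHomeo g O hO hg hm).symm q).2) ∈ O ∧
      g (q.1, ((fiberHomeo g O hO hg hm).symm q).2) = q.2 :=
  ⟨(fiberHomeo g O hO hg hm).map_target hq,
    congrArg Prod.snd ((fiberHomeo g O hO hg hm).right_inv hq)⟩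

theorem fiberHomeo_symm_eq {m : X} {y : ℝ} (hy : (m, y) ∈ O) :
    ((fiberHomeo g O hO hg hm).symm (m, g (m, y))).2 = y :=
  congrArg Prod.snd ((fiberHomeo g O hO hg hm).left_inv hy)

theorem mem_fiberHomeo_target {q : X × ℝ} :
    q ∈ (fiberHomeo g O hO hg hm).target ↔ ∃ y, (q.1, y) ∈ O ∧ g (q.1, y) = q.2 := by
  constructor
  · rintro ⟨z, hz, rfl⟩
    exact ⟨z.2, hz, rfl⟩
  · rintro ⟨y, hy, h⟩
    exact ⟨(q.1, y), hy, Prod.ext rfl h⟩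

end FiberHomeo

/-! ### Smooth inverses of fibrewise monotone maps -/

section FiberSmooth

variable {X : Type} [NormedAddCommGroup X] [NormedSpace ℝ X] [CompleteSpace X] {g : X × ℝ → ℝ}
  {O : Set (X × ℝ)} (hO : IsOpen O) (hg : ContinuousOn g O)
  (hm : ∀ m, StrictMonoOn (fun y => g (m, y)) {y | (m, y) ∈ O})

/-- A vertical shear which is invertible because the vertical derivative does not vanish. -/
def shearEquiv (L : X × ℝ →L[ℝ] ℝ) (hL : L (0, 1) ≠ 0) : (X × ℝ) ≃L[ℝ] (X × ℝ) :=
  ContinuousLinearEquiv.equivOfInverse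
    ((ContinuousLinearMap.fst ℝ X ℝ).prod L)
    ((ContinuousLinearMap.fst ℝ X ℝ).prod ((L (0, 1))⁻¹ • (ContinuousLinearMap.snd ℝ X ℝ -
      L.comp ((ContinuousLinearMap.inl ℝ X ℝ).comp (ContinuousLinearMap.fst ℝ X ℝ)))))
    (fun z => by
      have h : L z = L (z.1, 0) + z.2 * L (0, 1) := by
        rw [← smul_eq_mul, ← map_smul, ← map_add]; simp
      refine Prod.ext rfl ?_
      change (L (0, 1))⁻¹ * (L z - L (z.1, 0)) = z.2
      rw [h]
      field_simp
      ring)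
    (fun z => by
      have h : ∀ t : ℝ, L (z.1, t) = L (z.1, 0) + t * L (0, 1) := fun t => by
        rw [← smul_eq_mul, ← map_smul, ← map_add]; simp
      refine Prod.ext rfl ?_
      change L (z.1, (L (0, 1))⁻¹ * (z.2 - L (z.1, 0))) = z.2
      rw [h]
      field_simp
      ring)

/-- The inverse function theorem: the derivative of (m, y) ↦ (m, g(m, y)) is the vertical shear
`shearEquiv`, invertible because the vertical derivative of `g` is nonzero. -/
theorem contDiffOn_fiberHomeo_symm (hsm : ContDiffOn ℝ ∞ g O)
    (hd : ∀ p ∈ O, fderiv ℝ g p (0, 1) ≠ 0) :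
    ContDiffOn ℝ ∞ (fiberHomeo g O hO hg hm).symm (fiberHomeo g O hO hg hm).target := by
  intro q hq
  refine ContDiffAt.contDiffWithinAt ?_
  have hz := (fiberHomeo g O hO hg hm).map_target hq
  have hgc : ContDiffAt ℝ ∞ g ((fiberHomeo g O hO hg hm).symm q) := hsm.contDiffAt (hO.mem_nhds hz)
  refine (fiberHomeo g O hO hg hm).contDiffAt_symm (f₀' := shearEquiv _ (hd _ hz)) hq ?_ ?_
  · exact hasFDerivAt_fst.prodMk (hgc.differentiableAt (by simp)).hasFDerivAt
  · exact contDiffAt_fst.prodMk hgc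

end FiberSmooth

/-! ### Smooth families converge with all derivatives -/

/-- Up to the currying isometry, the next partial derivative is the partial derivative of a jointly
smooth map, hence again jointly smooth. -/
theorem contDiffOn_partial_iteratedFDeriv {E G : Type} [NormedAddCommGroup E] [NormedSpace ℝ E]
    [NormedAddCommGroup G] [NormedSpace ℝ G] {f : ℝ × E → G} {O : Set (ℝ × E)} (hO : IsOpen O)
    (hf : ContDiffOn ℝ ∞ f O) (k : ℕ) :
    ContDiffOn ℝ ∞ (fun p : ℝ × E => iteratedFDeriv ℝ k (fun z => f (p.1, z)) p.2) O := by
  induction k with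
  | zero =>
    have h : ∀ p : ℝ × E, iteratedFDeriv ℝ 0 (fun z => f (p.1, z)) p.2 =
      (continuousMultilinearCurryFin0 ℝ E G).symm (f p) := fun p => by
        rw [iteratedFDeriv_zero_eq_comp]; rfl
    simp only [h]
    exact (continuousMultilinearCurryFin0 ℝ E G).symm.contDiff.comp_contDiffOn hf
  | succ k ih =>
    have h : ∀ p : ℝ × E, iteratedFDeriv ℝ (k + 1) (fun z => f (p.1, z)) p.2 =
      (continuousMultilinearCurryLeftEquiv ℝ (fun _ : Fin (k + 1) => E) G).symm
        (fderiv ℝ (iteratedFDeriv ℝ k (fun z => f (p.1, z))) p.2) := fun p => by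
        rw [iteratedFDeriv_succ_eq_comp_left]; rfl
    simp only [h]
    let e : (E →L[ℝ] E [×k]→L[ℝ] G) ≃ₗᵢ[ℝ] (E [×(k + 1)]→L[ℝ] G) :=
      (continuousMultilinearCurryLeftEquiv ℝ (fun _ : Fin (k + 1) => E) G).symm
    have he : ContDiff ℝ ∞ e := LinearIsometryEquiv.contDiff (𝕜 := ℝ)
      (E := E →L[ℝ] E [×k]→L[ℝ] G) (F := E [×(k + 1)]→L[ℝ] G) e
    refine he.comp_contDiffOn (s := O) (f := fun p : ℝ × E =>
      fderiv ℝ (iteratedFDeriv ℝ k (fun z => f (p.1, z))) p.2)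
      fun p hp => ContDiffAt.contDiffWithinAt ?_
    refine ContDiffAt.fderiv (n := ∞)
      (f := fun (p : ℝ × E) (w : E) => iteratedFDeriv ℝ k (fun z => f (p.1, z)) w)
      (g := fun p : ℝ × E => p.2) ?_ contDiffAt_snd (by simp)
    have h1 : ContDiffAt ℝ ∞ (fun p : ℝ × E => iteratedFDeriv ℝ k (fun z => f (p.1, z)) p.2)
      (p.1, p.2) := ih.contDiffAt (hO.mem_nhds hp)
    exact h1.comp ((p, p.2) : (ℝ × E) × E) (contDiffAt_fst.fst.prodMk contDiffAt_snd)

/-- This reduces smooth convergence to joint smoothness of a one-parameter family that contains the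
limit at parameter 0: joint continuity of the k-th derivative at (0, q) is already uniformity near
q. -/
theorem tendstoLocallyUniformlyOn_iteratedFDeriv {E G : Type} [NormedAddCommGroup E]
    [NormedSpace ℝ E] [NormedAddCommGroup G] [NormedSpace ℝ G] {f : ℝ × E → G} {O : Set (ℝ × E)}
    (hO : IsOpen O) (hf : ContDiffOn ℝ ∞ f O) {a : ℕ → ℝ} (ha : Tendsto a atTop (𝓝 0))
    {D : Set E} (hD : ∀ q ∈ D, ((0 : ℝ), q) ∈ O) (k : ℕ) :
    TendstoLocallyUniformlyOn (fun i => iteratedFDeriv ℝ k fun z => f (a i, z))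
      (iteratedFDeriv ℝ k fun z => f (0, z)) atTop D := by
  rw [Metric.tendstoLocallyUniformlyOn_iff]
  intro ε hε q hq
  have hc : ContinuousAt (fun p : ℝ × E => iteratedFDeriv ℝ k (fun z => f (p.1, z)) p.2) (0, q) :=
    (contDiffOn_partial_iteratedFDeriv hO hf k).continuousOn.continuousAt (hO.mem_nhds (hD q hq))
  have h1 := Metric.tendsto_nhds.1 hc (ε / 2) (half_pos hε)
  rw [nhds_prod_eq, eventually_prod_iff] at h1
  obtain ⟨pa, hpa, pb, hpb, hab⟩ := h1
  refine ⟨{y | pb y}, mem_nhdsWithin_of_mem_nhds hpb, ?_⟩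
  filter_upwards [ha.eventually hpa] with i hi y hy
  have h2 := hab hi hy
  have h3 := hab hpa.self_of_nhds hy
  calc _ ≤ _ := dist_triangle_right _ _ _
    _ < ε / 2 + ε / 2 := add_lt_add h3 h2
    _ = ε := add_halves ε

/-! ### The shape operator under a change of parameters -/

theorem inner_space (v w : Space) : inner ℝ v w = v 0 * w 0 + v 1 * w 1 + v 2 * w 2 := by
  simp [PiLp.inner_apply, Fin.sum_univ_three]
  ring

theorem cross_apply (v w : Space) :
    cross v w = !₂[v 1 * w 2 - v 2 * w 1, v 2 * w 0 - v 0 * w 2, v 0 * w 1 - v 1 * w 0] := by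
  simp [cross, crossProduct]

theorem cross_linearComb (v w : Space) (a b c d : ℝ) :
    cross (a • v + b • w) (c • v + d • w) = (a * d - b * c) • cross v w := by
  simp only [cross_apply]
  ext i
  fin_cases i <;> simp <;> ring

theorem inner_cross_left (v w : Space) : inner ℝ v (cross v w) = 0 := by
  simp [inner_space, cross_apply]; ring

theorem inner_cross_right (v w : Space) : inner ℝ w (cross v w) = 0 := by
  simp [inner_space, cross_apply]; ring

theorem inner_partialD_unitNormal (F : Plane → Space) (p : Plane) (l : Fin 2) :
    inner ℝ (partialD l F p) (unitNormal F p) = 0 := by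
  rw [unitNormal, inner_smul_right]
  fin_cases l
  · exact mul_eq_zero_of_right _ (inner_cross_left _ _)
  · exact mul_eq_zero_of_right _ (inner_cross_right _ _)

theorem plane_eq_sum (w : Plane) : w = w 0 • EuclideanSpace.single 0 1 +
    w 1 • EuclideanSpace.single 1 1 := by
  ext i
  fin_cases i <;> simp

theorem clm_plane_apply {G : Type*} [NormedAddCommGroup G] [NormedSpace ℝ G]
    (L : Plane →L[ℝ] G) (w : Plane) :
    L w = w 0 • L (EuclideanSpace.single 0 1) + w 1 • L (EuclideanSpace.single 1 1) := by
  conv_lhs => rw [plane_eq_sum w]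
  simp

/-- The Jacobian matrix of a change of parameters. -/
def jacobian (φ : Plane → Plane) (q : Plane) : Matrix (Fin 2) (Fin 2) ℝ :=
  Matrix.of fun l k => fderiv ℝ φ q (EuclideanSpace.single k 1) l

section Reparam

variable {F f : Plane → Space} {φ : Plane → Plane} {q : Plane}
  (hφ : ContDiffAt ℝ ∞ φ q) (hF : ContDiffAt ℝ ∞ F (φ q)) (hf : f =ᶠ[𝓝 q] F ∘ φ)

include hφ hF hf

theorem partialD_reparam (k : Fin 2) :
    partialD k f q = jacobian φ q 0 k • partialD 0 F (φ q) +
      jacobian φ q 1 k • partialD 1 F (φ q) := by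
  rw [partialD, hf.fderiv_eq, fderiv_comp q (hF.differentiableAt (by simp))
    (hφ.differentiableAt (by simp)), ContinuousLinearMap.comp_apply, clm_plane_apply]
  rfl

theorem eventually_partialD_reparam (k : Fin 2) :
    ∀ᶠ z in 𝓝 q, partialD k f z = fderiv ℝ φ z (EuclideanSpace.single k 1) 0 •
      partialD 0 F (φ z) + fderiv ℝ φ z (EuclideanSpace.single k 1) 1 • partialD 1 F (φ z) := by
  have h1 : ∀ᶠ z in 𝓝 q, ContDiffAt ℝ 1 φ z :=
    (hφ.of_le (by norm_cast)).eventually (by simp)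
  have h2 : ∀ᶠ z in 𝓝 q, ContDiffAt ℝ 1 F (φ z) :=
    hφ.continuousAt.eventually ((hF.of_le (by norm_cast)).eventually (by simp))
  filter_upwards [h1, h2, hf.eventually_nhds] with z h3 h4 h5
  rw [partialD, Filter.EventuallyEq.fderiv_eq h5, fderiv_comp z (h4.differentiableAt (by simp))
    (h3.differentiableAt (by simp)), ContinuousLinearMap.comp_apply, clm_plane_apply]
  rfl

theorem unitNormal_reparam : unitNormal f q =
    (|(jacobian φ q).det|⁻¹ * (jacobian φ q).det) • unitNormal F (φ q) := by
  rw [unitNormal, unitNormal, partialD_reparam hφ hF hf 0, partialD_reparam hφ hF hf 1,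
    cross_linearComb, Matrix.det_fin_two, norm_smul, mul_inv, smul_smul, smul_smul,
    Real.norm_eq_abs, mul_comm (jacobian φ q 1 0)]
  congr 1
  ring

theorem firstForm_reparam : firstForm f q =
    (jacobian φ q).transpose * firstForm F (φ q) * jacobian φ q := by
  ext j k
  simp only [firstForm, Matrix.mul_apply, Fin.sum_univ_two, Matrix.of_apply,
    Matrix.transpose_apply, partialD_reparam hφ hF hf, inner_add_left, inner_add_right,
    inner_smul_left, inner_smul_right, RCLike.conj_to_real]
  ring

/-- Second derivatives of the parameter change contribute only tangential terms, which the normal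
annihilates. The sign of the Jacobian is the one by which the two unit normals differ. -/
theorem secondForm_reparam : secondForm f q = (|(jacobian φ q).det|⁻¹ * (jacobian φ q).det) •
    ((jacobian φ q).transpose * secondForm F (φ q) * jacobian φ q) := by
  ext j k
  have hd : ∀ l : Fin 2, DifferentiableAt ℝ
      (fun z => fderiv ℝ φ z (EuclideanSpace.single k 1) l) q := fun l => by
    have h1 : DifferentiableAt ℝ (fderiv ℝ φ) q :=
      (hφ.fderiv_right (m := 1) (by norm_cast)).differentiableAt (by simp)
    have h2 : DifferentiableAt ℝ (fun z => fderiv ℝ φ z (EuclideanSpace.single k 1)) q :=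
      h1.clm_apply (differentiableAt_const _)
    exact ((EuclideanSpace.proj (𝕜 := ℝ) l : Plane →L[ℝ] ℝ).differentiableAt).comp q h2
  have hD : ∀ l : Fin 2, DifferentiableAt ℝ (partialD l F) (φ q) := fun l => by
    have h1 : DifferentiableAt ℝ (fderiv ℝ F) (φ q) :=
      (hF.fderiv_right (m := 1) (by norm_cast)).differentiableAt (by simp)
    exact h1.clm_apply (differentiableAt_const _)
  have hφd := hφ.differentiableAt (by simp)
  have hcomp : ∀ l : Fin 2, HasFDerivAt (fun z => partialD l F (φ z)) _ q := fun l =>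
    (hD l).hasFDerivAt.comp q hφd.hasFDerivAt
  have key : partialD j (partialD k f) q =
      (jacobian φ q 0 k • fderiv ℝ (partialD 0 F) (φ q)
        (fderiv ℝ φ q (EuclideanSpace.single j 1)) +
        fderiv ℝ (fun z => fderiv ℝ φ z (EuclideanSpace.single k 1) 0) q
          (EuclideanSpace.single j 1) • partialD 0 F (φ q)) +
      (jacobian φ q 1 k • fderiv ℝ (partialD 1 F) (φ q)
        (fderiv ℝ φ q (EuclideanSpace.single j 1)) +
        fderiv ℝ (fun z => fderiv ℝ φ z (EuclideanSpace.single k 1) 1) q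
          (EuclideanSpace.single j 1) • partialD 1 F (φ q)) := by
    have h := (((hd 0).hasFDerivAt.smul (hcomp 0)).add
      ((hd 1).hasFDerivAt.smul (hcomp 1))).congr_of_eventuallyEq
      (eventually_partialD_reparam hφ hF hf k)
    rw [partialD, h.fderiv]
    rfl
  simp only [secondForm, Matrix.of_apply, key, unitNormal_reparam hφ hF hf, Matrix.smul_apply,
    Matrix.mul_apply, Fin.sum_univ_two, Matrix.transpose_apply, inner_add_left, inner_smul_left,
    inner_smul_right, inner_partialD_unitNormal, RCLike.conj_to_real, smul_eq_mul]
  rw [clm_plane_apply (fderiv ℝ (partialD 0 F) (φ q)),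
    clm_plane_apply (fderiv ℝ (partialD 1 F) (φ q))]
  simp only [inner_add_left, inner_smul_left, RCLike.conj_to_real]
  change _ = _ * (((jacobian φ q 0 j) * inner ℝ (fderiv ℝ (partialD 0 F) (φ q) _) _ + _) * _ + _)
  simp only [jacobian, Matrix.of_apply, partialD]
  ring

variable (hdet : (jacobian φ q).det ≠ 0)
include hdet

/-- Up to sign the shape operator is conjugated by the Jacobian, so vanishing of its trace and the
trace of its square are independent of parameters. -/
theorem shapeOperator_reparam : shapeOperator f q =
    (|(jacobian φ q).det|⁻¹ * (jacobian φ q).det) •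
      ((jacobian φ q)⁻¹ * shapeOperator F (φ q) * jacobian φ q) := by
  have hu : IsUnit (jacobian φ q).det := isUnit_iff_ne_zero.2 hdet
  rw [shapeOperator, shapeOperator, firstForm_reparam hφ hF hf, secondForm_reparam hφ hF hf,
    Matrix.mul_inv_rev, Matrix.mul_inv_rev, Matrix.mul_smul]
  congr 1
  simp only [Matrix.mul_assoc]
  rw [← Matrix.mul_assoc ((jacobian φ q).transpose)⁻¹, Matrix.nonsing_inv_mul _ (by
    rwa [Matrix.det_transpose]), Matrix.one_mul]

theorem meanCurvature_reparam (h0 : meanCurvature F (φ q) = 0) : meanCurvature f q = 0 := by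
  have hu : IsUnit (jacobian φ q).det := isUnit_iff_ne_zero.2 hdet
  rw [meanCurvature, div_eq_zero_iff] at h0 ⊢
  left
  have h0 := h0.resolve_right two_ne_zero
  rw [shapeOperator_reparam hφ hF hf hdet, Matrix.trace_smul, Matrix.trace_mul_cycle,
    Matrix.mul_nonsing_inv _ hu, Matrix.one_mul, h0, smul_zero]

omit hφ hF hf in
theorem sign_sq : |(jacobian φ q).det|⁻¹ * (jacobian φ q).det *
    (|(jacobian φ q).det|⁻¹ * (jacobian φ q).det) = 1 := by
  have : |(jacobian φ q).det| ≠ 0 := abs_ne_zero.2 hdet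
  field_simp
  rw [sq_abs]

theorem normSqA_reparam : normSqA f q = normSqA F (φ q) := by
  have hu : IsUnit (jacobian φ q).det := isUnit_iff_ne_zero.2 hdet
  rw [normSqA, normSqA, shapeOperator_reparam hφ hF hf hdet, Matrix.smul_mul, Matrix.mul_smul,
    smul_smul, sign_sq hdet, one_smul]
  rw [show ∀ J S : Matrix (Fin 2) (Fin 2) ℝ, J⁻¹ * S * J * (J⁻¹ * S * J) =
    J⁻¹ * (S * (J * J⁻¹) * S) * J from fun J S => by simp only [Matrix.mul_assoc],
    Matrix.mul_nonsing_inv _ hu, Matrix.mul_one, Matrix.trace_mul_cycle,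
    Matrix.mul_nonsing_inv _ hu, Matrix.one_mul]

theorem abs_unitNormal_reparam (i : Fin 3) : |unitNormal f q i| = |unitNormal F (φ q) i| := by
  rw [unitNormal_reparam hφ hF hf, PiLp.smul_apply, smul_eq_mul, abs_mul]
  have h := congrArg abs (sign_sq hdet)
  rw [abs_mul, abs_one, mul_self_eq_one_iff] at h
  rcases h with h | h
  · rw [h, one_mul]
  · linarith [abs_nonneg (|(jacobian φ q).det|⁻¹ * (jacobian φ q).det)]

end Reparam

/-- A change of parameters with a differentiable local left inverse has invertible Jacobian. -/
theorem jacobian_det_ne_zero {φ : Plane → Plane} {q : Plane}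
    (h : Function.Injective (fderiv ℝ φ q)) : (jacobian φ q).det ≠ 0 := by
  intro h0
  obtain ⟨v, hv, hv0⟩ := Matrix.exists_mulVec_eq_zero_iff.2 h0
  have h1 : fderiv ℝ φ q (WithLp.toLp 2 v) = 0 := by
    rw [clm_plane_apply]
    ext l
    have := congrFun hv0 l
    simp only [Matrix.mulVec, dotProduct, Fin.sum_univ_two, jacobian, Matrix.of_apply,
      Pi.zero_apply] at this
    simp only [PiLp.add_apply, PiLp.smul_apply, smul_eq_mul, PiLp.zero_apply]
    linarith
  have h2 : WithLp.toLp 2 v = (0 : Plane) := h (by rw [h1, map_zero])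
  exact hv (by simpa using congrArg WithLp.ofLp h2)

/-! ### Vertical primitives -/

/-- Points `((a, x), y)`: the parameter `a` of the family and the variable `z = x + i y`. -/
abbrev Pt := (ℝ × ℝ) × ℝ

/-- The primitive of `k` in the variable `y` which vanishes at `y = 0`. -/
def vint (k : Pt → ℝ) (p : Pt) : ℝ := p.2 * avg k p

section Vint

variable {k k' : Pt → ℝ} {O : Set Pt}

theorem contDiffOn_vint (hO : IsOpen O) (hs : VertStar O) (hk : ContDiffOn ℝ ∞ k O) :
    ContDiffOn ℝ ∞ (vint k) O :=
  contDiffOn_snd.mul (contDiffOn_avg hO hs hk)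

theorem hasDerivAt_vint_y (hO : IsOpen O) (hs : VertStar O) (hk : ContinuousOn k O) {m : ℝ × ℝ}
    {y : ℝ} (hp : (m, y) ∈ O) : HasDerivAt (fun t => vint k (m, t)) (k (m, y)) y :=
  hasDerivAt_smul_avg hO hs hk hp

theorem hasDerivAt_vint_x (hO : IsOpen O) (hs : VertStar O) (hk : ContDiffOn ℝ ∞ k O)
    (hk' : ∀ a x y : ℝ, ((a, x), y) ∈ O →
      HasDerivAt (fun t => k ((a, t), y)) (k' ((a, x), y)) x)
    {a x y : ℝ} (hp : ((a, x), y) ∈ O) :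
    HasDerivAt (fun t => vint k ((a, t), y)) (vint k' ((a, x), y)) x := by
  have hsec : ∀ x y : ℝ, HasDerivAt (fun t : ℝ => (((a, t), y) : Pt)) ((0, 1), 0) x := fun x y =>
    ((hasDerivAt_const x a).prodMk (hasDerivAt_id x)).prodMk (hasDerivAt_const x y)
  have h1 : HasDerivAt (fun t => avg k ((a, t), y)) (fderiv ℝ (avg k) ((a, x), y) ((0, 1), 0)) x :=
    HasFDerivAt.comp_hasDerivAt (f := fun t => (((a, t), y) : Pt)) x
      (((contDiffOn_avg hO hs hk).contDiffAt (hO.mem_nhds hp)).differentiableAt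
        (by simp)).hasFDerivAt (hsec x y)
  rw [hasFDerivAt_avg hO hs hk hp] at h1
  have h2 : avg (fun q => fderiv ℝ k q ((0, 1), 0)) ((a, x), y) = avg k' ((a, x), y) := by
    refine intervalIntegral.integral_congr fun s hs' => ?_
    rw [uIcc_of_le zero_le_one] at hs'
    have hm : ((a, x), s * y) ∈ O := hs _ hp s hs'
    have h3 : HasDerivAt (fun t => k ((a, t), s * y))
        (fderiv ℝ k ((a, x), s * y) ((0, 1), 0)) x :=
      HasFDerivAt.comp_hasDerivAt (f := fun t => (((a, t), s * y) : Pt)) x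
        ((hk.contDiffAt (hO.mem_nhds hm)).differentiableAt (by simp)).hasFDerivAt (hsec x _)
    exact h3.unique (hk' a x _ hm)
  rw [h2] at h1
  exact h1.const_mul y

theorem vint_eq_sub (hs : VertStar O) {ℓ : Pt → ℝ} (hk : ContinuousOn k O)
    (hℓ : ∀ a x y : ℝ, ((a, x), y) ∈ O →
      HasDerivAt (fun t => ℓ ((a, x), t)) (k ((a, x), y)) y) {p : Pt} (hp : p ∈ O) :
    vint k p = ℓ p - ℓ (p.1, 0) :=
  smul_avg_deriv_eq_sub hs hk (fun q hq => hℓ q.1.1 q.1.2 q.2 hq) hp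

theorem vint_add_mul (hs : VertStar O) (hk : ContinuousOn k O) (hk' : ContinuousOn k' O)
    (b : ℝ × ℝ → ℝ) {p : Pt} (hp : p ∈ O) :
    vint (fun q => k q + b q.1 * k' q) p = vint k p + b p.1 * vint k' p := by
  have h1 := intervalIntegrable_segment hs hk hp
  have h2 := (intervalIntegrable_segment hs hk' hp).const_mul (b p.1)
  simp only [vint, avg]
  rw [intervalIntegral.integral_add h1 h2, intervalIntegral.integral_const_mul]
  ring

end Vint

/-! ### The Weierstrass data -/

/-- The size of the curvature of the family. -/
def lam : ℝ := 2 ^ 20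

/-- The relative width of the parameter domain. -/
def kap : ℝ := 1 / 4096

/-- `x² + a²`. -/
def sz (m : ℝ × ℝ) : ℝ := m.2 ^ 2 + m.1 ^ 2

/-- The domain on which the Weierstrass data `k = lam / (z² + a²)`, `z = x + i y`, is used. -/
def wDom : Set Pt := {p | p.2 ^ 4 < kap ^ 4 * sz p.1 ^ 3 ∧ sz p.1 < 4}

/-- `|z² + a²|²`. -/
def wN (p : Pt) : ℝ := (sz p.1 - p.2 ^ 2) ^ 2 + (2 * p.1.2 * p.2) ^ 2

/-- The real part of `lam / (z² + a²)`. -/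
def kr (p : Pt) : ℝ := lam * (sz p.1 - p.2 ^ 2) / wN p

/-- The imaginary part of `lam / (z² + a²)`. -/
def ki (p : Pt) : ℝ := -(lam * (2 * p.1.2 * p.2)) / wN p

theorem sz_nonneg (m : ℝ × ℝ) : 0 ≤ sz m := by unfold sz; positivity

theorem isOpen_wDom : IsOpen wDom := by
  have h : Continuous fun p : Pt => sz p.1 := by unfold sz; fun_prop
  exact (isOpen_lt (continuous_snd.pow 4) (continuous_const.mul (h.pow 3))).inter (isOpen_lt h continuous_const)

theorem vertStar_wDom : VertStar wDom := by
  rintro ⟨m, y⟩ ⟨h1, h2⟩ s ⟨hs0, hs1⟩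
  refine ⟨lt_of_le_of_lt ?_ h1, h2⟩
  have : s ^ 4 ≤ 1 := pow_le_one₀ hs0 hs1
  calc (s * y) ^ 4 = s ^ 4 * y ^ 4 := by ring
    _ ≤ 1 * y ^ 4 := by gcongr
    _ = y ^ 4 := one_mul _

theorem sz_pos {p : Pt} (hp : p ∈ wDom) : 0 < sz p.1 := by
  by_contra h
  have h0 : sz p.1 = 0 := le_antisymm (not_lt.1 h) (sz_nonneg _)
  have h1 := hp.1
  rw [h0] at h1
  have : 0 ≤ p.2 ^ 4 := by positivity
  simp at h1
  linarith

/-- From y² < kap² sz^(3/2) and sz < 4, y² is negligible against sz. In particular the poles ±ia of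
k are avoided, and |z² + a²| is comparable to sz. -/
theorem sq_y_le {p : Pt} (hp : p ∈ wDom) : p.2 ^ 2 ≤ sz p.1 / 1000000 := by
  have h0 := sz_pos hp
  refine abs_le_of_sq_le_sq' ?_ (by positivity) |>.2
  have h1 := hp.1
  have h2 := hp.2
  have h3 : kap ^ 4 * sz p.1 ^ 3 ≤ (sz p.1 / 1000000) ^ 2 := by
    have : kap ^ 4 * 4 ≤ 1 / 1000000 ^ 2 := by norm_num [kap]
    nlinarith [sq_nonneg (sz p.1), mul_le_mul_of_nonneg_right this (sq_nonneg (sz p.1)),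
      mul_pos (mul_pos h0 h0) (sub_pos.2 h2), show 0 < kap ^ 4 by norm_num [kap],
      mul_pos (show 0 < kap ^ 4 by norm_num [kap]) (mul_pos (mul_pos h0 h0) (sub_pos.2 h2))]
  calc (p.2 ^ 2) ^ 2 = p.2 ^ 4 := by ring
    _ ≤ _ := h1.le.trans h3

/-- The exponent 3/4 of the domain is made for this: |x| ≤ sz^(1/2) and y² ≤ kap² sz^(3/2) multiply
to exactly sz². -/
theorem abs_x_mul_sq_y_le {p : Pt} (hp : p ∈ wDom) : |p.1.2| * p.2 ^ 2 ≤ kap ^ 2 * sz p.1 ^ 2 := by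
  have h0 := sz_pos hp
  refine abs_le_of_sq_le_sq' ?_ (by positivity) |>.2
  have h1 : p.1.2 ^ 2 ≤ sz p.1 := by unfold sz; nlinarith [sq_nonneg p.1.1]
  calc (|p.1.2| * p.2 ^ 2) ^ 2 = p.1.2 ^ 2 * p.2 ^ 4 := by rw [mul_pow, sq_abs]; ring
    _ ≤ sz p.1 * (kap ^ 4 * sz p.1 ^ 3) := by gcongr; exact hp.1.le
    _ = _ := by ring

theorem le_wN {p : Pt} (hp : p ∈ wDom) : sz p.1 ^ 2 / 2 ≤ wN p := by
  have h0 := sz_pos hp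
  have h1 := sq_y_le hp
  unfold wN
  nlinarith [sq_nonneg (2 * p.1.2 * p.2), sq_nonneg p.2, mul_nonneg h0.le (sq_nonneg p.2)]

theorem wN_le {p : Pt} (hp : p ∈ wDom) : wN p ≤ 3 / 2 * sz p.1 ^ 2 := by
  have h0 := sz_pos hp
  have h1 := sq_y_le hp
  have h2 : p.1.2 ^ 2 ≤ sz p.1 := by unfold sz; nlinarith [sq_nonneg p.1.1]
  have h3 : p.1.2 ^ 2 * p.2 ^ 2 ≤ sz p.1 * (sz p.1 / 1000000) := by gcongr
  unfold wN
  nlinarith [sq_nonneg p.2, mul_nonneg h0.le (sq_nonneg p.2)]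

theorem wN_pos {p : Pt} (hp : p ∈ wDom) : 0 < wN p :=
  lt_of_lt_of_le (by have := sz_pos hp; positivity) (le_wN hp)

theorem lam_pos : 0 < lam := by norm_num [lam]

theorem le_kr {p : Pt} (hp : p ∈ wDom) : lam / (2 * sz p.1) ≤ kr p := by
  have h0 := sz_pos hp
  have h1 := sq_y_le hp
  rw [kr, div_le_div_iff₀ (by positivity) (wN_pos hp), mul_assoc]
  refine mul_le_mul_of_nonneg_left ?_ lam_pos.le
  nlinarith [wN_le hp]

theorem kr_pos {p : Pt} (hp : p ∈ wDom) : 0 < kr p :=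
  lt_of_lt_of_le (by have := sz_pos hp; have := lam_pos; positivity) (le_kr hp)

theorem kr_sq_add_ki_sq {p : Pt} (hp : p ∈ wDom) : kr p ^ 2 + ki p ^ 2 ≤ 2 * lam ^ 2 / sz p.1 ^ 2 := by
  have h0 := sz_pos hp
  have hN := wN_pos hp
  have h : kr p ^ 2 + ki p ^ 2 = lam ^ 2 / wN p := by
    unfold kr ki
    field_simp
    unfold wN
    ring
  rw [h, div_le_div_iff₀ hN (by positivity)]
  nlinarith [le_wN hp, sq_nonneg lam]

theorem abs_ki_le {p : Pt} (hp : p ∈ wDom) : |ki p| ≤ 4 * lam * (|p.1.2| * |p.2|) / sz p.1 ^ 2 := by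
  have h0 := sz_pos hp
  have hN := wN_pos hp
  rw [ki, abs_div, abs_neg, abs_mul, abs_mul, abs_mul, abs_of_pos lam_pos, abs_of_pos hN,
    abs_two, div_le_div_iff₀ hN (by positivity)]
  have := le_wN hp
  have h2 : 0 ≤ lam * (|p.1.2| * |p.2|) := mul_nonneg lam_pos.le (by positivity)
  nlinarith

theorem ki_zero (m : ℝ × ℝ) : ki (m, 0) = 0 := by simp [ki]

theorem kr_zero {m : ℝ × ℝ} (h0 : 0 < sz m) : kr (m, 0) = lam / sz m := by
  simp only [kr, wN]
  field_simp
  ring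

theorem contDiff_sz : ContDiff ℝ ∞ sz := by unfold sz; fun_prop

theorem contDiff_wN : ContDiff ℝ ∞ wN := by
  have := contDiff_sz
  unfold wN
  fun_prop

theorem contDiffOn_kr : ContDiffOn ℝ ∞ kr wDom := by
  have := contDiff_sz
  unfold kr
  exact ContDiffOn.div (by fun_prop) contDiff_wN.contDiffOn fun p hp => (wN_pos hp).ne'

theorem contDiffOn_ki : ContDiffOn ℝ ∞ ki wDom := by
  unfold ki
  exact ContDiffOn.div (by fun_prop) contDiff_wN.contDiffOn fun p hp => (wN_pos hp).ne'

/-- The real part of the derivative of `lam / (z² + a²)`. -/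
def krx (p : Pt) : ℝ := -(2 * lam) * (p.1.2 * ((sz p.1 - p.2 ^ 2) ^ 2 - (2 * p.1.2 * p.2) ^ 2) +
  2 * p.2 * (sz p.1 - p.2 ^ 2) * (2 * p.1.2 * p.2)) / wN p ^ 2

/-- The imaginary part of the derivative of `lam / (z² + a²)`. -/
def kix (p : Pt) : ℝ := -(2 * lam) * (p.2 * ((sz p.1 - p.2 ^ 2) ^ 2 - (2 * p.1.2 * p.2) ^ 2) -
  2 * p.1.2 * (sz p.1 - p.2 ^ 2) * (2 * p.1.2 * p.2)) / wN p ^ 2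

theorem contDiffOn_krx : ContDiffOn ℝ ∞ krx wDom := by
  have := contDiff_sz
  unfold krx
  exact ContDiffOn.div (by fun_prop) (contDiff_wN.pow 2).contDiffOn
    fun p hp => pow_ne_zero 2 (wN_pos hp).ne'

theorem contDiffOn_kix : ContDiffOn ℝ ∞ kix wDom := by
  have := contDiff_sz
  unfold kix
  exact ContDiffOn.div (by fun_prop) (contDiff_wN.pow 2).contDiffOn
    fun p hp => pow_ne_zero 2 (wN_pos hp).ne'

section Derivatives

variable {a x y : ℝ}

theorem hasDerivAt_re_x : HasDerivAt (fun t => sz (a, t) - y ^ 2) (2 * x) x := by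
  unfold sz
  simpa using ((hasDerivAt_pow 2 x).add_const (a ^ 2)).sub_const (y ^ 2)

theorem hasDerivAt_im_x : HasDerivAt (fun t : ℝ => 2 * t * y) (2 * y) x := by
  simpa using ((hasDerivAt_id x).const_mul 2).mul_const y

theorem hasDerivAt_re_y : HasDerivAt (fun t => sz (a, x) - t ^ 2) (-(2 * y)) y := by
  simpa using (hasDerivAt_pow 2 y).const_sub (sz (a, x))

theorem hasDerivAt_im_y : HasDerivAt (fun t : ℝ => 2 * x * t) (2 * x) y := by
  simpa using (hasDerivAt_id y).const_mul (2 * x)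

variable (hp : ((a, x), y) ∈ wDom)
include hp

theorem hasDerivAt_kr_x : HasDerivAt (fun t => kr ((a, t), y)) (krx ((a, x), y)) x := by
  have hN := (wN_pos hp).ne'
  have h := ((hasDerivAt_re_x (a := a) (x := x) (y := y)).const_mul lam).div
    (((hasDerivAt_re_x (a := a) (x := x) (y := y)).pow 2).add
      ((hasDerivAt_im_x (x := x) (y := y)).pow 2)) hN
  refine h.congr_deriv ?_
  simp only [wN] at hN
  simp only [krx, wN, Pi.add_apply, Pi.pow_apply]
  field_simp
  ring

theorem hasDerivAt_ki_x : HasDerivAt (fun t => ki ((a, t), y)) (kix ((a, x), y)) x := by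
  have hN := (wN_pos hp).ne'
  have h := ((hasDerivAt_im_x (x := x) (y := y)).const_mul lam).neg.div
    (((hasDerivAt_re_x (a := a) (x := x) (y := y)).pow 2).add
      ((hasDerivAt_im_x (x := x) (y := y)).pow 2)) hN
  refine h.congr_deriv ?_
  simp only [wN] at hN
  simp only [kix, wN, Pi.add_apply, Pi.pow_apply, Pi.neg_apply]
  field_simp
  ring

theorem hasDerivAt_kr_y : HasDerivAt (fun t => kr ((a, x), t)) (-kix ((a, x), y)) y := by
  have hN := (wN_pos hp).ne'
  have h := ((hasDerivAt_re_y (a := a) (x := x) (y := y)).const_mul lam).div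
    (((hasDerivAt_re_y (a := a) (x := x) (y := y)).pow 2).add
      ((hasDerivAt_im_y (x := x) (y := y)).pow 2)) hN
  refine h.congr_deriv ?_
  simp only [wN] at hN
  simp only [kix, wN, Pi.add_apply, Pi.pow_apply]
  field_simp
  ring

theorem hasDerivAt_ki_y : HasDerivAt (fun t => ki ((a, x), t)) (krx ((a, x), y)) y := by
  have hN := (wN_pos hp).ne'
  have h := ((hasDerivAt_im_y (x := x) (y := y)).const_mul lam).neg.div
    (((hasDerivAt_re_y (a := a) (x := x) (y := y)).pow 2).add
      ((hasDerivAt_im_y (x := x) (y := y)).pow 2)) hN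
  refine h.congr_deriv ?_
  simp only [wN] at hN
  simp only [krx, wN, Pi.add_apply, Pi.pow_apply, Pi.neg_apply]
  field_simp
  ring

end Derivatives

/-- `u - U`, where `u + i v` is the primitive of `k` and `U` its restriction to the real axis. -/
def wf (p : Pt) : ℝ := -vint ki p

/-- The imaginary part `v` of the primitive of `k`. -/
def vf (p : Pt) : ℝ := vint kr p

theorem contDiffOn_wf : ContDiffOn ℝ ∞ wf wDom :=
  (contDiffOn_vint isOpen_wDom vertStar_wDom contDiffOn_ki).neg

theorem contDiffOn_vf : ContDiffOn ℝ ∞ vf wDom :=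
  contDiffOn_vint isOpen_wDom vertStar_wDom contDiffOn_kr

@[simp] theorem wf_zero (m : ℝ × ℝ) : wf (m, 0) = 0 := by simp [wf, vint]

@[simp] theorem vf_zero (m : ℝ × ℝ) : vf (m, 0) = 0 := by simp [vf, vint]

section Derivatives

variable {a x y : ℝ} (hp : ((a, x), y) ∈ wDom)
include hp

theorem hasDerivAt_wf_y : HasDerivAt (fun t => wf ((a, x), t)) (-ki ((a, x), y)) y :=
  (hasDerivAt_vint_y isOpen_wDom vertStar_wDom contDiffOn_ki.continuousOn hp).neg

theorem hasDerivAt_vf_y : HasDerivAt (fun t => vf ((a, x), t)) (kr ((a, x), y)) y :=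
  hasDerivAt_vint_y isOpen_wDom vertStar_wDom contDiffOn_kr.continuousOn hp

/-- By the Cauchy–Riemann equations the vertical integral of ∂_x Im k is a difference of values of
Re k; the value on the real axis is the derivative of U. -/
theorem hasDerivAt_wf_x : HasDerivAt (fun t => wf ((a, t), y))
    (kr ((a, x), y) - lam / sz (a, x)) x := by
  have h := (hasDerivAt_vint_x isOpen_wDom vertStar_wDom contDiffOn_ki
    (fun a x y => hasDerivAt_ki_x) hp).neg
  refine h.congr_deriv ?_
  rw [vint_eq_sub (ℓ := fun q => -kr q) vertStar_wDom contDiffOn_kix.continuousOn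
    (fun a x y hq => by simpa using (hasDerivAt_kr_y hq).fun_neg) hp, kr_zero (sz_pos hp)]
  ring

theorem hasDerivAt_vf_x : HasDerivAt (fun t => vf ((a, t), y)) (ki ((a, x), y)) x := by
  have h := hasDerivAt_vint_x isOpen_wDom vertStar_wDom contDiffOn_kr
    (fun a x y => hasDerivAt_kr_x) hp
  refine h.congr_deriv ?_
  rw [vint_eq_sub (ℓ := ki) vertStar_wDom contDiffOn_krx.continuousOn
    (fun a x y hq => hasDerivAt_ki_y hq) hp, ki_zero, sub_zero]

end Derivatives

/-! ### Estimates for the primitive -/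

/-- Integrating |Im k| ≤ 4 lam |x||y| / sz² over a segment of length |y| gives 4 lam |x| y² / sz².
`abs_x_mul_sq_y_le` cancels sz² and leaves 4 lam kap² = 1/4. This controls how far the direction of
a slice turns. -/
theorem abs_wf_le {p : Pt} (hp : p ∈ wDom) : |wf p| ≤ 1 / 4 := by
  have h0 := sz_pos hp
  have hl := lam_pos
  have h1 : ‖avg ki p‖ ≤ (4 * lam * (|p.1.2| * |p.2|) / sz p.1 ^ 2) * |1 - (0 : ℝ)| := by
    refine intervalIntegral.norm_integral_le_of_norm_le_const fun s hs => ?_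
    rw [uIoc_of_le zero_le_one] at hs
    refine (abs_ki_le (vertStar_wDom p hp s ⟨hs.1.le, hs.2⟩)).trans ?_
    simp only [abs_mul, abs_of_pos hs.1]
    have : s * |p.2| ≤ 1 * |p.2| := by gcongr; exact hs.2
    rw [one_mul] at this
    gcongr
  rw [sub_zero, abs_one, mul_one, Real.norm_eq_abs] at h1
  rw [wf, abs_neg, vint, abs_mul]
  calc |p.2| * |avg ki p| ≤ |p.2| * (4 * lam * (|p.1.2| * |p.2|) / sz p.1 ^ 2) := by gcongr
    _ = 4 * lam * (|p.1.2| * p.2 ^ 2) / sz p.1 ^ 2 := by rw [← sq_abs p.2]; ring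
    _ ≤ 4 * lam * (kap ^ 2 * sz p.1 ^ 2) / sz p.1 ^ 2 := by
        gcongr 4 * lam * ?_ / _; exact abs_x_mul_sq_y_le hp
    _ = 1 / 4 := by field_simp; norm_num [lam, kap]

theorem le_avg_kr {p : Pt} (hp : p ∈ wDom) : lam / (2 * sz p.1) ≤ avg kr p := by
  have h := intervalIntegral.integral_mono_on (zero_le_one' ℝ)
    (intervalIntegrable_const (c := lam / (2 * sz p.1)))
    (intervalIntegrable_segment vertStar_wDom contDiffOn_kr.continuousOn hp)
    (fun s hs => le_kr (vertStar_wDom p hp s hs))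
  rw [intervalIntegral.integral_const, sub_zero, one_smul] at h
  exact h

theorem avg_kr_pos {p : Pt} (hp : p ∈ wDom) : 0 < avg kr p :=
  lt_of_lt_of_le (by have := sz_pos hp; have := lam_pos; positivity) (le_avg_kr hp)

theorem le_abs_vf {p : Pt} (hp : p ∈ wDom) : lam / (2 * sz p.1) * |p.2| ≤ |vf p| := by
  rw [vf, vint, abs_mul, abs_of_pos (avg_kr_pos hp), mul_comm]
  gcongr
  exact le_avg_kr hp

theorem neg_mem_wDom {m : ℝ × ℝ} {y : ℝ} (h : (m, y) ∈ wDom) : (m, -y) ∈ wDom :=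
  ⟨by simpa [Even.neg_pow (by decide : Even 4)] using h.1, h.2⟩

theorem ordConnected_wDom_fiber (m : ℝ × ℝ) : OrdConnected {y | (m, y) ∈ wDom} := by
  refine ordConnected_of_Ioo ?_
  rintro y1 ⟨h1, h4⟩ y2 ⟨h2, -⟩ - y ⟨hy1, hy2⟩
  refine ⟨?_, h4⟩
  have h3 : |y| ≤ max |y1| |y2| := abs_le_max_abs_abs hy1.le hy2.le
  have h5 : y ^ 4 ≤ max |y1| |y2| ^ 4 := by
    rw [← Even.pow_abs (by decide : Even 4) y]; gcongr
  refine h5.trans_lt ?_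
  rcases max_choice |y1| |y2| with h | h <;> rw [h, Even.pow_abs (by decide : Even 4)] <;>
    assumption

theorem vf_strictMonoOn (m : ℝ × ℝ) : StrictMonoOn (fun y => vf (m, y)) {y | (m, y) ∈ wDom} := by
  have hconv : Convex ℝ {y | (m, y) ∈ wDom} := (ordConnected_wDom_fiber m).convex
  refine strictMonoOn_of_deriv_pos hconv ?_ ?_
  · intro y hy
    exact (hasDerivAt_vf_y (a := m.1) (x := m.2) hy).continuousAt.continuousWithinAt
  · intro y hy
    have hy := interior_subset hy
    rw [(hasDerivAt_vf_y (a := m.1) (x := m.2) hy).deriv]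
    exact kr_pos hy

theorem abs_vf_segment_le {p : Pt} (hp : p ∈ wDom) {s : ℝ} (hs : s ∈ Icc (0 : ℝ) 1) :
    |vf (p.1, s * p.2)| ≤ |vf p| := by
  have hmono := (vf_strictMonoOn p.1).monotoneOn
  have h0 : (p.1, (0 : ℝ)) ∈ wDom := by simpa using vertStar_wDom p hp 0 ⟨le_rfl, zero_le_one⟩
  have hsm := vertStar_wDom p hp s hs
  rcases le_total 0 p.2 with h | h
  · have h1 := hmono h0 hsm (mul_nonneg hs.1 h)
    have h2 := hmono hsm (show (p.1, p.2) ∈ wDom from hp) (mul_le_of_le_one_left h hs.2)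
    simp only [vf_zero] at h1 h2
    rw [abs_of_nonneg h1, abs_of_nonneg (h1.trans h2)]
    exact h2
  · have h1 := hmono hsm h0 (mul_nonpos_of_nonneg_of_nonpos hs.1 h)
    have h2 := hmono (show (p.1, p.2) ∈ wDom from hp) hsm (by nlinarith [hs.2])
    simp only [vf_zero] at h1 h2
    rw [abs_of_nonpos h1, abs_of_nonpos (h2.trans h1)]
    exact neg_le_neg h2

/-! ### The horizontal slices -/

/-- The velocity of the slice `x = const`, up to a rotation: real part. -/
def c1 (p : Pt) : ℝ := Real.cosh (vf p) * Real.cos (wf p)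

/-- The velocity of the slice `x = const`, up to a rotation: imaginary part. -/
def c2 (p : Pt) : ℝ := Real.cosh (vf p) * Real.sin (wf p)

theorem contDiffOn_c1 : ContDiffOn ℝ ∞ c1 wDom :=
  (Real.contDiff_cosh.comp_contDiffOn contDiffOn_vf).mul
    (Real.contDiff_cos.comp_contDiffOn contDiffOn_wf)

theorem contDiffOn_c2 : ContDiffOn ℝ ∞ c2 wDom :=
  (Real.contDiff_cosh.comp_contDiffOn contDiffOn_vf).mul
    (Real.contDiff_sin.comp_contDiffOn contDiffOn_wf)

/-- The position on the slice `x = const`, up to a rotation: real part. -/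
def g1 (p : Pt) : ℝ := vint c1 p

/-- The position on the slice `x = const`, up to a rotation: imaginary part. -/
def g2 (p : Pt) : ℝ := vint c2 p

theorem contDiffOn_g1 : ContDiffOn ℝ ∞ g1 wDom :=
  contDiffOn_vint isOpen_wDom vertStar_wDom contDiffOn_c1

theorem contDiffOn_g2 : ContDiffOn ℝ ∞ g2 wDom :=
  contDiffOn_vint isOpen_wDom vertStar_wDom contDiffOn_c2

section Derivatives

variable {a x y : ℝ} (hp : ((a, x), y) ∈ wDom)
include hp

theorem hasDerivAt_g1_y : HasDerivAt (fun t => g1 ((a, x), t)) (c1 ((a, x), y)) y :=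
  hasDerivAt_vint_y isOpen_wDom vertStar_wDom contDiffOn_c1.continuousOn hp

theorem hasDerivAt_g2_y : HasDerivAt (fun t => g2 ((a, x), t)) (c2 ((a, x), y)) y :=
  hasDerivAt_vint_y isOpen_wDom vertStar_wDom contDiffOn_c2.continuousOn hp

theorem hasDerivAt_g1_x : HasDerivAt (fun t => g1 ((a, t), y))
    (-(Real.sinh (vf ((a, x), y)) * Real.sin (wf ((a, x), y))) +
      lam / sz (a, x) * g2 ((a, x), y)) x := by
  -- `d` is the y-derivative of -sinh v sin w, so its vertical integral is explicit. The rest of ∂_x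
  -- c1 comes from having rotated each slice by -U(x), whence the term with U' = lam / sz.
  let d : Pt → ℝ := fun q => -(Real.sinh (vf q) * Real.cos (wf q) * -ki q +
    Real.cosh (vf q) * Real.sin (wf q) * kr q)
  have hd : ContinuousOn d wDom := by
    have h1 := contDiffOn_vf.continuousOn
    have h2 := contDiffOn_wf.continuousOn
    have h3 := contDiffOn_kr.continuousOn
    have h4 := contDiffOn_ki.continuousOn
    have h5 := Real.continuous_sinh.comp_continuousOn h1
    have h6 := Real.continuous_cosh.comp_continuousOn h1
    fun_prop
  have hk : ∀ a x y : ℝ, ((a, x), y) ∈ wDom → HasDerivAt (fun t => c1 ((a, t), y))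
      (d ((a, x), y) + lam / sz (a, x) * c2 ((a, x), y)) x := fun a x y hq => by
    refine ((hasDerivAt_vf_x hq).cosh.mul (hasDerivAt_wf_x hq).cos).congr_deriv ?_
    simp only [d, c2]
    ring
  refine (hasDerivAt_vint_x (k' := fun q => d q + lam / sz q.1 * c2 q) isOpen_wDom vertStar_wDom
    contDiffOn_c1 hk hp).congr_deriv ?_
  rw [vint_add_mul vertStar_wDom hd contDiffOn_c2.continuousOn (fun m => lam / sz m) hp, g2]
  congr 1
  rw [vint_eq_sub (ℓ := fun q => -(Real.sinh (vf q) * Real.sin (wf q))) vertStar_wDom hd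
    (fun a x y hq => ?_) hp]
  · simp
  · refine ((hasDerivAt_vf_y hq).sinh.mul (hasDerivAt_wf_y hq).sin).fun_neg.congr_deriv ?_
    simp only [d]
    ring

theorem hasDerivAt_g2_x : HasDerivAt (fun t => g2 ((a, t), y))
    (Real.sinh (vf ((a, x), y)) * Real.cos (wf ((a, x), y)) -
      lam / sz (a, x) * g1 ((a, x), y)) x := by
  -- Likewise the y-derivative of sinh v cos w.
  let d : Pt → ℝ := fun q => Real.sinh (vf q) * Real.sin (wf q) * ki q +
    Real.cosh (vf q) * Real.cos (wf q) * kr q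
  have hd : ContinuousOn d wDom := by
    have h1 := contDiffOn_vf.continuousOn
    have h2 := contDiffOn_wf.continuousOn
    have h3 := contDiffOn_kr.continuousOn
    have h4 := contDiffOn_ki.continuousOn
    have h5 := Real.continuous_sinh.comp_continuousOn h1
    have h6 := Real.continuous_cosh.comp_continuousOn h1
    fun_prop
  have hk : ∀ a x y : ℝ, ((a, x), y) ∈ wDom → HasDerivAt (fun t => c2 ((a, t), y))
      (d ((a, x), y) + -(lam / sz (a, x)) * c1 ((a, x), y)) x := fun a x y hq => by
    refine ((hasDerivAt_vf_x hq).cosh.mul (hasDerivAt_wf_x hq).sin).congr_deriv ?_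
    simp only [d, c1]
    ring
  refine (hasDerivAt_vint_x (k' := fun q => d q + -(lam / sz q.1) * c1 q) isOpen_wDom
    vertStar_wDom contDiffOn_c2 hk hp).congr_deriv ?_
  rw [vint_add_mul vertStar_wDom hd contDiffOn_c1.continuousOn (fun m => -(lam / sz m)) hp, g1,
    neg_mul, ← sub_eq_add_neg]
  congr 1
  rw [vint_eq_sub (ℓ := fun q => Real.sinh (vf q) * Real.cos (wf q)) vertStar_wDom hd
    (fun a x y hq => ?_) hp]
  · simp
  · refine ((hasDerivAt_vf_y hq).sinh.mul (hasDerivAt_wf_y hq).cos).congr_deriv ?_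
    simp only [d]
    ring

end Derivatives

/-! ### The slices are nearly straight -/

theorem cos_wf_ge {p : Pt} (hp : p ∈ wDom) : 31 / 32 ≤ Real.cos (wf p) := by
  have h1 := abs_wf_le hp
  have h2 := Real.one_sub_sq_div_two_le_cos (x := wf p)
  have h3 : wf p ^ 2 ≤ (1 / 4) ^ 2 := sq_le_sq' (abs_le.1 h1).1 (abs_le.1 h1).2
  linarith

theorem abs_c2_le {p : Pt} (hp : p ∈ wDom) : |c2 p| ≤ c1 p / 2 := by
  have h1 := cos_wf_ge hp
  have h2 : |Real.sin (wf p)| ≤ 1 / 4 := Real.abs_sin_le_abs.trans (abs_wf_le hp)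
  have h3 := Real.cosh_pos (vf p)
  rw [c2, c1, abs_mul, abs_of_pos h3, mul_div_assoc]
  gcongr
  linarith

theorem le_c1 {p : Pt} (hp : p ∈ wDom) : 31 / 32 * Real.cosh (vf p) ≤ c1 p := by
  rw [c1, mul_comm]
  have := Real.cosh_pos (vf p)
  gcongr
  exact cos_wf_ge hp

theorem c1_pos {p : Pt} (hp : p ∈ wDom) : 0 < c1 p :=
  lt_of_lt_of_le (by have := Real.cosh_pos (vf p); positivity) (le_c1 hp)

theorem c1_le {p : Pt} : c1 p ≤ Real.cosh (vf p) :=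
  mul_le_of_le_one_right (Real.cosh_pos _).le (Real.cos_le_one _)

theorem le_avg_c1 {p : Pt} (hp : p ∈ wDom) : 31 / 32 ≤ avg c1 p := by
  have h := intervalIntegral.integral_mono_on (zero_le_one' ℝ)
    (intervalIntegrable_const (c := (31 / 32 : ℝ)))
    (intervalIntegrable_segment vertStar_wDom contDiffOn_c1.continuousOn hp)
    (fun s hs => (by nlinarith [Real.one_le_cosh (vf (p.1, s * p.2))] :
      (31 / 32 : ℝ) ≤ 31 / 32 * Real.cosh (vf (p.1, s * p.2))).trans
      (le_c1 (vertStar_wDom p hp s hs)))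
  rw [intervalIntegral.integral_const, sub_zero, one_smul] at h
  exact h

theorem avg_c1_pos {p : Pt} (hp : p ∈ wDom) : 0 < avg c1 p :=
  lt_of_lt_of_le (by norm_num) (le_avg_c1 hp)

theorem avg_c1_le {p : Pt} (hp : p ∈ wDom) : avg c1 p ≤ Real.cosh (vf p) := by
  have h := intervalIntegral.integral_mono_on (zero_le_one' ℝ)
    (intervalIntegrable_segment vertStar_wDom contDiffOn_c1.continuousOn hp)
    (intervalIntegrable_const (c := Real.cosh (vf p)))
    (fun s hs => c1_le.trans (Real.cosh_le_cosh.2 (abs_vf_segment_le hp hs)))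
  rw [intervalIntegral.integral_const, sub_zero, one_smul] at h
  exact h

/-- The averaged velocity is the chord from the axis to a point of the slice, divided by y; it
inherits the sector of slope 1/2 from the velocity. -/
theorem abs_avg_c2_le {p : Pt} (hp : p ∈ wDom) : |avg c2 p| ≤ avg c1 p / 2 := by
  have h1 := intervalIntegrable_segment vertStar_wDom contDiffOn_c1.continuousOn hp
  have h := intervalIntegral.norm_integral_le_of_norm_le (zero_le_one' ℝ)
    (f := fun s => c2 (p.1, s * p.2)) (g := fun s => c1 (p.1, s * p.2) / 2)
    (μ := MeasureTheory.volume)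
    (Eventually.of_forall fun s hs => abs_c2_le (vertStar_wDom p hp s ⟨hs.1.le, hs.2⟩))
    (h1.div_const 2)
  rw [intervalIntegral.integral_div] at h
  exact h

/-- The distance to the axis divided by `|y|`. -/
def nrm (p : Pt) : ℝ := √(avg c1 p ^ 2 + avg c2 p ^ 2)

/-- The signed distance to the axis. -/
def rf (p : Pt) : ℝ := p.2 * nrm p

/-- The angle on the slice, up to the rotation by `U`. -/
def psi (p : Pt) : ℝ := Real.arctan (avg c2 p / avg c1 p)

theorem nrm_sq (p : Pt) : nrm p ^ 2 = avg c1 p ^ 2 + avg c2 p ^ 2 := Real.sq_sqrt (by positivity)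

theorem nrm_pos {p : Pt} (hp : p ∈ wDom) : 0 < nrm p :=
  Real.sqrt_pos.2 (by have := avg_c1_pos hp; positivity)

theorem nrm_mul_cos_psi {p : Pt} (hp : p ∈ wDom) : nrm p * Real.cos (psi p) = avg c1 p := by
  have h := avg_c1_pos hp
  rw [psi, Real.cos_arctan, nrm]
  have h1 : avg c1 p ^ 2 + avg c2 p ^ 2 = avg c1 p ^ 2 * (1 + (avg c2 p / avg c1 p) ^ 2) := by
    field_simp
  rw [h1, Real.sqrt_mul (by positivity), Real.sqrt_sq h.le]
  have : √(1 + (avg c2 p / avg c1 p) ^ 2) ≠ 0 := (Real.sqrt_pos.2 (by positivity)).ne'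
  field_simp

theorem nrm_mul_sin_psi {p : Pt} (hp : p ∈ wDom) : nrm p * Real.sin (psi p) = avg c2 p := by
  have h := avg_c1_pos hp
  have h1 : Real.sin (psi p) = avg c2 p / avg c1 p * Real.cos (psi p) := by
    rw [psi, Real.sin_arctan, Real.cos_arctan]; ring
  rw [h1, mul_left_comm, nrm_mul_cos_psi hp]
  field_simp

theorem rf_mul_cos_psi {p : Pt} (hp : p ∈ wDom) : rf p * Real.cos (psi p) = g1 p := by
  rw [rf, mul_assoc, nrm_mul_cos_psi hp]; rfl

theorem rf_mul_sin_psi {p : Pt} (hp : p ∈ wDom) : rf p * Real.sin (psi p) = g2 p := by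
  rw [rf, mul_assoc, nrm_mul_sin_psi hp]; rfl

theorem contDiffOn_rf : ContDiffOn ℝ ∞ rf wDom := by
  refine contDiffOn_snd.mul (ContDiffOn.sqrt ?_ fun p hp => ?_)
  · exact ((contDiffOn_avg isOpen_wDom vertStar_wDom contDiffOn_c1).pow 2).add
      ((contDiffOn_avg isOpen_wDom vertStar_wDom contDiffOn_c2).pow 2)
  · have := avg_c1_pos hp; positivity

theorem contDiffOn_psi : ContDiffOn ℝ ∞ psi wDom :=
  Real.contDiff_arctan.comp_contDiffOn
    ((contDiffOn_avg isOpen_wDom vertStar_wDom contDiffOn_c2).div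
      (contDiffOn_avg isOpen_wDom vertStar_wDom contDiffOn_c1) fun _ hp => (avg_c1_pos hp).ne')

theorem abs_psi_lt (p : Pt) : |psi p| < Real.pi / 2 :=
  abs_lt.2 ⟨Real.neg_pi_div_two_lt_arctan _, Real.arctan_lt_pi_div_two _⟩

/-- `|P|⁻² ⟨P, ∂_y P⟩ y`. -/
def dotc (p : Pt) : ℝ := avg c1 p * c1 p + avg c2 p * c2 p

/-- Velocity and chord lie in the same sector of slope 1/2, so they make an acute angle. Hence the
distance to the axis grows along the slice. -/
theorem dotc_pos {p : Pt} (hp : p ∈ wDom) : 0 < dotc p := by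
  have h1 := abs_le.1 (abs_c2_le hp)
  have h2 := abs_le.1 (abs_avg_c2_le hp)
  have h3 := c1_pos hp
  have h4 := avg_c1_pos hp
  have h5 : |avg c2 p * c2 p| ≤ avg c1 p / 2 * (c1 p / 2) := by
    rw [abs_mul]
    exact mul_le_mul (abs_avg_c2_le hp) (abs_c2_le hp) (abs_nonneg _) (by positivity)
  have h6 := (abs_le.1 h5).1
  have h7 : 0 < avg c1 p * c1 p := mul_pos h4 h3
  unfold dotc
  linarith

theorem hasDerivAt_section_y {f : Pt → ℝ} {p : Pt} (hf : DifferentiableAt ℝ f p) :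
    HasDerivAt (fun t => f (p.1, t)) (fderiv ℝ f p (0, 1)) p.2 :=
  HasFDerivAt.comp_hasDerivAt (f := fun t => ((p.1, t) : Pt)) p.2 hf.hasFDerivAt
    ((hasDerivAt_const p.2 p.1).prodMk (hasDerivAt_id p.2))

theorem hasDerivAt_rf_y {m : ℝ × ℝ} {y : ℝ} (hp : (m, y) ∈ wDom) :
    HasDerivAt (fun t => rf (m, t)) (dotc (m, y) / nrm (m, y)) y := by
  -- Differentiating y · avg c = ∫₀^y c gives y · (avg c)' = c - avg c, which eliminates the
  -- derivatives of the averages.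
  have key : ∀ c : Pt → ℝ, ContDiffOn ℝ ∞ c wDom → ∃ d, HasDerivAt (fun t => avg c (m, t)) d y ∧
      y * d = c (m, y) - avg c (m, y) := by
    intro c hc
    have h1 := hasDerivAt_section_y (((contDiffOn_avg isOpen_wDom vertStar_wDom hc).contDiffAt
      (isOpen_wDom.mem_nhds hp)).differentiableAt (by simp))
    refine ⟨_, h1, ?_⟩
    have h2 := ((hasDerivAt_id y).mul h1).unique
      (hasDerivAt_vint_y isOpen_wDom vertStar_wDom hc.continuousOn hp)
    simp only [id_eq, one_mul] at h2
    linarith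
  obtain ⟨d1, hd1, e1⟩ := key c1 contDiffOn_c1
  obtain ⟨d2, hd2, e2⟩ := key c2 contDiffOn_c2
  have hn := nrm_pos hp
  have hne : avg c1 (m, y) ^ 2 + avg c2 (m, y) ^ 2 ≠ 0 := by
    rw [← nrm_sq]; positivity
  have h := (hasDerivAt_id y).mul (((hd1.pow 2).add (hd2.pow 2)).sqrt hne)
  refine h.congr_deriv ?_
  change 1 * nrm (m, y) + y * (_ / (2 * nrm (m, y))) = _
  simp only [dotc]
  field_simp
  rw [nrm_sq]
  push_cast
  linear_combination 2 * avg c1 (m, y) * e1 + 2 * avg c2 (m, y) * e2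

theorem fderiv_rf_ne_zero {p : Pt} (hp : p ∈ wDom) : fderiv ℝ rf p (0, 1) ≠ 0 := by
  have h1 := hasDerivAt_section_y ((contDiffOn_rf.contDiffAt
    (isOpen_wDom.mem_nhds hp)).differentiableAt (by simp))
  rw [h1.unique (hasDerivAt_rf_y (m := p.1) (y := p.2) hp)]
  exact (div_pos (dotc_pos hp) (nrm_pos hp)).ne'

theorem rf_strictMonoOn (m : ℝ × ℝ) : StrictMonoOn (fun y => rf (m, y)) {y | (m, y) ∈ wDom} := by
  refine strictMonoOn_of_deriv_pos (ordConnected_wDom_fiber m).convex ?_ ?_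
  · intro y hy
    exact (hasDerivAt_rf_y hy).continuousAt.continuousWithinAt
  · intro y hy
    have hy := interior_subset hy
    rw [(hasDerivAt_rf_y hy).deriv]
    exact div_pos (dotc_pos hy) (nrm_pos hy)

/-! ### Symmetry -/

theorem avg_neg_of_even {k : Pt → ℝ} {m : ℝ × ℝ} (h : ∀ y, k (m, -y) = k (m, y)) (y : ℝ) :
    avg k (m, -y) = avg k (m, y) := by
  simp only [avg, mul_neg, h]

theorem avg_neg_of_odd {k : Pt → ℝ} {m : ℝ × ℝ} (h : ∀ y, k (m, -y) = -k (m, y)) (y : ℝ) :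
    avg k (m, -y) = -avg k (m, y) := by
  simp only [avg, mul_neg, h, intervalIntegral.integral_neg]

variable (m : ℝ × ℝ) (y : ℝ)

theorem wf_neg : wf (m, -y) = wf (m, y) := by
  simp only [wf, vint]
  rw [avg_neg_of_odd (fun y => by simp only [ki, wN]; ring)]
  ring

theorem vf_neg : vf (m, -y) = -vf (m, y) := by
  simp only [vf, vint]
  rw [avg_neg_of_even (fun y => by simp only [kr, wN]; ring)]
  ring

theorem avg_c1_neg : avg c1 (m, -y) = avg c1 (m, y) :=
  avg_neg_of_even (fun y => by simp only [c1, wf_neg, vf_neg, Real.cosh_neg]) y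

theorem avg_c2_neg : avg c2 (m, -y) = avg c2 (m, y) :=
  avg_neg_of_even (fun y => by simp only [c2, wf_neg, vf_neg, Real.cosh_neg]) y

theorem psi_neg : psi (m, -y) = psi (m, y) := by simp only [psi, avg_c1_neg, avg_c2_neg]

theorem rf_neg : rf (m, -y) = -rf (m, y) := by
  simp only [rf, nrm, avg_c1_neg, avg_c2_neg, neg_mul]

/-! ### The size of the slices -/

variable {m y}

theorem abs_rf_le {p : Pt} (hp : p ∈ wDom) : |rf p| ≤ 2 * |p.2| * Real.cosh (vf p) := by
  have h1 := abs_avg_c2_le hp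
  have h2 := avg_c1_le hp
  have h3 := avg_c1_pos hp
  have h4 : nrm p ≤ 2 * avg c1 p := by
    refine Real.sqrt_le_iff.2 ⟨by positivity, ?_⟩
    have := sq_le_sq' (abs_le.1 h1).1 (abs_le.1 h1).2
    nlinarith
  rw [rf, abs_mul, abs_of_pos (nrm_pos hp)]
  calc |p.2| * nrm p ≤ |p.2| * (2 * Real.cosh (vf p)) := by gcongr; linarith
    _ = _ := by ring

/-- A fourth power is enough growth: at the edge of the domain v is of order sz^(-1/4) and y of
order sz^(3/4), so y v⁴ does not tend to 0 as sz → 0. -/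
theorem le_cosh (v : ℝ) : v ^ 4 / 48 ≤ Real.cosh v := by
  have h1 := Real.pow_div_factorial_le_exp |v| (abs_nonneg v) 4
  rw [← Real.cosh_abs, Real.cosh_eq]
  have h2 := Real.exp_pos (-|v|)
  rw [Even.pow_abs (by decide : Even 4)] at h1
  norm_num [Nat.factorial] at h1
  linarith

theorem le_avg_c1_of_pow {p : Pt} (hp : p ∈ wDom) :
    (lam / (2 * sz p.1) * p.2) ^ 4 / 320 ≤ avg c1 p := by
  have h0 := sz_pos hp
  have hl := lam_pos
  have h := intervalIntegral.integral_mono_on (zero_le_one' ℝ)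
    (f := fun s => (lam / (2 * sz p.1) * p.2) ^ 4 / 64 * s ^ 4)
    ((by fun_prop : Continuous fun s : ℝ =>
      (lam / (2 * sz p.1) * p.2) ^ 4 / 64 * s ^ 4).intervalIntegrable 0 1)
    (intervalIntegrable_segment vertStar_wDom contDiffOn_c1.continuousOn hp)
    (fun s hs => by
      have hs' := vertStar_wDom p hp s hs
      have e1 := le_c1 hs'
      have e2 := le_cosh (vf (p.1, s * p.2))
      have e3 := le_abs_vf hs'
      have e4 : (lam / (2 * sz p.1) * |s * p.2|) ^ 4 ≤ |vf (p.1, s * p.2)| ^ 4 := by gcongr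
      rw [mul_pow, Even.pow_abs (by decide : Even 4), Even.pow_abs (by decide : Even 4)] at e4
      have e5 : 0 ≤ (lam / (2 * sz p.1)) ^ 4 * (s * p.2) ^ 4 := by positivity
      calc (lam / (2 * sz p.1) * p.2) ^ 4 / 64 * s ^ 4
          = (lam / (2 * sz p.1)) ^ 4 * (s * p.2) ^ 4 / 64 := by ring
        _ ≤ c1 (p.1, s * p.2) := by linarith)
  rw [intervalIntegral.integral_const_mul, integral_pow] at h
  refine le_trans (le_of_eq ?_) h
  norm_num
  ring

/-- The point is taken at half the width of the domain, where y v⁴ is of order sz^(-1/4), bounded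
below because sz < 4. Distance 2 leaves a margin around the unit ball. -/
theorem exists_two_le_rf {m : ℝ × ℝ} (h0 : 0 < sz m) (h4 : sz m < 4) :
    ∃ y, 0 < y ∧ (m, y) ∈ wDom ∧ 2 ≤ rf (m, y) := by
  obtain ⟨s, hs0, hs⟩ : ∃ s : ℝ, 0 < s ∧ s ^ 4 = sz m :=
    ⟨√(√(sz m)), by positivity, by
      rw [show (√(√(sz m))) ^ 4 = ((√(√(sz m))) ^ 2) ^ 2 by ring, Real.sq_sqrt (by positivity),
        Real.sq_sqrt h0.le]⟩
  have hs2 : s < 2 := by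
    by_contra h
    have h2 : (2 : ℝ) ^ 4 ≤ s ^ 4 := by gcongr; exact not_lt.1 h
    norm_num at h2
    linarith
  have hkap : 0 < kap := by norm_num [kap]
  have hy0 : 0 < kap * s ^ 3 / 2 := by positivity
  have hmem : (m, kap * s ^ 3 / 2) ∈ wDom := by
    refine ⟨?_, h4⟩
    have h1 : (kap * s ^ 3 / 2) ^ 4 = kap ^ 4 * sz m ^ 3 / 16 := by rw [← hs]; ring
    have h2 : 0 < kap ^ 4 * sz m ^ 3 := by positivity
    change (kap * s ^ 3 / 2) ^ 4 < kap ^ 4 * sz m ^ 3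
    linarith
  refine ⟨_, hy0, hmem, ?_⟩
  have h1 := le_avg_c1_of_pow hmem
  have h2 : avg c1 (m, kap * s ^ 3 / 2) ≤ nrm (m, kap * s ^ 3 / 2) :=
    Real.le_sqrt_of_sq_le (le_add_of_nonneg_right (sq_nonneg _))
  -- With s⁴ = sz the lower bound is kap⁵ lam⁴ / (2⁹ · 320) / s = 6.4 / s, and s < 2.
  calc (2 : ℝ) ≤ kap * s ^ 3 / 2 * ((lam / (2 * sz m) * (kap * s ^ 3 / 2)) ^ 4 / 320) := by
        rw [← hs]
        have : kap * s ^ 3 / 2 * ((lam / (2 * s ^ 4) * (kap * s ^ 3 / 2)) ^ 4 / 320) =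
          kap ^ 5 * lam ^ 4 / (2 ^ 9 * 320) / s := by
          field_simp
        rw [this, le_div_iff₀ hs0]
        norm_num [kap, lam]
        linarith
    _ ≤ rf (m, kap * s ^ 3 / 2) := by
        rw [rf]
        exact mul_le_mul_of_nonneg_left (h1.trans h2) hy0.le

theorem exists_rf_eq {m : ℝ × ℝ} (h0 : 0 < sz m) (h4 : sz m < 4) {r : ℝ} (hr : |r| < 2) :
    ∃ y, (m, y) ∈ wDom ∧ rf (m, y) = r := by
  obtain ⟨y, hy0, hy, h2⟩ := exists_two_le_rf h0 h4
  have hsub : Icc (-y) y ⊆ {y | (m, y) ∈ wDom} :=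
    (ordConnected_wDom_fiber m).out (neg_mem_wDom hy) hy
  have hc : ContinuousOn (fun y => rf (m, y)) (Icc (-y) y) :=
    contDiffOn_rf.continuousOn.comp (by fun_prop) hsub
  obtain ⟨t, ht, h⟩ := intermediate_value_Icc (by linarith) hc
    (show r ∈ Icc (rf (m, -y)) (rf (m, y)) by
      rw [rf_neg]
      exact ⟨by linarith [(abs_lt.1 hr).1], by linarith [(abs_lt.1 hr).2]⟩)
  exact ⟨t, hsub ht, h⟩

/-! ### The distance to the axis as a coordinate -/

/-- The change of coordinates `((a, x), y) ↦ ((a, x), r)`. -/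
def sliceHomeo : OpenPartialHomeomorph Pt Pt :=
  fiberHomeo rf wDom isOpen_wDom contDiffOn_rf.continuousOn rf_strictMonoOn

/-- The domain of the coordinates `((a, x), r)`. -/
def rDom : Set Pt := {q | (0 < sz q.1 ∧ sz q.1 < 4) ∧ |q.2| < 2}

theorem isOpen_rDom : IsOpen rDom := by
  have h : Continuous fun p : Pt => sz p.1 := contDiff_sz.continuous.comp continuous_fst
  exact ((isOpen_lt continuous_const h).inter (isOpen_lt h continuous_const)).inter
    (isOpen_lt continuous_snd.abs continuous_const)

theorem rDom_subset_target : rDom ⊆ sliceHomeo.target := fun _ hq =>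
  (mem_fiberHomeo_target _ _ _).2 (exists_rf_eq hq.1.1 hq.1.2 hq.2)

/-- The coordinate `y` as a function of `((a, x), r)`. -/
def yf (q : Pt) : ℝ := (sliceHomeo.symm q).2

theorem yf_mem {q : Pt} (hq : q ∈ rDom) : (q.1, yf q) ∈ wDom :=
  (fiberHomeo_symm_spec _ _ _ (rDom_subset_target hq)).1

theorem rf_yf {q : Pt} (hq : q ∈ rDom) : rf (q.1, yf q) = q.2 :=
  (fiberHomeo_symm_spec _ _ _ (rDom_subset_target hq)).2

theorem contDiffOn_yf : ContDiffOn ℝ ∞ yf rDom :=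
  ((contDiffOn_fiberHomeo_symm _ _ _ contDiffOn_rf fun _ hp => fderiv_rf_ne_zero hp).mono
    rDom_subset_target).snd

theorem neg_mem_rDom {m : ℝ × ℝ} {r : ℝ} (h : (m, r) ∈ rDom) : (m, -r) ∈ rDom :=
  ⟨h.1, by simpa using h.2⟩

theorem yf_neg {m : ℝ × ℝ} {r : ℝ} (h : (m, r) ∈ rDom) : yf (m, -r) = -yf (m, r) := by
  have h1 : (m, -yf (m, r)) ∈ wDom := neg_mem_wDom (yf_mem h)
  have h2 : (m, yf (m, -r)) ∈ wDom := yf_mem (neg_mem_rDom h)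
  refine (rf_strictMonoOn m).injOn h2 h1 ?_
  rw [rf_neg, rf_yf h]
  exact rf_yf (neg_mem_rDom h)

/-- The angle on the slice as a function of `((a, x), r)`. -/
def psiR (q : Pt) : ℝ := psi (q.1, yf q)

theorem contDiffOn_psiR : ContDiffOn ℝ ∞ psiR rDom :=
  contDiffOn_psi.comp (contDiffOn_fst.prodMk contDiffOn_yf) fun _ hq => yf_mem hq

/-- The symmetry y ↦ -y is the rotation by π about the axis. Evenness in r lets the angle be
computed from the distance to the axis alone, without knowing the sign of r. -/
theorem psiR_neg {m : ℝ × ℝ} {r : ℝ} (h : (m, r) ∈ rDom) : psiR (m, -r) = psiR (m, r) := by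
  simp only [psiR, yf_neg h, psi_neg]

theorem abs_psiR_lt (q : Pt) : |psiR q| < Real.pi / 2 := abs_psi_lt _

theorem mul_cos_psiR {q : Pt} (hq : q ∈ rDom) : q.2 * Real.cos (psiR q) = g1 (q.1, yf q) := by
  rw [psiR, ← rf_mul_cos_psi (yf_mem hq), rf_yf hq]

theorem mul_sin_psiR {q : Pt} (hq : q ∈ rDom) : q.2 * Real.sin (psiR q) = g2 (q.1, yf q) := by
  rw [psiR, ← rf_mul_sin_psi (yf_mem hq), rf_yf hq]

theorem yf_mul_pos {q : Pt} (hq : q ∈ rDom) (h : q.2 ≠ 0) : 0 < yf q * q.2 := by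
  rw [← rf_yf hq] at h ⊢
  have hn := nrm_pos (yf_mem hq)
  simp only [rf] at h ⊢
  have : yf q ≠ 0 := left_ne_zero_of_mul h
  have := mul_self_pos.2 this
  calc 0 < yf q * yf q * nrm (q.1, yf q) := by positivity
    _ = _ := by ring

theorem sinh_vf_mul_pos {p : Pt} (hp : p ∈ wDom) (h : p.2 ≠ 0) : 0 < Real.sinh (vf p) * p.2 := by
  have h0 : (p.1, (0 : ℝ)) ∈ wDom := by simpa using vertStar_wDom p hp 0 ⟨le_rfl, zero_le_one⟩
  rcases lt_or_gt_of_ne h with h | h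
  · refine mul_pos_of_neg_of_neg (Real.sinh_neg_iff.2 ?_) h
    have := vf_strictMonoOn p.1 (show (p.1, p.2) ∈ wDom from hp) h0 h
    simpa only [vf_zero] using this
  · refine mul_pos (Real.sinh_pos_iff.2 ?_) h
    have := vf_strictMonoOn p.1 h0 (show (p.1, p.2) ∈ wDom from hp) h
    simpa only [vf_zero] using this

theorem hasDerivAt_along {f : Pt → ℝ} {a x fx fy y' : ℝ} {Y : ℝ → ℝ}
    (hf : DifferentiableAt ℝ f ((a, x), Y x)) (hx : HasDerivAt (fun t => f ((a, t), Y x)) fx x)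
    (hy : HasDerivAt (fun t => f ((a, x), t)) fy (Y x)) (hY : HasDerivAt Y y' x) :
    HasDerivAt (fun t => f ((a, t), Y t)) (fx + y' * fy) x := by
  have h1 := HasFDerivAt.comp_hasDerivAt (f := fun t => (((a, t), Y t) : Pt)) x hf.hasFDerivAt
    (((hasDerivAt_const x a).prodMk (hasDerivAt_id x)).prodMk hY)
  have h2 := HasFDerivAt.comp_hasDerivAt (f := fun t => (((a, t), Y x) : Pt)) x hf.hasFDerivAt
    (((hasDerivAt_const x a).prodMk (hasDerivAt_id x)).prodMk (hasDerivAt_const x (Y x)))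
  have h3 := HasFDerivAt.comp_hasDerivAt (f := fun t => (((a, x), t) : Pt)) (Y x) hf.hasFDerivAt
    ((hasDerivAt_const (Y x) (a, x)).prodMk (hasDerivAt_id (Y x)))
  rw [hx.unique h2, hy.unique h3]
  refine h1.congr_deriv ?_
  rw [← smul_eq_mul y', ← map_smul, ← map_add]
  simp

/-- Along `r = const ≠ 0`, the angle of the surface increases with `x`. -/
theorem exists_hasDerivAt_psiR {a x r : ℝ} (hq : ((a, x), r) ∈ rDom) (hr : r ≠ 0) :
    ∃ d, HasDerivAt (fun t => psiR ((a, t), r)) d x ∧ 0 < d + lam / sz (a, x) := by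
  have hsec : HasDerivAt (fun t : ℝ => (((a, t), r) : Pt)) ((0, 1), 0) x :=
    ((hasDerivAt_const x a).prodMk (hasDerivAt_id x)).prodMk (hasDerivAt_const x r)
  have hd : ∀ f : Pt → ℝ, ContDiffOn ℝ ∞ f rDom → ∃ d, HasDerivAt (fun t => f ((a, t), r)) d x :=
    fun f hf => ⟨_, HasFDerivAt.comp_hasDerivAt (f := fun t => (((a, t), r) : Pt)) x
      ((hf.contDiffAt (isOpen_rDom.mem_nhds hq)).differentiableAt (by simp)).hasFDerivAt hsec⟩
  obtain ⟨d, hpsi⟩ := hd psiR contDiffOn_psiR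
  obtain ⟨y', hy'⟩ := hd yf contDiffOn_yf
  refine ⟨d, hpsi, ?_⟩
  set p : Pt := ((a, x), yf ((a, x), r)) with hpdef
  have hp : p ∈ wDom := yf_mem hq
  have hev : ∀ᶠ t in 𝓝 x, ((a, t), r) ∈ rDom :=
    hsec.continuousAt.eventually (isOpen_rDom.mem_nhds hq)
  have e1 := (hasDerivAt_along (Y := fun t => yf ((a, t), r)) ((contDiffOn_g1.contDiffAt
    (isOpen_wDom.mem_nhds hp)).differentiableAt (by simp)) (hasDerivAt_g1_x hp)
    (hasDerivAt_g1_y hp) hy').congr_of_eventuallyEq (f₁ := fun t => r * Real.cos (psiR ((a, t), r)))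
    (hev.mono fun t ht => mul_cos_psiR ht)
  have e2 := (hasDerivAt_along (Y := fun t => yf ((a, t), r)) ((contDiffOn_g2.contDiffAt
    (isOpen_wDom.mem_nhds hp)).differentiableAt (by simp)) (hasDerivAt_g2_x hp)
    (hasDerivAt_g2_y hp) hy').congr_of_eventuallyEq (f₁ := fun t => r * Real.sin (psiR ((a, t), r)))
    (hev.mono fun t ht => mul_sin_psiR ht)
  have e1 := e1.unique (hpsi.cos.const_mul r)
  have e2 := e2.unique (hpsi.sin.const_mul r)
  have m1 := mul_cos_psiR hq
  have m2 := mul_sin_psiR hq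
  simp only [← hpdef] at e1 e2 m1 m2
  have hsc := Real.sin_sq_add_cos_sq (wf p)
  -- Differentiating r(cos ψ, sin ψ) = (g1, g2) at fixed r gives two equations with the unknown y' =
  -- dy/dx. Combining them with coefficients orthogonal to the slice velocity (c1, c2) eliminates
  -- y'. Both sinh v and the inner product of velocity and position have the sign of y, which gives
  -- positivity.
  have key : (d + lam / sz (a, x)) * (c1 p * g1 p + c2 p * g2 p) =
      Real.sinh (vf p) * Real.cosh (vf p) := by
    have f1 : -(Real.sinh (vf p) * Real.sin (wf p)) + lam / sz (a, x) * g2 p + y' * c1 p =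
      -(g2 p * d) := by rw [e1, ← m2]; ring
    have f2 : Real.sinh (vf p) * Real.cos (wf p) - lam / sz (a, x) * g1 p + y' * c2 p =
      g1 p * d := by rw [e2, ← m1]; ring
    have hc1 : c1 p = Real.cosh (vf p) * Real.cos (wf p) := rfl
    have hc2 : c2 p = Real.cosh (vf p) * Real.sin (wf p) := rfl
    linear_combination -c1 p * f2 + c2 p * f1 + Real.sinh (vf p) * Real.cos (wf p) * hc1 +
      Real.sinh (vf p) * Real.sin (wf p) * hc2 + Real.sinh (vf p) * Real.cosh (vf p) * hsc
  have hfac : c1 p * g1 p + c2 p * g2 p = p.2 * dotc p := by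
    simp only [g1, g2, vint, dotc]; ring
  have hy0 : p.2 ≠ 0 := by
    intro h0
    have := yf_mul_pos hq hr
    simp only [hpdef] at h0
    rw [h0] at this
    simp at this
  have h1 := sinh_vf_mul_pos hp hy0
  have h2 : 0 < (d + lam / sz (a, x)) * (p.2 ^ 2 * dotc p) := by
    calc 0 < Real.sinh (vf p) * p.2 * Real.cosh (vf p) := mul_pos h1 (Real.cosh_pos _)
      _ = _ := by rw [hfac] at key; linear_combination -p.2 * key
  exact pos_of_mul_pos_left h2 (by have := dotc_pos hp; positivity)

/-! ### The surfaces -/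

/-- `U` is the restriction to the real axis of a primitive of `lam / (z² + a²)`. -/
structure IsPhase (a : ℝ) (J : Set ℝ) (U : ℝ → ℝ) : Prop where
  isOpen : IsOpen J
  ordConnected : J.OrdConnected
  sz_mem : ∀ x ∈ J, 0 < sz (a, x) ∧ sz (a, x) < 4
  smooth : ContDiffOn ℝ ∞ U J
  deriv : ∀ x ∈ J, HasDerivAt U (lam / sz (a, x)) x

/-- The angle of the surface with phase `U` at height `x` and signed distance `r` to the axis. -/
def ang (U : ℝ → ℝ) (a : ℝ) (x r : ℝ) : ℝ := U x + psiR ((a, x), r)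

/-- The point with signed distance `r` to the axis, angle `t` and height `x`. -/
def spiralPt (t x r : ℝ) : Space := !₂[r * Real.cos t, r * Real.sin t, x]

/-- The surface with phase `U`, parametrized by height and signed distance to the axis. -/
def surf (U : ℝ → ℝ) (a : ℝ) (q : Plane) : Space := spiralPt (ang U a (q 0) (q 1)) (q 0) (q 1)

/-- The surface with phase `U`, in the conformal coordinates `x`, `y`. -/
def conf (U : ℝ → ℝ) (a : ℝ) (q : Plane) : Space :=
  !₂[Real.cos (U (q 0)) * g1 ((a, q 0), q 1) - Real.sin (U (q 0)) * g2 ((a, q 0), q 1),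
    Real.sin (U (q 0)) * g1 ((a, q 0), q 1) + Real.cos (U (q 0)) * g2 ((a, q 0), q 1), q 0]

/-- The change of coordinates from `(x, r)` to `(x, y)`. -/
def toConf (a : ℝ) (q : Plane) : Plane := !₂[q 0, yf ((a, q 0), q 1)]

/-- Two parametrizations of one surface: `conf` is conformal and gives the curvature, `surf` shows
embeddedness and the intersection with balls. -/
theorem surf_eq_conf (U : ℝ → ℝ) {a : ℝ} {q : Plane} (hq : ((a, q 0), q 1) ∈ rDom) :
    surf U a q = conf U a (toConf a q) := by
  have h1 := mul_cos_psiR hq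
  have h2 := mul_sin_psiR hq
  simp only at h1 h2
  ext i
  fin_cases i
  · simp [surf, conf, spiralPt, ang, toConf, Real.cos_add, ← h1, ← h2]; ring
  · simp [surf, conf, spiralPt, ang, toConf, Real.sin_add, ← h1, ← h2]; ring
  · simp [surf, conf, spiralPt, toConf]

theorem hasDerivAt_euclidean {n : ℕ} {f : ℝ → EuclideanSpace ℝ (Fin n)}
    {v : EuclideanSpace ℝ (Fin n)} {x : ℝ} (h : ∀ i, HasDerivAt (fun t => f t i) (v i) x) :
    HasDerivAt f v x := by
  rw [hasDerivAt_iff_hasFDerivAt, ← hasFDerivWithinAt_univ, hasFDerivWithinAt_euclidean]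
  intro i
  refine ((h i).hasFDerivAt.congr_fderiv ?_).hasFDerivWithinAt
  ext
  simp

theorem partialD_zero_eq {F : Plane → Space} {q : Plane} {v : Space}
    (hF : DifferentiableAt ℝ F q) (h : HasDerivAt (fun t => F !₂[t, q 1]) v (q 0)) :
    partialD 0 F q = v := by
  have hc : HasDerivAt (fun t : ℝ => (!₂[t, q 1] : Plane)) (EuclideanSpace.single 0 1) (q 0) := by
    refine hasDerivAt_euclidean fun i => ?_
    fin_cases i
    exacts [hasDerivAt_id (q 0), hasDerivAt_const (q 0) (q 1)]
  have hq : (!₂[q 0, q 1] : Plane) = q := by ext i; fin_cases i <;> rfl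
  have h2 : HasFDerivAt F (fderiv ℝ F q) !₂[q 0, q 1] := by rw [hq]; exact hF.hasFDerivAt
  exact (h2.comp_hasDerivAt (q 0) hc).unique h

theorem partialD_one_eq {F : Plane → Space} {q : Plane} {v : Space}
    (hF : DifferentiableAt ℝ F q) (h : HasDerivAt (fun t => F !₂[q 0, t]) v (q 1)) :
    partialD 1 F q = v := by
  have hc : HasDerivAt (fun t : ℝ => (!₂[q 0, t] : Plane)) (EuclideanSpace.single 1 1) (q 1) := by
    refine hasDerivAt_euclidean fun i => ?_
    fin_cases i
    exacts [hasDerivAt_const (q 1) (q 0), hasDerivAt_id (q 1)]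
  have hq : (!₂[q 0, q 1] : Plane) = q := by ext i; fin_cases i <;> rfl
  have h2 : HasFDerivAt F (fderiv ℝ F q) !₂[q 0, q 1] := by rw [hq]; exact hF.hasFDerivAt
  exact (h2.comp_hasDerivAt (q 1) hc).unique h

/-! ### Fundamental forms in conformal coordinates -/

section Conf

variable {a : ℝ} {J : Set ℝ} {U : ℝ → ℝ} (hU : IsPhase a J U)

/-- The parameter domain of `conf`. -/
def confDom (a : ℝ) (J : Set ℝ) : Set Plane := {q | q 0 ∈ J ∧ ((a, q 0), q 1) ∈ wDom}

theorem contDiff_toPt (a : ℝ) : ContDiff ℝ ∞ fun q : Plane => (((a, q 0), q 1) : Pt) := by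
  have h0 : ContDiff ℝ ∞ fun q : Plane => q 0 := contDiff_piLp_apply 2
  have h1 : ContDiff ℝ ∞ fun q : Plane => q 1 := contDiff_piLp_apply 2
  exact (contDiff_const.prodMk h0).prodMk h1

theorem contDiff_proj_zero : ContDiff ℝ ∞ fun q : Plane => q 0 := contDiff_piLp_apply 2

theorem contDiff_proj_one : ContDiff ℝ ∞ fun q : Plane => q 1 := contDiff_piLp_apply 2

theorem contDiffOn_space {E : Type} [NormedAddCommGroup E] [NormedSpace ℝ E] {f : E → Space}
    {s : Set E} (h0 : ContDiffOn ℝ ∞ (fun q => f q 0) s) (h1 : ContDiffOn ℝ ∞ (fun q => f q 1) s)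
    (h2 : ContDiffOn ℝ ∞ (fun q => f q 2) s) : ContDiffOn ℝ ∞ f s := by
  rw [contDiffOn_euclidean]
  intro i
  fin_cases i
  exacts [h0, h1, h2]

include hU

theorem isOpen_confDom : IsOpen (confDom a J) :=
  (hU.isOpen.preimage contDiff_proj_zero.continuous).inter
    (isOpen_wDom.preimage (contDiff_toPt a).continuous)

theorem contDiffOn_phase : ContDiffOn ℝ ∞ (fun q : Plane => U (q 0)) (confDom a J) :=
  hU.smooth.comp contDiff_proj_zero.contDiffOn fun _ hq => hq.1

omit hU in
theorem contDiffOn_conf_comp {f : Pt → ℝ} (hf : ContDiffOn ℝ ∞ f wDom) :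
    ContDiffOn ℝ ∞ (fun q : Plane => f ((a, q 0), q 1)) (confDom a J) :=
  hf.comp (contDiff_toPt a).contDiffOn fun _ hq => hq.2

theorem contDiffOn_conf : ContDiffOn ℝ ∞ (conf U a) (confDom a J) := by
  have hU' := contDiffOn_phase hU
  have h1 := contDiffOn_conf_comp (a := a) (J := J) contDiffOn_g1
  have h2 := contDiffOn_conf_comp (a := a) (J := J) contDiffOn_g2
  have hc := Real.contDiff_cos.comp_contDiffOn hU'
  have hs := Real.contDiff_sin.comp_contDiffOn hU'
  exact contDiffOn_space ((hc.mul h1).sub (hs.mul h2)) ((hs.mul h1).add (hc.mul h2))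
    contDiff_proj_zero.contDiffOn

omit hU in
/-- The derivative of `conf` in `x`. -/
def confX (U : ℝ → ℝ) (a : ℝ) (q : Plane) : Space :=
  !₂[-(Real.sinh (vf ((a, q 0), q 1)) * Real.sin (U (q 0) + wf ((a, q 0), q 1))),
    Real.sinh (vf ((a, q 0), q 1)) * Real.cos (U (q 0) + wf ((a, q 0), q 1)), 1]

omit hU in
/-- The derivative of `conf` in `y`. -/
def confY (U : ℝ → ℝ) (a : ℝ) (q : Plane) : Space :=
  !₂[Real.cosh (vf ((a, q 0), q 1)) * Real.cos (U (q 0) + wf ((a, q 0), q 1)),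
    Real.cosh (vf ((a, q 0), q 1)) * Real.sin (U (q 0) + wf ((a, q 0), q 1)), 0]

variable {q : Plane} (hq : q ∈ confDom a J)
include hq

theorem partialD_zero_conf : partialD 0 (conf U a) q = confX U a q := by
  refine partialD_zero_eq (((contDiffOn_conf hU).contDiffAt
    ((isOpen_confDom hU).mem_nhds hq)).differentiableAt (by simp)) (hasDerivAt_euclidean fun i => ?_)
  have hu := hU.deriv _ hq.1
  have h1 := hasDerivAt_g1_x hq.2
  have h2 := hasDerivAt_g2_x hq.2
  fin_cases i
  · refine ((hu.cos.mul h1).sub (hu.sin.mul h2)).congr_deriv ?_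
    simp [confX, Real.sin_add]
    ring
  · refine ((hu.sin.mul h1).add (hu.cos.mul h2)).congr_deriv ?_
    simp [confX, Real.cos_add]
    ring
  · exact hasDerivAt_id _

theorem partialD_one_conf : partialD 1 (conf U a) q = confY U a q := by
  refine partialD_one_eq (((contDiffOn_conf hU).contDiffAt
    ((isOpen_confDom hU).mem_nhds hq)).differentiableAt (by simp)) (hasDerivAt_euclidean fun i => ?_)
  have h1 := hasDerivAt_g1_y hq.2
  have h2 := hasDerivAt_g2_y hq.2
  fin_cases i
  · refine ((h1.const_mul (Real.cos (U (q 0)))).sub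
      (h2.const_mul (Real.sin (U (q 0))))).congr_deriv ?_
    simp [confY, Real.cos_add, c1, c2]
    ring
  · refine ((h1.const_mul (Real.sin (U (q 0)))).add
      (h2.const_mul (Real.cos (U (q 0))))).congr_deriv ?_
    simp [confY, Real.sin_add, c1, c2]
    ring
  · exact hasDerivAt_const _ _

theorem differentiableAt_confX : DifferentiableAt ℝ (confX U a) q := by
  have hU' := contDiffOn_phase hU
  have hv := contDiffOn_conf_comp (a := a) (J := J) contDiffOn_vf
  have hu := hU'.add (contDiffOn_conf_comp (a := a) (J := J) contDiffOn_wf)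
  have h : ContDiffOn ℝ ∞ (confX U a) (confDom a J) := contDiffOn_space
    ((Real.contDiff_sinh.comp_contDiffOn hv).mul (Real.contDiff_sin.comp_contDiffOn hu)).neg
    ((Real.contDiff_sinh.comp_contDiffOn hv).mul (Real.contDiff_cos.comp_contDiffOn hu))
    contDiffOn_const
  exact (h.contDiffAt ((isOpen_confDom hU).mem_nhds hq)).differentiableAt (by simp)

theorem differentiableAt_confY : DifferentiableAt ℝ (confY U a) q := by
  have hU' := contDiffOn_phase hU
  have hv := contDiffOn_conf_comp (a := a) (J := J) contDiffOn_vf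
  have hu := hU'.add (contDiffOn_conf_comp (a := a) (J := J) contDiffOn_wf)
  have h : ContDiffOn ℝ ∞ (confY U a) (confDom a J) := contDiffOn_space
    ((Real.contDiff_cosh.comp_contDiffOn hv).mul (Real.contDiff_cos.comp_contDiffOn hu))
    ((Real.contDiff_cosh.comp_contDiffOn hv).mul (Real.contDiff_sin.comp_contDiffOn hu))
    contDiffOn_const
  exact (h.contDiffAt ((isOpen_confDom hU).mem_nhds hq)).differentiableAt (by simp)

theorem partialD_partialD_zero_conf (j : Fin 2) :
    partialD j (partialD 0 (conf U a)) q = partialD j (confX U a) q := by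
  have h : partialD 0 (conf U a) =ᶠ[𝓝 q] confX U a := by
    filter_upwards [(isOpen_confDom hU).mem_nhds hq] with z hz using partialD_zero_conf hU hz
  rw [partialD, h.fderiv_eq, partialD]

theorem partialD_partialD_one_conf (j : Fin 2) :
    partialD j (partialD 1 (conf U a)) q = partialD j (confY U a) q := by
  have h : partialD 1 (conf U a) =ᶠ[𝓝 q] confY U a := by
    filter_upwards [(isOpen_confDom hU).mem_nhds hq] with z hz using partialD_one_conf hU hz
  rw [partialD, h.fderiv_eq, partialD]

omit hU hq in
theorem cross_conf : cross (confX U a q) (confY U a q) = Real.cosh (vf ((a, q 0), q 1)) •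
    !₂[-Real.sin (U (q 0) + wf ((a, q 0), q 1)), Real.cos (U (q 0) + wf ((a, q 0), q 1)),
      -Real.sinh (vf ((a, q 0), q 1))] := by
  rw [cross_apply]
  ext i
  fin_cases i
  · simp [confX, confY]
  · simp [confX, confY]
  · simp [confX, confY]
    linear_combination -Real.sinh (vf ((a, q 0), q 1)) * Real.cosh (vf ((a, q 0), q 1)) *
      Real.sin_sq_add_cos_sq (U (q 0) + wf ((a, q 0), q 1))

theorem unitNormal_conf : unitNormal (conf U a) q = (Real.cosh (vf ((a, q 0), q 1)))⁻¹ •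
    !₂[-Real.sin (U (q 0) + wf ((a, q 0), q 1)), Real.cos (U (q 0) + wf ((a, q 0), q 1)),
      -Real.sinh (vf ((a, q 0), q 1))] := by
  have hc := Real.cosh_pos (vf ((a, q 0), q 1))
  have hn : ‖(!₂[-Real.sin (U (q 0) + wf ((a, q 0), q 1)),
      Real.cos (U (q 0) + wf ((a, q 0), q 1)),
      -Real.sinh (vf ((a, q 0), q 1))] : Space)‖ = Real.cosh (vf ((a, q 0), q 1)) := by
    rw [EuclideanSpace.norm_eq, Real.sqrt_eq_iff_mul_self_eq (by positivity) hc.le]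
    simp [Fin.sum_univ_three]
    have := Real.cosh_sq (vf ((a, q 0), q 1))
    have := Real.sin_sq_add_cos_sq (U (q 0) + wf ((a, q 0), q 1))
    linarith
  rw [unitNormal, partialD_zero_conf hU hq, partialD_one_conf hU hq, cross_conf, norm_smul, hn,
    smul_smul, Real.norm_of_nonneg hc.le]
  congr 1
  field_simp

theorem firstForm_conf : firstForm (conf U a) q =
    Real.cosh (vf ((a, q 0), q 1)) ^ 2 • (1 : Matrix (Fin 2) (Fin 2) ℝ) := by
  have hcs := Real.cosh_sq (vf ((a, q 0), q 1))
  have hsc := Real.sin_sq_add_cos_sq (U (q 0) + wf ((a, q 0), q 1))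
  ext j k
  fin_cases j <;> fin_cases k
  · simp [firstForm, partialD_zero_conf hU hq, inner_space, confX]
    linear_combination Real.sinh (vf ((a, q 0), q 1)) ^ 2 * hsc - hcs
  · simp [firstForm, partialD_zero_conf hU hq, partialD_one_conf hU hq, inner_space, confX, confY]
    ring
  · simp [firstForm, partialD_zero_conf hU hq, partialD_one_conf hU hq, inner_space, confX, confY]
    ring
  · simp [firstForm, partialD_one_conf hU hq, inner_space, confY]
    linear_combination Real.cosh (vf ((a, q 0), q 1)) ^ 2 * hsc

/-- The x- and y-derivatives of u + iv are k and ik, so only Re k and Im k appear. The trace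
vanishes, and as the first form is a multiple of the identity the surface is minimal. -/
theorem secondForm_conf : secondForm (conf U a) q =
    !![ki ((a, q 0), q 1), kr ((a, q 0), q 1); kr ((a, q 0), q 1), -ki ((a, q 0), q 1)] := by
  have hsc := Real.sin_sq_add_cos_sq (U (q 0) + wf ((a, q 0), q 1))
  have hc := (Real.cosh_pos (vf ((a, q 0), q 1))).ne'
  have hux := (hU.deriv _ hq.1).add (hasDerivAt_wf_x hq.2)
  have huy := (hasDerivAt_wf_y hq.2).const_add (U (q 0))
  have hvx := hasDerivAt_vf_x hq.2
  have hvy := hasDerivAt_vf_y hq.2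
  have hX0 : partialD 0 (confX U a) q = _ := partialD_zero_eq (differentiableAt_confX hU hq)
    (v := !₂[_, _, _]) (hasDerivAt_euclidean fun i => by
      fin_cases i
      exacts [(hvx.sinh.mul hux.sin).neg, hvx.sinh.mul hux.cos, hasDerivAt_const _ _])
  have hX1 : partialD 1 (confX U a) q = _ := partialD_one_eq (differentiableAt_confX hU hq)
    (v := !₂[_, _, _]) (hasDerivAt_euclidean fun i => by
      fin_cases i
      exacts [(hvy.sinh.mul huy.sin).neg, hvy.sinh.mul huy.cos, hasDerivAt_const _ _])
  have hY0 : partialD 0 (confY U a) q = _ := partialD_zero_eq (differentiableAt_confY hU hq)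
    (v := !₂[_, _, _]) (hasDerivAt_euclidean fun i => by
      fin_cases i
      exacts [hvx.cosh.mul hux.cos, hvx.cosh.mul hux.sin, hasDerivAt_const _ _])
  have hY1 : partialD 1 (confY U a) q = _ := partialD_one_eq (differentiableAt_confY hU hq)
    (v := !₂[_, _, _]) (hasDerivAt_euclidean fun i => by
      fin_cases i
      exacts [hvy.cosh.mul huy.cos, hvy.cosh.mul huy.sin, hasDerivAt_const _ _])
  ext j k
  fin_cases j <;> fin_cases k
  · simp only [secondForm, Matrix.of_apply, Fin.zero_eta, partialD_partialD_zero_conf hU hq, hX0,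
      unitNormal_conf hU hq, inner_space]
    simp
    field_simp
    linear_combination ki ((a, q 0), q 1) * Real.cosh (vf ((a, q 0), q 1)) * hsc
  · simp only [secondForm, Matrix.of_apply, Fin.zero_eta, Fin.mk_one,
      partialD_partialD_one_conf hU hq, hY0, unitNormal_conf hU hq, inner_space]
    simp
    field_simp
    linear_combination kr ((a, q 0), q 1) * Real.cosh (vf ((a, q 0), q 1)) * hsc
  · simp only [secondForm, Matrix.of_apply, Fin.zero_eta, Fin.mk_one,
      partialD_partialD_zero_conf hU hq, hX1, unitNormal_conf hU hq, inner_space]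
    simp
    field_simp
    linear_combination kr ((a, q 0), q 1) * Real.cosh (vf ((a, q 0), q 1)) * hsc
  · simp only [secondForm, Matrix.of_apply, Fin.mk_one, partialD_partialD_one_conf hU hq, hY1,
      unitNormal_conf hU hq, inner_space]
    simp
    field_simp
    linear_combination -ki ((a, q 0), q 1) * Real.cosh (vf ((a, q 0), q 1)) * hsc

theorem shapeOperator_conf : shapeOperator (conf U a) q =
    (Real.cosh (vf ((a, q 0), q 1)) ^ 2)⁻¹ • !![ki ((a, q 0), q 1), kr ((a, q 0), q 1);
      kr ((a, q 0), q 1), -ki ((a, q 0), q 1)] := by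
  have hc := Real.cosh_pos (vf ((a, q 0), q 1))
  have h : (Real.cosh (vf ((a, q 0), q 1)) ^ 2 • (1 : Matrix (Fin 2) (Fin 2) ℝ))⁻¹ =
      (Real.cosh (vf ((a, q 0), q 1)) ^ 2)⁻¹ • (1 : Matrix (Fin 2) (Fin 2) ℝ) := by
    refine Matrix.inv_eq_right_inv ?_
    rw [Matrix.smul_mul, Matrix.one_mul, smul_smul, mul_inv_cancel₀ (by positivity), one_smul]
  rw [shapeOperator, firstForm_conf hU hq, secondForm_conf hU hq, h, Matrix.smul_mul,
    Matrix.one_mul]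

theorem meanCurvature_conf : meanCurvature (conf U a) q = 0 := by
  rw [meanCurvature, shapeOperator_conf hU hq]
  simp [Matrix.trace_fin_two]

theorem normSqA_conf : normSqA (conf U a) q = 2 * (kr ((a, q 0), q 1) ^ 2 +
    ki ((a, q 0), q 1) ^ 2) / Real.cosh (vf ((a, q 0), q 1)) ^ 4 := by
  have hc := Real.cosh_pos (vf ((a, q 0), q 1))
  rw [normSqA, shapeOperator_conf hU hq]
  simp [Matrix.trace_fin_two]
  field_simp
  ring

theorem injective_fderiv_conf : Function.Injective (fderiv ℝ (conf U a) q) := by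
  rw [injective_iff_map_eq_zero]
  intro w hw
  have h0 := partialD_zero_conf hU hq
  have h1 := partialD_one_conf hU hq
  simp only [partialD] at h0 h1
  rw [clm_plane_apply, h0, h1] at hw
  have e2 := congrArg (fun z : Space => z 2) hw
  have e0 := congrArg (fun z : Space => z 0) hw
  have e1 := congrArg (fun z : Space => z 1) hw
  simp [confX, confY] at e0 e1 e2
  have hw1 : w 1 = 0 := by
    have hc := Real.cosh_pos (vf ((a, q 0), q 1))
    have hsc := Real.sin_sq_add_cos_sq (U (q 0) + wf ((a, q 0), q 1))
    rw [e2] at e0 e1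
    have : w 1 * Real.cosh (vf ((a, q 0), q 1)) = 0 := by
      linear_combination Real.cos (U (q 0) + wf ((a, q 0), q 1)) * e0 +
        Real.sin (U (q 0) + wf ((a, q 0), q 1)) * e1 -
        w 1 * Real.cosh (vf ((a, q 0), q 1)) * hsc
    exact (mul_eq_zero.1 this).resolve_right hc.ne'
  ext i
  fin_cases i
  exacts [e2, hw1]

end Conf

/-! ### Immersions and embeddings from left inverses; norms -/

theorem injective_fderiv_of_leftInverse {E G : Type} [NormedAddCommGroup E] [NormedSpace ℝ E]
    [NormedAddCommGroup G] [NormedSpace ℝ G] {φ : E → G} {χ : G → E} {q : E}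
    (hφ : DifferentiableAt ℝ φ q) (hχ : DifferentiableAt ℝ χ (φ q))
    (h : ∀ᶠ z in 𝓝 q, χ (φ z) = z) : Function.Injective (fderiv ℝ φ q) := by
  have h1 : HasFDerivAt (fun z => χ (φ z)) ((fderiv ℝ χ (φ q)).comp (fderiv ℝ φ q)) q :=
    hχ.hasFDerivAt.comp q hφ.hasFDerivAt
  have h2 := h1.unique ((hasFDerivAt_id q).congr_of_eventuallyEq h)
  exact Function.LeftInverse.injective (g := fderiv ℝ χ (φ q)) fun v =>
    by simpa using congrArg (fun L : E →L[ℝ] E => L v) h2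

theorem isEmbedding_domRestrict {X Y : Type} [TopologicalSpace X] [TopologicalSpace Y] {f : X → Y}
    {g : Y → X} {D : Set X} {T : Set Y} (hf : ContinuousOn f D) (hg : ContinuousOn g T)
    (hT : MapsTo f D T) (h : LeftInvOn g f D) : IsEmbedding (D.domRestrict f) := by
  have h1 : Continuous (fun q : D => (⟨f q, hT q.2⟩ : T)) :=
    Continuous.subtype_mk hf.domRestrict _
  have h2 : IsEmbedding ((T.domRestrict g) ∘ fun q : D => (⟨f q, hT q.2⟩ : T)) := by
    have : (T.domRestrict g) ∘ (fun q : D => (⟨f q, hT q.2⟩ : T)) = Subtype.val := by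
      ext q
      exact h q.2
    rw [this]
    exact IsEmbedding.subtypeVal
  exact IsEmbedding.subtypeVal.comp (IsEmbedding.of_comp h1 hg.domRestrict h2)

/-! ### Norms -/

theorem norm_plane_sq (q : Plane) : ‖q‖ ^ 2 = q 0 ^ 2 + q 1 ^ 2 := by
  rw [EuclideanSpace.norm_sq_eq]; simp [Fin.sum_univ_two]

theorem norm_space_sq (p : Space) : ‖p‖ ^ 2 = p 0 ^ 2 + p 1 ^ 2 + p 2 ^ 2 := by
  rw [EuclideanSpace.norm_sq_eq]; simp [Fin.sum_univ_three]

/-- Each point (r, 0, x) is only rotated about the axis. Therefore the unit ball cuts out exactly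
the image of the unit disk of parameters, so that the intersection is a disk with boundary on the
sphere. -/
theorem norm_surf (U : ℝ → ℝ) (a : ℝ) (q : Plane) : ‖surf U a q‖ = ‖q‖ := by
  rw [← sq_eq_sq₀ (norm_nonneg _) (norm_nonneg _), norm_plane_sq, norm_space_sq]
  simp [surf, spiralPt]
  linear_combination q 1 ^ 2 * Real.sin_sq_add_cos_sq (ang U a (q 0) (q 1))

/-- The distance to the axis. -/
def axr (p : Space) : ℝ := √(p 0 ^ 2 + p 1 ^ 2)

theorem axr_sq (p : Space) : axr p ^ 2 = p 0 ^ 2 + p 1 ^ 2 := Real.sq_sqrt (by positivity)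

theorem axr_nonneg (p : Space) : 0 ≤ axr p := Real.sqrt_nonneg _

theorem continuous_axr : Continuous axr := by
  unfold axr
  fun_prop

theorem axr_surf (U : ℝ → ℝ) (a : ℝ) (q : Plane) : axr (surf U a q) = |q 1| := by
  rw [axr, ← Real.sqrt_sq_eq_abs]
  congr 1
  simp [surf, spiralPt]
  linear_combination q 1 ^ 2 * Real.sin_sq_add_cos_sq (ang U a (q 0) (q 1))

/-! ### Surfaces composed with a change of parameters -/

/-- The domain of `surf` in the coordinates `(x, r)`. -/
def surfDom (J : Set ℝ) : Set Plane := {q | q 0 ∈ J ∧ |q 1| < 2}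

section Surf

variable {a : ℝ} {J : Set ℝ} {U : ℝ → ℝ} (hU : IsPhase a J U)
include hU

theorem mem_rDom {x r : ℝ} (hx : x ∈ J) (hr : |r| < 2) : ((a, x), r) ∈ rDom :=
  ⟨hU.sz_mem x hx, hr⟩

theorem isOpen_surfDom : IsOpen (surfDom J) :=
  (hU.isOpen.preimage contDiff_proj_zero.continuous).inter
    (isOpen_lt contDiff_proj_one.continuous.abs continuous_const)

theorem contDiffOn_ang : ContDiffOn ℝ ∞ (fun q : ℝ × ℝ => ang U a q.1 q.2)
    {q | q.1 ∈ J ∧ |q.2| < 2} := by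
  refine (hU.smooth.comp contDiffOn_fst fun q hq => hq.1).add
    (contDiffOn_psiR.comp (ContDiff.contDiffOn (by fun_prop)) fun q hq => mem_rDom hU hq.1 hq.2)

theorem contDiffOn_surf : ContDiffOn ℝ ∞ (surf U a) (surfDom J) := by
  have h : ContDiffOn ℝ ∞ (fun q : Plane => ang U a (q 0) (q 1)) (surfDom J) :=
    (contDiffOn_ang hU).comp (contDiff_proj_zero.prodMk contDiff_proj_one).contDiffOn
      fun q hq => hq
  exact contDiffOn_space
    (contDiff_proj_one.contDiffOn.mul (Real.contDiff_cos.comp_contDiffOn h))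
    (contDiff_proj_one.contDiffOn.mul (Real.contDiff_sin.comp_contDiffOn h))
    contDiff_proj_zero.contDiffOn

theorem ang_abs {x r : ℝ} (hx : x ∈ J) (hr : |r| < 2) : ang U a x |r| = ang U a x r := by
  rcases abs_choice r with h | h
  · rw [h]
  · rw [h, ang, psiR_neg (mem_rDom hU hx hr), ang]

omit hU in
/-- The inverse of `surf`. -/
def unsurf (U : ℝ → ℝ) (a : ℝ) (p : Space) : Plane :=
  !₂[p 2, p 0 * Real.cos (ang U a (p 2) (axr p)) + p 1 * Real.sin (ang U a (p 2) (axr p))]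

/-- The angle is even in r, so it is known from the height and the distance to the axis; projecting
onto the line with this angle recovers r with its sign. The distance is not smooth on the axis, but
a continuous inverse suffices for an embedding. -/
theorem unsurf_surf {q : Plane} (hq : q ∈ surfDom J) : unsurf U a (surf U a q) = q := by
  have h1 : (surf U a q) 2 = q 0 := by simp [surf, spiralPt]
  rw [unsurf, axr_surf, h1, ang_abs hU hq.1 hq.2]
  ext i
  fin_cases i
  · simp
  · simp [surf, spiralPt]
    linear_combination q 1 * Real.sin_sq_add_cos_sq (ang U a (q 0) (q 1))

theorem surf_injOn : InjOn (surf U a) (surfDom J) :=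
  LeftInvOn.injOn (f₁' := unsurf U a) fun _ hq => unsurf_surf hU hq

omit hU in
/-- The region around the axis in which `unsurf` is continuous. -/
def surfRange (J : Set ℝ) : Set Space := {p | p 2 ∈ J ∧ axr p < 2}

theorem continuousOn_ang_axr :
    ContinuousOn (fun p : Space => ang U a (p 2) (axr p)) (surfRange J) := by
  have h2 : Continuous fun p : Space => p 2 := by fun_prop
  refine (contDiffOn_ang hU).continuousOn.comp (h2.prodMk continuous_axr).continuousOn
    fun p hp => ⟨hp.1, ?_⟩
  simpa only [abs_of_nonneg (axr_nonneg p)] using hp.2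

theorem continuousOn_unsurf : ContinuousOn (unsurf U a) (surfRange J) := by
  have h := continuousOn_ang_axr hU
  have h0 : Continuous fun p : Space => p 0 := by fun_prop
  have h1 : Continuous fun p : Space => p 1 := by fun_prop
  have h2 : Continuous fun p : Space => p 2 := by fun_prop
  refine (PiLp.continuous_toLp 2 _).comp_continuousOn (continuousOn_pi.2 fun i => ?_)
  fin_cases i
  · exact h2.continuousOn
  · exact (h0.continuousOn.mul (Real.continuous_cos.comp_continuousOn h)).add
      (h1.continuousOn.mul (Real.continuous_sin.comp_continuousOn h))

omit hU in
theorem surf_mem_surfRange {q : Plane} (hq : q ∈ surfDom J) : surf U a q ∈ surfRange J := by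
  refine ⟨?_, ?_⟩
  · simpa [surf, spiralPt] using hq.1
  · rw [axr_surf]; exact hq.2

theorem contDiffOn_toConf : ContDiffOn ℝ ∞ (toConf a) (surfDom J) := by
  rw [contDiffOn_euclidean]
  intro i
  fin_cases i
  · exact contDiff_proj_zero.contDiffOn
  · exact contDiffOn_yf.comp (contDiff_toPt a).contDiffOn fun q hq => mem_rDom hU hq.1 hq.2

theorem toConf_mem {q : Plane} (hq : q ∈ surfDom J) : toConf a q ∈ confDom a J := by
  refine ⟨by simpa [toConf] using hq.1, ?_⟩
  simpa [toConf] using yf_mem (mem_rDom hU hq.1 hq.2)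

theorem injective_fderiv_toConf {q : Plane} (hq : q ∈ surfDom J) :
    Function.Injective (fderiv ℝ (toConf a) q) := by
  have hmem := (isOpen_surfDom hU).mem_nhds hq
  let χ : Plane → Plane := fun z => !₂[z 0, rf ((a, z 0), z 1)]
  have hχ : ContDiffOn ℝ ∞ χ (confDom a J) := by
    rw [contDiffOn_euclidean]
    intro i
    fin_cases i
    · exact contDiff_proj_zero.contDiffOn
    · exact contDiffOn_conf_comp contDiffOn_rf
  refine injective_fderiv_of_leftInverse (χ := χ)
    (((contDiffOn_toConf hU).contDiffAt hmem).differentiableAt (by simp))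
    ((hχ.contDiffAt ((isOpen_confDom hU).mem_nhds (toConf_mem hU hq))).differentiableAt (by simp)) ?_
  filter_upwards [hmem] with z hz
  have h := rf_yf (mem_rDom hU hz.1 hz.2)
  ext i
  fin_cases i
  · simp [χ, toConf]
  · simpa [χ, toConf] using h

omit hU in
/-- `|A|²` at the point with height `x` and signed distance `r` to the axis. -/
def curvAt (a x r : ℝ) : ℝ := 2 * (kr ((a, x), yf ((a, x), r)) ^ 2 +
  ki ((a, x), yf ((a, x), r)) ^ 2) / Real.cosh (vf ((a, x), yf ((a, x), r))) ^ 4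

omit hU in
/-- `|⟨n, e₃⟩|` at the point with height `x` and signed distance `r` to the axis. -/
def tiltAt (a x r : ℝ) : ℝ :=
  |Real.sinh (vf ((a, x), yf ((a, x), r)))| / Real.cosh (vf ((a, x), yf ((a, x), r)))

variable {κ : Plane → Plane} {q : Plane} (hκ : ContDiffAt ℝ ∞ κ q) (hq : κ q ∈ surfDom J)
  (hinj : Function.Injective (fderiv ℝ κ q))
include hκ hq

theorem surf_comp_eventuallyEq : surf U a ∘ κ =ᶠ[𝓝 q] conf U a ∘ (toConf a ∘ κ) := by
  filter_upwards [hκ.continuousAt ((isOpen_surfDom hU).mem_nhds hq)] with z hz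
  exact surf_eq_conf U (mem_rDom hU hz.1 hz.2)

theorem contDiffAt_toConf_comp : ContDiffAt ℝ ∞ (toConf a ∘ κ) q :=
  ((contDiffOn_toConf hU).contDiffAt ((isOpen_surfDom hU).mem_nhds hq)).comp q hκ

omit hκ in
theorem contDiffAt_conf_toConf : ContDiffAt ℝ ∞ (conf U a) ((toConf a ∘ κ) q) :=
  (contDiffOn_conf hU).contDiffAt ((isOpen_confDom hU).mem_nhds (toConf_mem hU hq))

include hinj

theorem injective_fderiv_toConf_comp : Function.Injective (fderiv ℝ (toConf a ∘ κ) q) := by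
  rw [fderiv_comp q (((contDiffOn_toConf hU).contDiffAt
    ((isOpen_surfDom hU).mem_nhds hq)).differentiableAt (by simp)) (hκ.differentiableAt (by simp))]
  exact (injective_fderiv_toConf hU hq).comp hinj

theorem injective_fderiv_surf_comp : Function.Injective (fderiv ℝ (surf U a ∘ κ) q) := by
  rw [(surf_comp_eventuallyEq hU hκ hq).fderiv_eq, fderiv_comp q
    ((contDiffAt_conf_toConf hU hq).differentiableAt (by simp))
    ((contDiffAt_toConf_comp hU hκ hq).differentiableAt (by simp))]
  exact (injective_fderiv_conf hU (toConf_mem hU hq)).comp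
    (injective_fderiv_toConf_comp hU hκ hq hinj)

theorem meanCurvature_surf_comp : meanCurvature (surf U a ∘ κ) q = 0 :=
  meanCurvature_reparam (contDiffAt_toConf_comp hU hκ hq) (contDiffAt_conf_toConf hU hq)
    (surf_comp_eventuallyEq hU hκ hq)
    (jacobian_det_ne_zero (injective_fderiv_toConf_comp hU hκ hq hinj))
    (meanCurvature_conf hU (toConf_mem hU hq))

theorem normSqA_surf_comp : normSqA (surf U a ∘ κ) q = curvAt a (κ q 0) (κ q 1) := by
  rw [normSqA_reparam (contDiffAt_toConf_comp hU hκ hq) (contDiffAt_conf_toConf hU hq)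
    (surf_comp_eventuallyEq hU hκ hq)
    (jacobian_det_ne_zero (injective_fderiv_toConf_comp hU hκ hq hinj))]
  exact normSqA_conf hU (toConf_mem hU hq)

theorem abs_unitNormal_surf_comp : |unitNormal (surf U a ∘ κ) q 2| =
    tiltAt a (κ q 0) (κ q 1) := by
  have hc := Real.cosh_pos (vf ((a, κ q 0), yf ((a, κ q 0), κ q 1)))
  rw [abs_unitNormal_reparam (contDiffAt_toConf_comp hU hκ hq) (contDiffAt_conf_toConf hU hq)
    (surf_comp_eventuallyEq hU hκ hq)
    (jacobian_det_ne_zero (injective_fderiv_toConf_comp hU hκ hq hinj)), Function.comp_apply,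
    unitNormal_conf hU (toConf_mem hU hq)]
  simp [toConf, tiltAt, abs_mul, abs_of_pos hc]
  field_simp

end Surf

/-! ### Embedded minimal disks from changes of parameters -/

/-- A change of parameters from `dom`, the open unit disk with a part of its boundary, onto the
part of the closed unit disk over `J`, with a smooth inverse. -/
structure IsDiskParam (J : Set ℝ) (dom : Set Plane) (κ χ : Plane → Plane) : Prop where
  nhd : ∃ V V' : Set Plane, IsOpen V ∧ IsOpen V' ∧ dom ⊆ V ∧ ContDiffOn ℝ ∞ κ V ∧
    ContDiffOn ℝ ∞ χ V' ∧ MapsTo κ V (surfDom J ∩ V') ∧ ∀ q ∈ V, χ (κ q) = q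
  ball_subset : Metric.ball 0 1 ⊆ dom
  dom_eq : ∃ O : Set Plane, IsOpen O ∧ dom = O ∩ Metric.closedBall 0 1
  image_eq : κ '' dom = {q | q 0 ∈ J ∧ ‖q‖ ≤ 1}
  norm_eq : ∀ q ∈ dom, ‖q‖ = 1 → ‖κ q‖ = 1

section Disk

variable {a : ℝ} {J : Set ℝ} {U : ℝ → ℝ} (hU : IsPhase a J U) {dom : Set Plane}
  {κ χ : Plane → Plane} (hκ : IsDiskParam J dom κ χ)

theorem IsDiskParam.spec (hκ : IsDiskParam J dom κ χ) {q : Plane} (hq : q ∈ dom) :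
    ContDiffAt ℝ ∞ κ q ∧ κ q ∈ surfDom J ∧ Function.Injective (fderiv ℝ κ q) ∧ χ (κ q) = q := by
  obtain ⟨V, V', hV, hV', hdV, h1, h2, hm, hl⟩ := hκ.nhd
  have hn := hV.mem_nhds (hdV hq)
  refine ⟨h1.contDiffAt hn, (hm (hdV hq)).1, ?_, hl q (hdV hq)⟩
  refine injective_fderiv_of_leftInverse ((h1.contDiffAt hn).differentiableAt (by simp))
    ((h2.contDiffAt (hV'.mem_nhds (hm (hdV hq)).2)).differentiableAt (by simp)) ?_
  filter_upwards [hn] with z hz using hl z hz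

theorem abs_apply_one_le {q : Plane} (h : ‖q‖ ≤ 1) : |q 1| ≤ 1 := by
  have := norm_plane_sq q
  have : ‖q‖ ^ 2 ≤ 1 := pow_le_one₀ (norm_nonneg _) h
  exact abs_le_one_iff_mul_self_le_one.2 (by nlinarith [sq_nonneg (q 0)])

theorem mem_surfDom_of_norm_le {q : Plane} (hJ : q 0 ∈ J) (h : ‖q‖ ≤ 1) : q ∈ surfDom J :=
  ⟨hJ, by linarith [abs_apply_one_le h]⟩

include hU hκ in
theorem isSmoothEmbeddingOn_surf_comp : IsSmoothEmbeddingOn (surf U a ∘ κ) dom := by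
  obtain ⟨V, V', hV, hV', hdV, h1, h2, hm, hl⟩ := hκ.nhd
  refine ⟨⟨V, hV, hdV, (contDiffOn_surf hU).comp h1 fun q hq => (hm hq).1⟩, fun q hq => ?_, ?_⟩
  · obtain ⟨e1, e2, e3, -⟩ := hκ.spec hq
    exact injective_fderiv_surf_comp hU e1 e2 e3
  · have hc := ((contDiffOn_surf hU).comp h1 fun q hq => (hm hq).1).continuousOn.mono hdV
    refine isEmbedding_domRestrict (T := surfRange J ∩ unsurf U a ⁻¹' V') (g := χ ∘ unsurf U a)
      hc ?_ ?_ ?_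
    · exact h2.continuousOn.comp ((continuousOn_unsurf hU).mono inter_subset_left)
        fun p hp => hp.2
    · intro q hq
      refine ⟨surf_mem_surfRange (hm (hdV hq)).1, ?_⟩
      change unsurf U a (surf U a (κ q)) ∈ V'
      rw [unsurf_surf hU (hm (hdV hq)).1]
      exact (hm (hdV hq)).2
    · intro q hq
      change χ (unsurf U a (surf U a (κ q))) = q
      rw [unsurf_surf hU (hm (hdV hq)).1, hl q (hdV hq)]

/-- The embedded minimal disk parametrized by `surf U a ∘ κ`. -/
def spiralDisk : EmbeddedMinimalDisk where
  dom := dom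
  ball_subset_dom := hκ.ball_subset
  dom_eq := hκ.dom_eq
  toFun := surf U a ∘ κ
  embedded := isSmoothEmbeddingOn_surf_comp hU hκ
  minimal q hq := by
    obtain ⟨e1, e2, e3, -⟩ := hκ.spec hq
    exact meanCurvature_surf_comp hU e1 e2 e3

theorem spiralDisk_carrier :
    (spiralDisk hU hκ).carrier = surf U a '' {q | q 0 ∈ J ∧ ‖q‖ ≤ 1} := by
  rw [← hκ.image_eq, ← image_comp]
  rfl

theorem spiralDisk_boundary : (spiralDisk hU hκ).boundary ⊆ Metric.sphere 0 1 := by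
  rintro _ ⟨q, ⟨hq, h1⟩, rfl⟩
  rw [mem_sphere_zero_iff_norm] at h1 ⊢
  change ‖surf U a (κ q)‖ = 1
  rw [norm_surf]
  exact hκ.norm_eq q hq h1

theorem spiralDisk_carrier_subset : (spiralDisk hU hκ).carrier ⊆ Metric.closedBall 0 1 := by
  rw [spiralDisk_carrier]
  rintro _ ⟨q, hq, rfl⟩
  rw [mem_closedBall_zero_iff, norm_surf]
  exact hq.2

theorem EmbeddedMinimalDisk.param_toFun (S : EmbeddedMinimalDisk) {q : Plane} (hq : q ∈ S.dom) :
    S.param (S.toFun q) = q :=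
  (injOn_iff_injective.2 S.embedded.embedding.injective).leftInvOn_invFunOn hq

theorem spiralDisk_curvSq {q : Plane} (hJ : q 0 ∈ J) (h1 : ‖q‖ ≤ 1) :
    (spiralDisk hU hκ).curvSq (surf U a q) = curvAt a (q 0) (q 1) := by
  obtain ⟨z, hz, rfl⟩ : q ∈ κ '' dom := by rw [hκ.image_eq]; exact ⟨hJ, h1⟩
  obtain ⟨e1, e2, e3, -⟩ := hκ.spec hz
  rw [← normSqA_surf_comp hU e1 e2 e3]
  change normSqA _ ((spiralDisk hU hκ).param ((spiralDisk hU hκ).toFun z)) = _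
  rw [EmbeddedMinimalDisk.param_toFun _ hz]
  rfl

theorem spiralDisk_normal {q : Plane} (hJ : q 0 ∈ J) (h1 : ‖q‖ ≤ 1) :
    |(spiralDisk hU hκ).normal (surf U a q) 2| = tiltAt a (q 0) (q 1) := by
  obtain ⟨z, hz, rfl⟩ : q ∈ κ '' dom := by rw [hκ.image_eq]; exact ⟨hJ, h1⟩
  obtain ⟨e1, e2, e3, -⟩ := hκ.spec hz
  rw [← abs_unitNormal_surf_comp hU e1 e2 e3]
  change |unitNormal _ ((spiralDisk hU hκ).param ((spiralDisk hU hκ).toFun z)) 2| = _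
  rw [EmbeddedMinimalDisk.param_toFun _ hz]
  rfl

theorem plane_ext {q z : Plane} (h0 : q 0 = z 0) (h1 : q 1 = z 1) : q = z := by
  ext i
  fin_cases i
  exacts [h0, h1]

theorem space_ext {p z : Space} (h0 : p 0 = z 0) (h1 : p 1 = z 1) (h2 : p 2 = z 2) : p = z := by
  ext i
  fin_cases i
  exacts [h0, h1, h2]

/-- An implicit equation: the horizontal part of `p` lies on the line with the prescribed angle. It
does not involve the sign of r and is continuous in `p`, so it serves for the closure of the disk
and for the lamination charts. -/
theorem mem_spiralDisk_carrier {p : Space} : p ∈ (spiralDisk hU hκ).carrier ↔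
    (p 2 ∈ J ∧ ‖p‖ ≤ 1) ∧ p 1 * Real.cos (ang U a (p 2) (axr p)) -
      p 0 * Real.sin (ang U a (p 2) (axr p)) = 0 := by
  rw [spiralDisk_carrier]
  constructor
  · rintro ⟨q, ⟨hq, h1⟩, rfl⟩
    have h2 : (surf U a q) 2 = q 0 := by simp [surf, spiralPt]
    have hd := mem_surfDom_of_norm_le hq h1
    refine ⟨⟨by rwa [h2], by rwa [norm_surf]⟩, ?_⟩
    rw [axr_surf, h2, ang_abs hU hq hd.2]
    simp [surf, spiralPt]
    ring
  · rintro ⟨⟨hp, h1⟩, h0⟩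
    have hsc := Real.sin_sq_add_cos_sq (ang U a (p 2) (axr p))
    have hz1 : unsurf U a p 1 = p 0 * Real.cos (ang U a (p 2) (axr p)) +
      p 1 * Real.sin (ang U a (p 2) (axr p)) := rfl
    have hz0 : unsurf U a p 0 = p 2 := rfl
    have hsq : unsurf U a p 1 ^ 2 = axr p ^ 2 := by
      rw [hz1, axr_sq]
      linear_combination (p 0 ^ 2 + p 1 ^ 2) * hsc - (p 1 * Real.cos (ang U a (p 2) (axr p)) -
        p 0 * Real.sin (ang U a (p 2) (axr p))) * h0
    have habs : |unsurf U a p 1| = axr p := by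
      rw [← abs_of_nonneg (axr_nonneg p)]; exact (sq_eq_sq_iff_abs_eq_abs _ _).1 hsq
    have hnorm : ‖unsurf U a p‖ = ‖p‖ := by
      rw [← sq_eq_sq₀ (norm_nonneg _) (norm_nonneg _), norm_plane_sq, norm_space_sq, hsq, hz0,
        axr_sq]
      ring
    have h2 : |unsurf U a p 1| < 2 := by
      linarith [abs_apply_one_le (q := unsurf U a p) (by rwa [hnorm])]
    refine ⟨unsurf U a p, ⟨hp, by rwa [hnorm]⟩, ?_⟩
    have hang : ang U a (unsurf U a p 0) (unsurf U a p 1) = ang U a (p 2) (axr p) := by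
      rw [hz0, ← ang_abs hU hp h2, habs]
    refine space_ext ?_ ?_ rfl
    · change unsurf U a p 1 * Real.cos (ang U a (unsurf U a p 0) (unsurf U a p 1)) = p 0
      rw [hang, hz1]
      linear_combination p 0 * hsc + Real.sin (ang U a (p 2) (axr p)) * h0
    · change unsurf U a p 1 * Real.sin (ang U a (unsurf U a p 0) (unsurf U a p 1)) = p 1
      rw [hang, hz1]
      linear_combination p 1 * hsc - Real.cos (ang U a (p 2) (axr p)) * h0

theorem axis_mem_spiralDisk {t : ℝ} (ht : t ∈ J) (h1 : |t| ≤ 1) :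
    !₂[0, 0, t] ∈ (spiralDisk hU hκ).carrier := by
  rw [mem_spiralDisk_carrier]
  refine ⟨⟨ht, ?_⟩, by simp⟩
  have h : ‖(!₂[0, 0, t] : Space)‖ ^ 2 = t ^ 2 := by rw [norm_space_sq]; simp
  have h2 : t ^ 2 ≤ 1 := by rw [← sq_abs]; exact pow_le_one₀ (abs_nonneg _) h1
  exact (sq_le_one_iff₀ (norm_nonneg _)).1 (h ▸ h2)

end Disk

/-! ### Curvature estimates -/

section Curvature

variable {a x r : ℝ} (hq : ((a, x), r) ∈ rDom)
include hq

/-- Combines |r| ≤ 2|y| cosh v with y⁴ < kap⁴ sz³. At a fixed distance from the axis, small sz thus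
forces large cosh v; the curvature bound and the tilt of the tangent planes both rest on this. -/
theorem pow_four_le : r ^ 4 ≤ 16 * kap ^ 4 * sz (a, x) ^ 3 *
    Real.cosh (vf ((a, x), yf ((a, x), r))) ^ 4 := by
  have hp := yf_mem hq
  have h1 := abs_rf_le hp
  rw [rf_yf hq] at h1
  have h2 : |r| ^ 4 ≤ (2 * |yf ((a, x), r)| * Real.cosh (vf ((a, x), yf ((a, x), r)))) ^ 4 := by
    gcongr
  rw [Even.pow_abs (by decide : Even 4), mul_pow, mul_pow, Even.pow_abs (by decide : Even 4)] at h2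
  refine h2.trans ?_
  have h3 := hp.1.le
  have := Real.cosh_pos (vf ((a, x), yf ((a, x), r)))
  calc _ ≤ 2 ^ 4 * (kap ^ 4 * sz (a, x) ^ 3) * Real.cosh (vf ((a, x), yf ((a, x), r))) ^ 4 := by
        gcongr
    _ = _ := by ring

theorem curvAt_le_of_sz : curvAt a x r ≤ 4 * lam ^ 2 / sz (a, x) ^ 2 := by
  have hp := yf_mem hq
  have h1 := kr_sq_add_ki_sq hp
  have hc := Real.one_le_cosh (vf ((a, x), yf ((a, x), r)))
  have h2 : (1 : ℝ) ≤ Real.cosh (vf ((a, x), yf ((a, x), r))) ^ 4 := one_le_pow₀ hc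
  refine (div_le_self (by positivity) h2).trans ?_
  calc _ ≤ 2 * (2 * lam ^ 2 / sz (a, x) ^ 2) := by gcongr
    _ = _ := by ring

/-- The factor cosh⁻⁴ v, at most of order sz³ / r⁴, outweighs |k|² of order sz⁻². What remains is sz
/ r⁴ with a constant made small by 32 kap⁴ lam² = 1/8, and sz < 4. -/
theorem curvAt_le_of_ne (hr : r ≠ 0) : curvAt a x r ≤ 1 / r ^ 4 := by
  have hp := yf_mem hq
  have h0 : 0 < sz (a, x) := hq.1.1
  have h1 := kr_sq_add_ki_sq hp
  have hc := Real.cosh_pos (vf ((a, x), yf ((a, x), r)))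
  have h2 := pow_four_le hq
  have h4 : sz (a, x) < 4 := hq.1.2
  have hr4 : 0 < r ^ 4 := by positivity
  have h5 : r ^ 4 * (kr ((a, x), yf ((a, x), r)) ^ 2 + ki ((a, x), yf ((a, x), r)) ^ 2) ≤
      16 * kap ^ 4 * sz (a, x) ^ 3 * Real.cosh (vf ((a, x), yf ((a, x), r))) ^ 4 *
        (2 * lam ^ 2 / sz (a, x) ^ 2) :=
    mul_le_mul h2 h1 (by positivity) (by positivity)
  have h6 : 16 * kap ^ 4 * sz (a, x) ^ 3 * Real.cosh (vf ((a, x), yf ((a, x), r))) ^ 4 *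
        (2 * lam ^ 2 / sz (a, x) ^ 2) = (32 * kap ^ 4 * lam ^ 2) * sz (a, x) *
        Real.cosh (vf ((a, x), yf ((a, x), r))) ^ 4 := by
    field_simp
    ring
  have h7 : 32 * kap ^ 4 * lam ^ 2 = 1 / 8 := by norm_num [kap, lam]
  rw [h6, h7] at h5
  rw [curvAt, div_le_div_iff₀ (by positivity) hr4]
  have hc4 : 0 < Real.cosh (vf ((a, x), yf ((a, x), r))) ^ 4 := by positivity
  nlinarith

/-- At distance at least δ from the origin, x² or r² is at least δ²/2; each case has its own bound.
-/
theorem curvAt_le {δ : ℝ} (hδ : 0 < δ) (h : δ ^ 2 ≤ x ^ 2 + r ^ 2) :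
    curvAt a x r ≤ 16 * lam ^ 2 / δ ^ 4 := by
  have h0 : 0 < sz (a, x) := hq.1.1
  have hl : 1 ≤ lam := by norm_num [lam]
  rcases le_total (δ ^ 2 / 2) (x ^ 2) with hx | hx
  · refine (curvAt_le_of_sz hq).trans ?_
    have h1 : δ ^ 2 / 2 ≤ sz (a, x) := by unfold sz; nlinarith [sq_nonneg a]
    have h2 : (δ ^ 2 / 2) ^ 2 ≤ sz (a, x) ^ 2 := by gcongr
    rw [div_le_div_iff₀ (by positivity) (by positivity)]
    nlinarith [sq_nonneg lam]
  · have hr : δ ^ 2 / 2 ≤ r ^ 2 := by linarith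
    have hr0 : r ≠ 0 := by
      rintro rfl
      have : 0 < δ ^ 2 := by positivity
      norm_num at hr
      linarith
    refine (curvAt_le_of_ne hq hr0).trans ?_
    have h2 : (δ ^ 2 / 2) ^ 2 ≤ (r ^ 2) ^ 2 := by gcongr
    have hl2 : 1 ≤ lam ^ 2 := one_le_pow₀ hl
    rw [div_le_div_iff₀ (by positivity) (by positivity)]
    have h3 : δ ^ 4 ≤ 4 * r ^ 4 := by nlinarith
    have h4 : 0 ≤ r ^ 4 := by positivity
    nlinarith

/-- The tilt is tanh |v| ≥ tanh² v = 1 - 1 / cosh² v, and `pow_four_le` makes cosh² v larger than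
1/η. -/
theorem lt_tiltAt {δ η : ℝ} (hδ : 0 < δ) (hη : 0 < η) (h : δ ^ 2 / 2 ≤ r ^ 2)
    (hA : sz (a, x) ≤ 1) (hs : sz (a, x) ≤ η ^ 2 * δ ^ 4) : 1 - η < tiltAt a x r := by
  have h0 : 0 < sz (a, x) := hq.1.1
  have hp := pow_four_le hq
  set v := vf ((a, x), yf ((a, x), r))
  have hc := Real.cosh_pos v
  have hcs := Real.cosh_sq v
  have h2 : (δ ^ 2 / 2) ^ 2 ≤ (r ^ 2) ^ 2 := by gcongr
  have h3 : sz (a, x) ^ 3 ≤ sz (a, x) := by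
    calc sz (a, x) ^ 3 = sz (a, x) * (sz (a, x) * sz (a, x)) := by ring
      _ ≤ sz (a, x) * (1 * 1) := by gcongr
      _ = sz (a, x) := by ring
  have hk : 16 * kap ^ 4 ≤ 1 / 8 := by norm_num [kap]
  have hc4 : 0 < Real.cosh v ^ 4 := by positivity
  have hd4 : 0 < δ ^ 4 := by positivity
  have h4 : δ ^ 4 / 4 ≤ 1 / 8 * (η ^ 2 * δ ^ 4) * Real.cosh v ^ 4 := by
    calc δ ^ 4 / 4 = (δ ^ 2 / 2) ^ 2 := by ring
      _ ≤ (r ^ 2) ^ 2 := h2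
      _ = r ^ 4 := by ring
      _ ≤ _ := hp
      _ ≤ _ := by gcongr; exact h3.trans hs
  have h5 : 1 < η ^ 2 * Real.cosh v ^ 4 := by
    have : δ ^ 4 * 2 ≤ δ ^ 4 * (η ^ 2 * Real.cosh v ^ 4) := by linarith
    have := le_of_mul_le_mul_left this hd4
    linarith
  have h6 : 1 < η * Real.cosh v ^ 2 := by
    refine lt_of_pow_lt_pow_left₀ 2 (by positivity) ?_
    calc (1 : ℝ) ^ 2 = 1 := one_pow 2
      _ < _ := h5
      _ = _ := by ring
  have h7 : |Real.sinh v| ≤ Real.cosh v := by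
    refine abs_le_of_sq_le_sq' ?_ hc.le |> abs_le.2
    linarith
  have h8 : (1 - η) * Real.cosh v ^ 2 < |Real.sinh v| * Real.cosh v := by
    have : |Real.sinh v| * |Real.sinh v| ≤ |Real.sinh v| * Real.cosh v := by gcongr
    rw [abs_mul_abs_self] at this
    nlinarith
  change 1 - η < |Real.sinh v| / Real.cosh v
  rw [lt_div_iff₀ hc]
  nlinarith

end Curvature

theorem curvAt_zero {a : ℝ} (h0 : 0 < a) (h1 : a < 1) : curvAt a 0 0 = 2 * lam ^ 2 / a ^ 4 := by
  have hsz : sz (a, 0) = a ^ 2 := by simp [sz]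
  have hm : ((a, 0), (0 : ℝ)) ∈ rDom := by
    refine ⟨⟨?_, ?_⟩, by simp⟩
    · change 0 < sz (a, 0); rw [hsz]; positivity
    · change sz (a, 0) < 4; rw [hsz]; nlinarith
  have hy : yf ((a, 0), 0) = 0 := by
    have := yf_neg hm
    rw [neg_zero] at this
    linarith
  have h0' : 0 < sz (a, 0) := hm.1.1
  rw [curvAt, hy, vf_zero, ki_zero, kr_zero h0', hsz]
  simp
  field_simp

/-! ### The two multi-valued graphs -/

section Graphs

variable {a : ℝ} {J : Set ℝ} {U : ℝ → ℝ} (hU : IsPhase a J U)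

theorem ang_hasDerivAt (hU : IsPhase a J U) {x r : ℝ} (hx : x ∈ J) (hr : |r| < 2) (h0 : r ≠ 0) :
    ∃ d, HasDerivAt (fun t => ang U a t r) d x ∧ 0 < d := by
  obtain ⟨d, hd, hpos⟩ := exists_hasDerivAt_psiR (mem_rDom hU hx hr) h0
  exact ⟨_, (hU.deriv x hx).add hd, by linarith⟩

theorem ang_strictMonoOn (hU : IsPhase a J U) {r : ℝ} (hr : |r| < 2) (h0 : r ≠ 0) :
    StrictMonoOn (fun x => ang U a x r) J := by
  refine strictMonoOn_of_deriv_pos hU.ordConnected.convex (fun x hx => ?_) fun x hx => ?_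
  · obtain ⟨d, hd, -⟩ := ang_hasDerivAt hU hx hr h0
    exact hd.continuousAt.continuousWithinAt
  · obtain ⟨d, hd, hpos⟩ := ang_hasDerivAt hU (interior_subset hx) hr h0
    rw [hd.deriv]
    exact hpos

theorem continuousOn_ang_section (hU : IsPhase a J U) {r : ℝ} (hr : |r| < 2) :
    ContinuousOn (fun x => ang U a x r) J :=
  (contDiffOn_ang hU).continuousOn.comp (f := fun x : ℝ => (x, r)) (by fun_prop)
    fun _ hx => ⟨hx, hr⟩

/-- The domain of the coordinates `(ρ, x)`. -/
def heightDom (J : Set ℝ) : Set (ℝ × ℝ) := {q | (0 < q.1 ∧ q.1 < 2) ∧ q.2 ∈ J}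

theorem isOpen_heightDom (hU : IsPhase a J U) : IsOpen (heightDom J) :=
  ((isOpen_lt continuous_const continuous_fst).inter
    (isOpen_lt continuous_fst continuous_const)).inter (hU.isOpen.preimage continuous_snd)

theorem contDiffOn_ang_swap (hU : IsPhase a J U) :
    ContDiffOn ℝ ∞ (fun q : ℝ × ℝ => ang U a q.2 q.1) (heightDom J) :=
  (contDiffOn_ang hU).comp (f := fun q : ℝ × ℝ => (q.2, q.1)) (ContDiff.contDiffOn (by fun_prop))
    fun q hq => ⟨hq.2, by rw [abs_of_pos hq.1.1]; exact hq.1.2⟩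

theorem ang_swap_strictMonoOn (hU : IsPhase a J U) (ρ : ℝ) :
    StrictMonoOn (fun x => ang U a x ρ) {x | (ρ, x) ∈ heightDom J} := by
  intro x hx y hy hxy
  exact ang_strictMonoOn hU (by rw [abs_of_pos hx.1.1]; exact hx.1.2) hx.1.1.ne' hx.2 hy.2 hxy

/-- The change of coordinates `(ρ, x) ↦ (ρ, θ)`. -/
def angHomeo : OpenPartialHomeomorph (ℝ × ℝ) (ℝ × ℝ) :=
  fiberHomeo (fun q : ℝ × ℝ => ang U a q.2 q.1) (heightDom J) (isOpen_heightDom hU)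
    (contDiffOn_ang_swap hU).continuousOn (ang_swap_strictMonoOn hU)

/-- The height of the surface as a function of the polar coordinates. -/
def height (q : ℝ × ℝ) : ℝ := ((angHomeo hU).symm q).2

theorem height_ang {x ρ : ℝ} (hx : x ∈ J) (h0 : 0 < ρ) (h2 : ρ < 2) :
    height hU (ρ, ang U a x ρ) = x :=
  fiberHomeo_symm_eq (isOpen_heightDom hU) (contDiffOn_ang_swap hU).continuousOn
    (ang_swap_strictMonoOn hU) (show (ρ, x) ∈ heightDom J from ⟨⟨h0, h2⟩, hx⟩)

theorem contDiffOn_height : ContDiffOn ℝ ∞ (height hU) (angHomeo hU).target := by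
  refine (contDiffOn_fiberHomeo_symm (isOpen_heightDom hU) (contDiffOn_ang_swap hU).continuousOn
    (ang_swap_strictMonoOn hU) (contDiffOn_ang_swap hU) fun q hq => ?_).snd
  obtain ⟨d, hd, hpos⟩ := ang_hasDerivAt hU hq.2 (r := q.1)
    (by rw [abs_of_pos hq.1.1]; exact hq.1.2) hq.1.1.ne'
  have h := HasFDerivAt.comp_hasDerivAt (f := fun t => (q.1, t)) q.2
    (((contDiffOn_ang_swap hU).contDiffAt
      ((isOpen_heightDom hU).mem_nhds hq)).differentiableAt (by simp)).hasFDerivAt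
    ((hasDerivAt_const q.2 q.1).prodMk (hasDerivAt_id q.2))
  rw [h.unique hd]
  exact hpos.ne'

/-- The angle between the two sheets. -/
def shift (j : Fin 2) : ℝ := ((j : ℕ) : ℝ) * Real.pi

/-- The sign of the distance to the axis on the two sheets. -/
def sgn (j : Fin 2) : ℝ := (-1) ^ (j : ℕ)

theorem cos_add_shift (t : ℝ) (j : Fin 2) : Real.cos (t + shift j) = sgn j * Real.cos t := by
  fin_cases j <;> simp [shift, sgn]

theorem sin_add_shift (t : ℝ) (j : Fin 2) : Real.sin (t + shift j) = sgn j * Real.sin t := by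
  fin_cases j <;> simp [shift, sgn]

theorem abs_sgn_mul (j : Fin 2) (r : ℝ) : |sgn j * r| = |r| := by
  fin_cases j <;> simp [sgn]

/-- The parameter domains of the two graphs. -/
def graphDom (U : ℝ → ℝ) (a : ℝ) (J : Set ℝ) (j : Fin 2) : Set (ℝ × ℝ) :=
  {q | ∃ x ∈ J, 0 < q.1 ∧ x ^ 2 + q.1 ^ 2 ≤ 1 ∧ q.2 = ang U a x q.1 + shift j}

/-- The two graph functions. -/
def graphFun (j : Fin 2) (q : ℝ × ℝ) : ℝ := height hU (q.1, q.2 - shift j)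

theorem lt_two_of_sq {x ρ : ℝ} (h : x ^ 2 + ρ ^ 2 ≤ 1) : |ρ| < 2 :=
  abs_lt_of_sq_lt_sq (by nlinarith [sq_nonneg x]) (by norm_num)

theorem graphFun_ang {x ρ : ℝ} (j : Fin 2) (hx : x ∈ J) (h0 : 0 < ρ) (h1 : x ^ 2 + ρ ^ 2 ≤ 1) :
    graphFun hU j (ρ, ang U a x ρ + shift j) = x := by
  rw [graphFun, add_sub_cancel_right]
  exact height_ang hU hx h0 (lt_of_abs_lt (lt_two_of_sq h1))

theorem graphPt_graphFun {x ρ : ℝ} (j : Fin 2) (hx : x ∈ J) (h0 : 0 < ρ)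
    (h1 : x ^ 2 + ρ ^ 2 ≤ 1) :
    graphPt (graphFun hU j) (ρ, ang U a x ρ + shift j) = surf U a !₂[x, sgn j * ρ] := by
  have hang : ang U a x (sgn j * ρ) = ang U a x ρ := by
    rw [← ang_abs hU hx (by rw [abs_sgn_mul]; exact lt_two_of_sq h1), abs_sgn_mul, abs_of_pos h0]
  rw [graphPt, graphFun_ang hU j hx h0 h1]
  refine space_ext ?_ ?_ ?_
  · simp [surf, spiralPt, hang, cos_add_shift]; ring
  · simp [surf, spiralPt, hang, sin_add_shift]; ring
  · simp [surf, spiralPt]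

theorem norm_mk_le {x r : ℝ} (h : x ^ 2 + r ^ 2 ≤ 1) : ‖(!₂[x, r] : Plane)‖ ≤ 1 := by
  rw [← sq_le_one_iff₀ (norm_nonneg _), norm_plane_sq]
  simpa using h

theorem sgn_sq (j : Fin 2) : sgn j ^ 2 = 1 := by fin_cases j <;> simp [sgn]

/-- The sheets are the halves r > 0 and r < 0 of the surface; adding π to the angle allows both to
be described with positive ρ. -/
theorem image_graphPt (j : Fin 2) : graphPt (graphFun hU j) '' graphDom U a J j =
    surf U a '' {q | (q 0 ∈ J ∧ ‖q‖ ≤ 1) ∧ 0 < sgn j * q 1} := by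
  ext p
  constructor
  · rintro ⟨⟨ρ, θ⟩, ⟨x, hx, h0, h1, h⟩, rfl⟩
    change θ = ang U a x ρ + shift j at h
    subst h
    refine ⟨!₂[x, sgn j * ρ], ⟨⟨by simpa using hx, norm_mk_le ?_⟩, ?_⟩,
      (graphPt_graphFun hU j hx h0 h1).symm⟩
    · rw [mul_pow, sgn_sq, one_mul]; exact h1
    · simp only [Matrix.cons_val_one, Matrix.cons_val_fin_one]
      rw [← mul_assoc, ← sq, sgn_sq, one_mul]
      exact h0
  · rintro ⟨q, ⟨⟨hJ, h1⟩, h0⟩, rfl⟩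
    have hn := norm_plane_sq q
    have hsq : q 0 ^ 2 + (sgn j * q 1) ^ 2 ≤ 1 := by
      rw [mul_pow, sgn_sq, one_mul, ← hn]; exact pow_le_one₀ (norm_nonneg _) h1
    refine ⟨(sgn j * q 1, ang U a (q 0) (sgn j * q 1) + shift j), ⟨q 0, hJ, h0, hsq, rfl⟩, ?_⟩
    rw [graphPt_graphFun hU j hJ h0 hsq]
    congr 1
    refine plane_ext (by simp) ?_
    simp only [Matrix.cons_val_one, Matrix.cons_val_fin_one]
    rw [← mul_assoc, ← sq, sgn_sq, one_mul]

theorem ordConnected_slice (hJ : J.OrdConnected) (ρ : ℝ) :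
    OrdConnected {x | x ∈ J ∧ 0 < ρ ∧ x ^ 2 + ρ ^ 2 ≤ 1} := by
  refine ⟨fun x hx y hy z hz => ⟨hJ.out hx.1 hy.1 hz, hx.2.1, ?_⟩⟩
  rcases le_total 0 z with h | h
  · nlinarith [hy.2.2, hz.2]
  · nlinarith [hx.2.2, hz.1]

theorem isMultivaluedGraph_graphFun (hne : ∃ x ∈ J, |x| < 1) (j : Fin 2) :
    IsMultivaluedGraph (graphDom U a J j) (graphFun hU j) where
  pos := by
    rintro q ⟨x, -, h0, -⟩
    exact h0
  connected := by
    have himg : graphDom U a J j = (fun q : ℝ × ℝ => (q.2, ang U a q.1 q.2 + shift j)) ''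
        {q | q.1 ∈ J ∧ 0 < q.2 ∧ q.1 ^ 2 + q.2 ^ 2 ≤ 1} := by
      ext ⟨ρ, θ⟩
      constructor
      · rintro ⟨x, hx, h0, h1, h⟩
        exact ⟨(x, ρ), ⟨hx, h0, h1⟩, Prod.ext rfl h.symm⟩
      · rintro ⟨⟨x, ρ'⟩, ⟨hx, h0, h1⟩, h⟩
        obtain ⟨rfl, rfl⟩ := Prod.mk.inj h
        exact ⟨x, hx, h0, h1, rfl⟩
    have hconv : Convex ℝ {q : ℝ × ℝ | q.1 ∈ J ∧ 0 < q.2 ∧ q.1 ^ 2 + q.2 ^ 2 ≤ 1} := by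
      rintro ⟨x, ρ⟩ ⟨hx, h0, h1⟩ ⟨y, τ⟩ ⟨hy, h0', h1'⟩ s t hs ht hst
      refine ⟨hU.ordConnected.convex hx hy hs ht hst, ?_, ?_⟩
      · exact (convex_Ioi (0 : ℝ)) h0 h0' hs ht hst
      · simp only [Prod.smul_mk, Prod.mk_add_mk, smul_eq_mul] at h1 h1' ⊢
        obtain rfl : s = 1 - t := by linarith
        nlinarith [mul_nonneg (mul_nonneg hs ht) (sq_nonneg (x - y)),
          mul_nonneg (mul_nonneg hs ht) (sq_nonneg (ρ - τ)),
          mul_le_mul_of_nonneg_left h1 hs, mul_le_mul_of_nonneg_left h1' ht]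
    rw [himg]
    refine IsConnected.image ⟨?_, hconv.isPreconnected⟩ _ ?_
    · obtain ⟨x, hx, h1⟩ := hne
      have hx2 : x ^ 2 < 1 := by rw [← sq_abs]; exact pow_lt_one₀ (abs_nonneg _) h1 two_ne_zero
      refine ⟨(x, √(1 - x ^ 2)), hx, Real.sqrt_pos.2 (by linarith), ?_⟩
      change x ^ 2 + √(1 - x ^ 2) ^ 2 ≤ 1
      rw [Real.sq_sqrt (by linarith)]
      linarith
    · exact continuousOn_snd.prodMk (((contDiffOn_ang hU).continuousOn.mono
        fun q hq => ⟨hq.1, lt_two_of_sq hq.2.2⟩).add continuousOn_const)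
  interval ρ := by
    have himg : {θ | (ρ, θ) ∈ graphDom U a J j} = (fun x => ang U a x ρ + shift j) ''
        {x | x ∈ J ∧ 0 < ρ ∧ x ^ 2 + ρ ^ 2 ≤ 1} := by
      ext θ
      constructor
      · rintro ⟨x, hx, h0, h1, h⟩
        exact ⟨x, ⟨hx, h0, h1⟩, h.symm⟩
      · rintro ⟨x, ⟨hx, h0, h1⟩, h⟩
        exact ⟨x, hx, h0, h1, h.symm⟩
    rw [himg]
    refine (IsPreconnected.image (ordConnected_slice hU.ordConnected ρ).isPreconnected _
      (fun x hx => ?_)).ordConnected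
    exact ((continuousOn_ang_section hU (lt_two_of_sq hx.2.2)).add continuousOn_const x hx.1).mono
      fun y hy => hy.1
  smooth := by
    have hc : Continuous fun q : ℝ × ℝ => (q.1, q.2 - shift j) := by fun_prop
    refine ⟨(fun q : ℝ × ℝ => (q.1, q.2 - shift j)) ⁻¹' (angHomeo hU).target,
      (angHomeo hU).open_target.preimage hc, ?_, ?_⟩
    · rintro ⟨ρ, θ⟩ ⟨x, hx, h0, h1, h⟩
      simp only at h
      refine (mem_fiberHomeo_target (isOpen_heightDom hU) (contDiffOn_ang_swap hU).continuousOn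
        (ang_swap_strictMonoOn hU)).2 ⟨x, ⟨⟨h0, lt_of_abs_lt (lt_two_of_sq h1)⟩, hx⟩, ?_⟩
      simp only [h, add_sub_cancel_right]
    · exact (contDiffOn_height hU).comp (ContDiff.contDiffOn (by fun_prop)) fun q hq => hq
  embedded := by
    rintro ⟨ρ, θ⟩ ⟨x, hx, h0, h1, e⟩ ⟨ρ', θ'⟩ ⟨x', hx', h0', h1', e'⟩ h
    change θ = ang U a x ρ + shift j at e
    change θ' = ang U a x' ρ' + shift j at e'
    subst e e'
    simp only at h0 h1 h0' h1'
    rw [graphPt_graphFun hU j hx h0 h1, graphPt_graphFun hU j hx' h0' h1'] at h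
    have hd : ∀ {x ρ : ℝ}, x ∈ J → x ^ 2 + ρ ^ 2 ≤ 1 → !₂[x, sgn j * ρ] ∈ surfDom J :=
      fun hx h1 => ⟨hx, (abs_sgn_mul j _).trans_lt (lt_two_of_sq h1)⟩
    have h2 := surf_injOn hU (hd hx h1) (hd hx' h1') h
    have e0 := congrArg (fun q : Plane => q 0) h2
    have e1 := congrArg (fun q : Plane => |q 1|) h2
    change x = x' at e0
    change |sgn j * ρ| = |sgn j * ρ'| at e1
    rw [abs_sgn_mul, abs_sgn_mul, abs_of_pos h0, abs_of_pos h0'] at e1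
    rw [e0, e1]

theorem isTwoMultivaluedGraphs_spiralDisk (hne : ∃ x ∈ J, |x| < 1) {dom : Set Plane}
    {κ χ : Plane → Plane} (hκ : IsDiskParam J dom κ χ) :
    IsTwoMultivaluedGraphs (spiralDisk hU hκ).carrier (graphDom U a J) (graphFun hU) := by
  refine ⟨isMultivaluedGraph_graphFun hU hne, ?_, ?_⟩
  · rw [image_graphPt, image_graphPt, spiralDisk_carrier]
    have hax : ∀ q : Plane, surf U a q ∈ axis ↔ q 1 = 0 := fun q => by
      rw [← abs_eq_zero, ← axr_surf U a q, axr, Real.sqrt_eq_zero (by positivity)]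
      constructor
      · rintro ⟨h0, h1⟩
        rw [h0, h1]; ring
      · intro h
        constructor <;> nlinarith [sq_nonneg ((surf U a q) 0), sq_nonneg ((surf U a q) 1)]
    ext p
    constructor
    · rintro ⟨⟨q, hq, rfl⟩, hp⟩
      rw [hax] at hp
      rcases lt_or_gt_of_ne hp with h | h
      · exact Or.inr ⟨q, ⟨hq, by simpa [sgn] using h⟩, rfl⟩
      · exact Or.inl ⟨q, ⟨hq, by simpa [sgn] using h⟩, rfl⟩
    · rintro (⟨q, ⟨hq, h⟩, rfl⟩ | ⟨q, ⟨hq, h⟩, rfl⟩)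
      · exact ⟨⟨q, hq, rfl⟩, fun hp => by rw [(hax q).1 hp] at h; simp at h⟩
      · exact ⟨⟨q, hq, rfl⟩, fun hp => by rw [(hax q).1 hp] at h; simp at h⟩
  · rw [image_graphPt, image_graphPt, Set.disjoint_left]
    rintro _ ⟨q, ⟨hq, h⟩, rfl⟩ ⟨z, ⟨hz, hz'⟩, hqz⟩
    obtain rfl := surf_injOn hU (mem_surfDom_of_norm_le hz.1 hz.2)
      (mem_surfDom_of_norm_le hq.1 hq.2) hqz
    simp [sgn] at h hz'
    linarith

/-- The intermediate value theorem at fixed ρ: the turns of a sheet are counted from its angles at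
just two heights. -/
theorem mem_graphDom_of_between {ρ θ x y : ℝ} {j : Fin 2} (h0 : 0 < ρ) (hx : x ∈ J) (hy : y ∈ J)
    (hxy : x ≤ y) (hx1 : x ^ 2 + ρ ^ 2 ≤ 1) (hy1 : y ^ 2 + ρ ^ 2 ≤ 1)
    (hθx : ang U a x ρ ≤ θ - shift j) (hθy : θ - shift j ≤ ang U a y ρ) (hU : IsPhase a J U) :
    (ρ, θ) ∈ graphDom U a J j := by
  have hsub : Icc x y ⊆ {x | x ∈ J ∧ 0 < ρ ∧ x ^ 2 + ρ ^ 2 ≤ 1} :=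
    (ordConnected_slice hU.ordConnected ρ).out ⟨hx, h0, hx1⟩ ⟨hy, h0, hy1⟩
  obtain ⟨z, hz, h⟩ := intermediate_value_Icc hxy
    ((continuousOn_ang_section hU (lt_two_of_sq hx1)).mono fun z hz => (hsub hz).1) ⟨hθx, hθy⟩
  refine ⟨z, (hsub hz).1, h0, (hsub hz).2.2, ?_⟩
  simp only at h ⊢
  linarith

end Graphs

/-! ### The phases -/

/-- The phase of the compact disks. -/
def phaseS (a : ℝ) (x : ℝ) : ℝ := lam / a * Real.arctan (x / a)

/-- The phase of the limit. -/
def phaseT (x : ℝ) : ℝ := -(lam / x)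

/-- The heights of the compact disks. -/
def heightsS : Set ℝ := Ioo (-(3 / 2)) (3 / 2)

/-- The heights of the limit disks. -/
def heightsT (ε : ℝ) : Set ℝ := {x | 0 < ε * x ∧ ε * x < 3 / 2}

theorem isPhase_phaseS {a : ℝ} (h0 : 0 < a) (h1 : a < 1) : IsPhase a heightsS (phaseS a) where
  isOpen := isOpen_Ioo
  ordConnected := ordConnected_Ioo
  sz_mem x hx := by
    have := hx.1
    have := hx.2
    unfold sz
    exact ⟨by positivity, by nlinarith⟩
  smooth := by
    unfold phaseS
    exact (contDiff_const.mul (Real.contDiff_arctan.comp (contDiff_id.div_const a))).contDiffOn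
  deriv x _ := by
    unfold phaseS sz
    refine (((hasDerivAt_id x).div_const a).arctan.const_mul (lam / a)).congr_deriv ?_
    have : x ^ 2 + a ^ 2 ≠ 0 := by positivity
    simp only [id]
    field_simp
    ring

theorem isPhase_phaseT {ε : ℝ} (hε : ε ^ 2 = 1) : IsPhase 0 (heightsT ε) phaseT where
  isOpen := (isOpen_lt continuous_const (continuous_const.mul continuous_id)).inter
    (isOpen_lt (continuous_const.mul continuous_id) continuous_const)
  ordConnected := by
    have h : Convex ℝ (heightsT ε) := fun x hx y hy s t hs ht hst => by
      have e : ε * (s • x + t • y) = s • (ε * x) + t • (ε * y) := by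
        simp only [smul_eq_mul]; ring
      change 0 < ε * (s • x + t • y) ∧ ε * (s • x + t • y) < 3 / 2
      rw [e]
      exact convex_Ioo (0 : ℝ) (3 / 2) hx hy hs ht hst
    exact h.ordConnected
  sz_mem x hx := by
    have h1 := hx.1
    have h2 := hx.2
    have h3 : x ^ 2 = (ε * x) ^ 2 := by rw [mul_pow, hε, one_mul]
    unfold sz
    simp only [h3]
    exact ⟨by positivity, by nlinarith⟩
  smooth := by
    unfold phaseT
    refine (contDiffOn_const.div contDiffOn_id fun x hx => ?_).neg
    rintro rfl
    simpa using hx.1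
  deriv x hx := by
    have h0 : x ≠ 0 := by
      rintro rfl
      simpa using hx.1
    unfold phaseT sz
    simp only [div_eq_mul_inv]
    refine ((hasDerivAt_inv h0).const_mul lam).fun_neg.congr_deriv ?_
    field_simp
    ring

/-! ### The changes of parameters -/

theorem isDiskParam_id : IsDiskParam heightsS (Metric.closedBall 0 1) id id := by
  have hsub : ∀ q : Plane, ‖q‖ ≤ 1 → q 0 ∈ heightsS := fun q hq => by
    have h1 := norm_plane_sq q
    have h2 : ‖q‖ ^ 2 ≤ 1 := pow_le_one₀ (norm_nonneg _) hq
    have := abs_le_one_iff_mul_self_le_one.2 (by nlinarith [sq_nonneg (q 1)] : q 0 * q 0 ≤ 1)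
    rw [abs_le] at this
    exact ⟨by linarith, by linarith⟩
  -- The value 1/2 is arbitrary; the phase serves only to provide openness of the domain.
  refine ⟨⟨surfDom heightsS, univ, isOpen_surfDom (isPhase_phaseS (a := 1 / 2) (by norm_num)
    (by norm_num)), isOpen_univ, fun q hq => ?_, contDiffOn_id, contDiffOn_id,
    fun q hq => ⟨hq, trivial⟩, fun q _ => rfl⟩, Metric.ball_subset_closedBall,
    ⟨univ, isOpen_univ, by simp⟩, ?_, fun q _ h => h⟩
  · rw [mem_closedBall_zero_iff] at hq
    exact mem_surfDom_of_norm_le (hsub q hq) hq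
  · ext q
    simp only [id_eq, image_id', mem_closedBall_zero_iff, mem_ofPred_eq]
    exact ⟨fun h => ⟨hsub q h, h⟩, fun h => h.2⟩

/-- Half the length of the chord of the unit disk through `q`. -/
def chord (q : Plane) : ℝ := √(1 - q 1 ^ 2)

/-- The map from the disk to the half disk. -/
def toHalf (ε : ℝ) (q : Plane) : Plane := !₂[ε * ((q 0 + chord q) / 2), q 1]

/-- The map from the half disk to the disk. -/
def ofHalf (ε : ℝ) (q : Plane) : Plane := !₂[2 * (ε * q 0) - chord q, q 1]

/-- The closed disk without the closed left half of the circle. -/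
def halfDom : Set Plane := {q | |q 1| < 1 ∧ 0 < q 0 + chord q} ∩ Metric.closedBall 0 1

theorem chord_nonneg (q : Plane) : 0 ≤ chord q := Real.sqrt_nonneg _

theorem chord_sq {q : Plane} (h : |q 1| ≤ 1) : chord q ^ 2 = 1 - q 1 ^ 2 :=
  Real.sq_sqrt (by have := (sq_le_one_iff_abs_le_one (q 1)).2 h; linarith)

theorem continuous_chord : Continuous chord := by
  unfold chord
  fun_prop

theorem contDiffOn_chord : ContDiffOn ℝ ∞ chord {q : Plane | |q 1| < 1} := by
  refine (contDiffOn_const.sub (contDiff_proj_one.pow 2).contDiffOn).sqrt fun q hq => ?_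
  have := (sq_lt_one_iff_abs_lt_one (q 1)).2 hq
  linarith

theorem contDiffOn_plane {s : Set Plane} {f : Plane → Plane}
    (h0 : ContDiffOn ℝ ∞ (fun q => f q 0) s) (h1 : ContDiffOn ℝ ∞ (fun q => f q 1) s) :
    ContDiffOn ℝ ∞ f s := by
  rw [contDiffOn_euclidean]
  intro i
  fin_cases i
  exacts [h0, h1]

theorem contDiffOn_toHalf (ε : ℝ) : ContDiffOn ℝ ∞ (toHalf ε) {q : Plane | |q 1| < 1} :=
  contDiffOn_plane (contDiffOn_const.mul
    ((contDiff_proj_zero.contDiffOn.add contDiffOn_chord).div_const 2))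
    contDiff_proj_one.contDiffOn

theorem contDiffOn_ofHalf (ε : ℝ) : ContDiffOn ℝ ∞ (ofHalf ε) {q : Plane | |q 1| < 1} :=
  contDiffOn_plane ((contDiffOn_const.mul (contDiffOn_const.mul
    contDiff_proj_zero.contDiffOn)).sub contDiffOn_chord) contDiff_proj_one.contDiffOn

section Half

variable {ε : ℝ} (hε : ε ^ 2 = 1)
include hε

theorem ofHalf_toHalf (q : Plane) : ofHalf ε (toHalf ε q) = q := by
  refine plane_ext ?_ rfl
  change 2 * (ε * (ε * ((q 0 + chord q) / 2))) - chord q = q 0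
  linear_combination (q 0 + chord q) * hε

theorem toHalf_ofHalf (q : Plane) : toHalf ε (ofHalf ε q) = q := by
  refine plane_ext ?_ rfl
  change ε * ((2 * (ε * q 0) - chord q + chord q) / 2) = q 0
  linear_combination q 0 * hε

theorem mul_toHalf_zero (q : Plane) : ε * toHalf ε q 0 = (q 0 + chord q) / 2 := by
  change ε * (ε * ((q 0 + chord q) / 2)) = _
  linear_combination (q 0 + chord q) / 2 * hε

theorem toHalf_sq (q : Plane) : toHalf ε q 0 ^ 2 = ((q 0 + chord q) / 2) ^ 2 := by
  rw [← mul_toHalf_zero hε, mul_pow, hε, one_mul]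

theorem toHalf_mem {q : Plane} (hq : q ∈ halfDom) :
    toHalf ε q 0 ∈ heightsT ε ∧ ‖toHalf ε q‖ ≤ 1 := by
  obtain ⟨⟨h1, h2⟩, h3⟩ := hq
  rw [mem_closedBall_zero_iff, ← sq_le_one_iff₀ (norm_nonneg _), norm_plane_sq] at h3
  have hc := chord_sq h1.le
  have hc0 := chord_nonneg q
  have hqc : q 0 ≤ chord q := abs_le_of_sq_le_sq' (by linarith) hc0 |>.2
  have hc1 : chord q ≤ 1 := (sq_le_one_iff₀ hc0).1 (by nlinarith [sq_nonneg (q 1)])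
  refine ⟨⟨?_, ?_⟩, ?_⟩
  · rw [mul_toHalf_zero hε]; linarith
  · rw [mul_toHalf_zero hε]; linarith
  · rw [← sq_le_one_iff₀ (norm_nonneg _), norm_plane_sq, toHalf_sq hε]
    change ((q 0 + chord q) / 2) ^ 2 + q 1 ^ 2 ≤ 1
    nlinarith

theorem ofHalf_mem {q : Plane} (h0 : 0 < ε * q 0) (h1 : ‖q‖ ≤ 1) : ofHalf ε q ∈ halfDom := by
  rw [← sq_le_one_iff₀ (norm_nonneg _), norm_plane_sq] at h1
  have hq0 : q 0 ^ 2 = (ε * q 0) ^ 2 := by rw [mul_pow, hε, one_mul]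
  have hlt : |q 1| < 1 := (sq_lt_one_iff_abs_lt_one (q 1)).1 (by nlinarith)
  have hc := chord_sq hlt.le
  have hc0 := chord_nonneg q
  have hqc : ε * q 0 ≤ chord q := abs_le_of_sq_le_sq' (by linarith) hc0 |>.2
  refine ⟨⟨hlt, ?_⟩, ?_⟩
  · change 0 < 2 * (ε * q 0) - chord q + chord q
    linarith
  · rw [mem_closedBall_zero_iff, ← sq_le_one_iff₀ (norm_nonneg _), norm_plane_sq]
    change (2 * (ε * q 0) - chord q) ^ 2 + q 1 ^ 2 ≤ 1
    nlinarith

/-- For fixed q 1, with c half the chord length, the part (-c, c] of the chord is mapped affinely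
onto (0, c], reflected if ε = -1. The arc that would land on the diameter x = 0 is left out of the
domain, because the limit disk has no boundary there. -/
theorem isDiskParam_half : IsDiskParam (heightsT ε) halfDom (toHalf ε) (ofHalf ε) := by
  have hopen1 : IsOpen {q : Plane | |q 1| < 1} :=
    isOpen_lt contDiff_proj_one.continuous.abs continuous_const
  have hc : Continuous fun q : Plane => q 0 + chord q :=
    contDiff_proj_zero.continuous.add continuous_chord
  refine ⟨⟨{q | |q 1| < 1} ∩ {q | 0 < q 0 + chord q ∧ q 0 + chord q < 3}, {q | |q 1| < 1},
    hopen1.inter ((isOpen_lt continuous_const hc).inter (isOpen_lt hc continuous_const)), hopen1,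
    fun q hq => ?_, (contDiffOn_toHalf ε).mono inter_subset_left, contDiffOn_ofHalf ε, ?_,
    fun q _ => ofHalf_toHalf hε q⟩, ?_, ⟨{q | |q 1| < 1 ∧ 0 < q 0 + chord q},
    hopen1.inter (isOpen_lt continuous_const hc), rfl⟩, ?_, ?_⟩
  · have h := (toHalf_mem hε hq).1.2
    rw [mul_toHalf_zero hε] at h
    exact ⟨hq.1.1, hq.1.2, by linarith⟩
  · rintro q ⟨h1, h2, h3⟩
    refine ⟨⟨⟨?_, ?_⟩, lt_trans (show |toHalf ε q 1| < 1 from h1) (by norm_num)⟩, h1⟩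
    · rw [mul_toHalf_zero hε]; linarith
    · rw [mul_toHalf_zero hε]; linarith
  · intro q hq
    rw [mem_ball_zero_iff] at hq
    have h1 : ‖q‖ ^ 2 < 1 := pow_lt_one₀ (norm_nonneg _) hq two_ne_zero
    rw [norm_plane_sq] at h1
    have hlt : |q 1| < 1 := (sq_lt_one_iff_abs_lt_one (q 1)).1 (by nlinarith [sq_nonneg (q 0)])
    have hcs := chord_sq hlt.le
    have := abs_lt_of_sq_lt_sq' (by linarith : q 0 ^ 2 < chord q ^ 2) (chord_nonneg q)
    exact ⟨⟨hlt, by linarith [this.1]⟩, mem_closedBall_zero_iff.2 hq.le⟩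
  · ext q
    constructor
    · rintro ⟨z, hz, rfl⟩
      exact toHalf_mem hε hz
    · rintro ⟨h0, h1⟩
      exact ⟨ofHalf ε q, ofHalf_mem hε h0.1 h1, toHalf_ofHalf hε q⟩
  · rintro q ⟨⟨h1, h2⟩, -⟩ hn
    have hn2 := norm_plane_sq q
    rw [hn] at hn2
    have hcs := chord_sq h1.le
    have hfac : (q 0 - chord q) * (q 0 + chord q) = 0 := by linarith
    have hq0 : q 0 = chord q := by
      rcases mul_eq_zero.1 hfac with h | h <;> linarith
    have : ‖toHalf ε q‖ ^ 2 = 1 := by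
      rw [norm_plane_sq, toHalf_sq hε, ← hq0]
      change ((q 0 + q 0) / 2) ^ 2 + q 1 ^ 2 = 1
      linarith
    exact (pow_eq_one_iff_of_nonneg (norm_nonneg _) two_ne_zero).1 this

end Half

/-! ### The sequence of compact disks -/

/-- The parameters of the compact disks. -/
def seqA (i : ℕ) : ℝ := lam / (4 * (i + lam))

theorem seqA_pos (i : ℕ) : 0 < seqA i := by
  have := lam_pos
  unfold seqA
  positivity

theorem seqA_lt_one (i : ℕ) : seqA i < 1 := by
  have := lam_pos
  rw [seqA, div_lt_one (by positivity)]
  have : (0 : ℝ) ≤ i := Nat.cast_nonneg i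
  linarith

/-- The reason for the choice of `seqA`: the limiting value (lam/a) · π/2 of the phase becomes 2π(i
+ lam), a multiple of 2π since lam is an integer. -/
theorem lam_div_seqA (i : ℕ) : lam / seqA i = 4 * (i + lam) := by
  have := lam_pos
  have : (i : ℝ) + lam ≠ 0 := by positivity
  rw [seqA]
  field_simp

theorem tendsto_seqA : Tendsto seqA atTop (𝓝 0) :=
  tendsto_const_nhds.div_atTop (Tendsto.const_mul_atTop (by norm_num)
    (tendsto_atTop_add_const_right _ _ tendsto_natCast_atTop_atTop))

theorem isPhase_seqA (i : ℕ) : IsPhase (seqA i) heightsS (phaseS (seqA i)) :=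
  isPhase_phaseS (seqA_pos i) (seqA_lt_one i)

/-- The compact disks. -/
def diskS (i : ℕ) : EmbeddedMinimalDisk := spiralDisk (isPhase_seqA i) isDiskParam_id

theorem mem_heightsS_of_abs_le {x : ℝ} (h : |x| ≤ 1) : x ∈ heightsS := by
  rw [abs_le] at h
  exact ⟨by linarith, by linarith⟩

theorem abs_apply_zero_le {q : Plane} (h : ‖q‖ ≤ 1) : |q 0| ≤ 1 := by
  have h1 := norm_plane_sq q
  exact (sq_le_one_iff_abs_le_one _).1
    (by nlinarith [sq_nonneg (q 1), norm_nonneg q])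

theorem isCompact_diskS (i : ℕ) : IsCompact (diskS i).carrier := by
  obtain ⟨V, -, hV, hf⟩ := (diskS i).embedded.smooth
  exact (isCompact_closedBall 0 1).image_of_continuousOn (hf.continuousOn.mono hV)

theorem diskS_carrier (i : ℕ) : (diskS i).carrier =
    surf (phaseS (seqA i)) (seqA i) '' {q | q 0 ∈ heightsS ∧ ‖q‖ ≤ 1} := spiralDisk_carrier _ _

theorem axis_mem_diskS (i : ℕ) {t : ℝ} (ht : |t| < 1) : !₂[0, 0, t] ∈ (diskS i).carrier :=
  axis_mem_spiralDisk _ _ (mem_heightsS_of_abs_le ht.le) ht.le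

theorem curvSq_diskS_zero (i : ℕ) : (diskS i).curvSq 0 = 2 * lam ^ 2 / seqA i ^ 4 := by
  have h0 : surf (phaseS (seqA i)) (seqA i) 0 = 0 := by
    rw [← norm_eq_zero, norm_surf, norm_zero]
  have h := spiralDisk_curvSq (isPhase_seqA i) isDiskParam_id (q := 0)
    (mem_heightsS_of_abs_le (by simp)) (by simp)
  rw [h0] at h
  exact h.trans (curvAt_zero (seqA_pos i) (seqA_lt_one i))

theorem tendsto_curvSq_diskS_zero : Tendsto (fun i => (diskS i).curvSq 0) atTop atTop := by
  simp only [curvSq_diskS_zero]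
  have h : Tendsto (fun i => seqA i ^ 4) atTop (𝓝[>] 0) := by
    refine tendsto_nhdsWithin_iff.2 ⟨?_, Eventually.of_forall fun i => pow_pos (seqA_pos i) 4⟩
    simpa using tendsto_seqA.pow 4
  have hl := lam_pos
  simpa only [div_eq_mul_inv, Function.comp_apply] using
    (tendsto_inv_nhdsGT_zero.comp h).const_mul_atTop (by positivity : 0 < 2 * lam ^ 2)

theorem sq_le_of_notMem_ball {U : ℝ → ℝ} {a δ : ℝ} {q : Plane} (hδ : 0 < δ)
    (h : surf U a q ∉ Metric.ball 0 δ) : δ ^ 2 ≤ q 0 ^ 2 + q 1 ^ 2 := by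
  rw [mem_ball_zero_iff, norm_surf, not_lt] at h
  rw [← norm_plane_sq]
  gcongr

theorem curvSq_diskS_le {δ : ℝ} (hδ : 0 < δ) (i : ℕ) {p : Space}
    (hp : p ∈ (diskS i).carrier \ Metric.ball 0 δ) :
    (diskS i).curvSq p ≤ 16 * lam ^ 2 / δ ^ 4 := by
  obtain ⟨hp, hb⟩ := hp
  rw [diskS_carrier] at hp
  obtain ⟨q, ⟨hJ, h1⟩, rfl⟩ := hp
  refine (spiralDisk_curvSq (isPhase_seqA i) isDiskParam_id hJ h1).trans_le ?_
  exact curvAt_le (mem_rDom (isPhase_seqA i) hJ (mem_surfDom_of_norm_le hJ h1).2) hδ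
    (sq_le_of_notMem_ball hδ hb)

theorem eventually_lt_normal_diskS {δ η : ℝ} (hδ : 0 < δ) (hη : 0 < η) : ∃ h > 0,
    ∀ᶠ i in atTop, ∀ p ∈ (diskS i).carrier \ Metric.ball 0 δ,
      |p 2| < h → 1 - η < |(diskS i).normal p 2| := by
  -- The bounds are imposed on |x₃| and on a. The first leaves r² ≥ δ²/2, the second gives sz ≤ 1,
  -- the third sz ≤ η² δ⁴, as `lt_tiltAt` requires.
  have hpos : 0 < min (min (δ / 2) (1 / 2)) (η * δ ^ 2 / 2) := by positivity
  refine ⟨_, hpos, ?_⟩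
  filter_upwards [tendsto_seqA.eventually_lt_const hpos] with i hi
  rintro p ⟨hp, hb⟩ hh
  rw [diskS_carrier] at hp
  obtain ⟨q, ⟨hJ, h1⟩, rfl⟩ := hp
  have h2 : (surf (phaseS (seqA i)) (seqA i) q) 2 = q 0 := by simp [surf, spiralPt]
  rw [h2] at hh
  simp only [lt_min_iff] at hi hh
  obtain ⟨⟨hx1, hx2⟩, hx3⟩ := hh
  have ha := seqA_pos i
  have hx := abs_nonneg (q 0)
  have hs := sq_le_of_notMem_ball hδ hb
  have hsz : sz (seqA i, q 0) = |q 0| ^ 2 + seqA i ^ 2 := by rw [sq_abs]; rfl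
  rw [show (diskS i).normal = (spiralDisk (isPhase_seqA i) isDiskParam_id).normal from rfl,
    spiralDisk_normal (isPhase_seqA i) isDiskParam_id hJ h1]
  refine lt_tiltAt (mem_rDom (isPhase_seqA i) hJ (mem_surfDom_of_norm_le hJ h1).2) hδ hη ?_ ?_ ?_
  · have : |q 0| ^ 2 ≤ (δ / 2) ^ 2 := by gcongr
    rw [sq_abs] at this
    nlinarith
  · rw [hsz]
    nlinarith [hi.1.2]
  · have e1 : |q 0| ^ 2 ≤ (η * δ ^ 2 / 2) ^ 2 := by gcongr
    have e2 : seqA i ^ 2 ≤ (η * δ ^ 2 / 2) ^ 2 := by gcongr; exact hi.2.le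
    rw [hsz]
    nlinarith [sq_nonneg (η * δ ^ 2)]

theorem isTwoMultivaluedGraphs_diskS (i : ℕ) : IsTwoMultivaluedGraphs (diskS i).carrier
    (graphDom (phaseS (seqA i)) (seqA i) heightsS) (graphFun (isPhase_seqA i)) :=
  isTwoMultivaluedGraphs_spiralDisk _ ⟨0, mem_heightsS_of_abs_le (by simp), by simp⟩ _

theorem abs_ang_sub_lt (U : ℝ → ℝ) (a x r : ℝ) : |ang U a x r - U x| < Real.pi / 2 := by
  rw [ang, add_sub_cancel_left]
  exact abs_psiR_lt _

theorem phaseS_neg (a x : ℝ) : phaseS a (-x) = -phaseS a x := by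
  rw [phaseS, phaseS, neg_div, Real.arctan_neg, mul_neg]

theorem le_phaseS {a x : ℝ} (ha : 0 < a) (h : a ≤ x) : lam / a * (Real.pi / 4) ≤ phaseS a x := by
  have hl := lam_pos
  rw [phaseS, ← Real.arctan_one]
  gcongr
  rwa [one_le_div ha]

/-- Over radii at most s the unit ball contains all heights up to t = √(1 - s²). Once a < t the
phase at ±t is at least (i + lam)π in modulus, while ψ costs less than π/2, so the number of turns
tends to infinity. -/
theorem eventually_containsNValued (N : ℝ) {s : ℝ} (hs : s ∈ Ioo (0 : ℝ) 1) :
    ∀ᶠ i in atTop, ∀ j, ContainsNValued (graphDom (phaseS (seqA i)) (seqA i) heightsS j) N s := by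
  have hs2 : s ^ 2 < 1 := pow_lt_one₀ hs.1.le hs.2 two_ne_zero
  set t := √(1 - s ^ 2) with ht
  have ht0 : 0 < t := Real.sqrt_pos.2 (by linarith)
  have ht2 : t ^ 2 = 1 - s ^ 2 := Real.sq_sqrt (by linarith)
  have ht1 : |t| ≤ 1 := (sq_le_one_iff_abs_le_one _).1 (by nlinarith [sq_nonneg s])
  filter_upwards [tendsto_seqA.eventually_lt_const ht0,
    tendsto_natCast_atTop_atTop.eventually_ge_atTop (N + 1)] with i hi hN j
  refine ⟨shift j, fun ρ θ h0 hρ hθ => ?_⟩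
  have hρ2 : ρ ^ 2 ≤ s ^ 2 := by gcongr
  have hU := le_phaseS (seqA_pos i) hi.le
  rw [lam_div_seqA] at hU
  have hpi := Real.pi_pos
  have hl := lam_pos
  have hU' : N * Real.pi + Real.pi / 2 ≤ phaseS (seqA i) t := by nlinarith
  obtain ⟨e1, e2⟩ := abs_lt.1 (abs_ang_sub_lt (phaseS (seqA i)) (seqA i) t ρ)
  obtain ⟨e3, e4⟩ := abs_lt.1 (abs_ang_sub_lt (phaseS (seqA i)) (seqA i) (-t) ρ)
  rw [phaseS_neg] at e3 e4
  rw [abs_le] at hθ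
  refine mem_graphDom_of_between (x := -t) (y := t) h0 (mem_heightsS_of_abs_le (by rwa [abs_neg]))
    (mem_heightsS_of_abs_le ht1) (by linarith) ?_ ?_ ?_ ?_ (isPhase_seqA i)
  · rw [neg_sq]; linarith
  · linarith
  · linarith
  · linarith

/-! ### The limit disks -/

section Limit

variable {ε : ℝ} (hε : ε ^ 2 = 1)

/-- The limit disks. -/
def diskT : EmbeddedMinimalDisk := spiralDisk (isPhase_phaseT hε) (isDiskParam_half hε)

theorem diskT_carrier : (diskT hε).carrier =
    surf phaseT 0 '' {q | q 0 ∈ heightsT ε ∧ ‖q‖ ≤ 1} := spiralDisk_carrier _ _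

include hε in
theorem eq_one_or_eq_neg_one : ε = 1 ∨ ε = -1 := by
  have : (ε - 1) * (ε + 1) = 0 := by linarith
  rcases mul_eq_zero.1 this with h | h
  · left; linarith
  · right; linarith

include hε in
theorem mul_mem_heightsT {t : ℝ} (h0 : 0 < t) (h1 : t ≤ 1) : ε * t ∈ heightsT ε := by
  have : ε * (ε * t) = t := by rw [← mul_assoc, ← sq, hε, one_mul]
  exact ⟨by rwa [this], by rw [this]; linarith⟩

theorem isTwoMultivaluedGraphs_diskT : IsTwoMultivaluedGraphs (diskT hε).carrier
    (graphDom phaseT 0 (heightsT ε)) (graphFun (isPhase_phaseT hε)) := by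
  refine isTwoMultivaluedGraphs_spiralDisk _ ⟨ε * (1 / 2), mul_mem_heightsT hε (by norm_num)
    (by norm_num), ?_⟩ _
  rcases eq_one_or_eq_neg_one hε with rfl | rfl <;> norm_num [abs_lt]

theorem abs_shift_le (j : Fin 2) : |shift j| ≤ Real.pi := by
  have := Real.pi_pos
  fin_cases j <;> simp [shift, abs_of_pos this, this.le]

theorem spiralsIntoPlane_diskT (j : Fin 2) :
    SpiralsIntoPlane (graphDom phaseT 0 (heightsT ε) j) (graphFun (isPhase_phaseT hε) j) := by
  have hl := lam_pos
  have hpi := Real.pi_pos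
  obtain ⟨hj1, hj2⟩ := abs_le.1 (abs_shift_le j)
  -- The phase -lam/x tends to -∞ as x ↓ 0 and to +∞ as x ↑ 0, so the turning direction is -ε.
  refine ⟨-ε, ?_, fun s hs => ?_, fun η hη => ?_⟩
  · rcases eq_one_or_eq_neg_one hε with rfl | rfl <;> simp
  · have hs2 : s ^ 2 < 1 := pow_lt_one₀ hs.1.le hs.2 two_ne_zero
    set t := √(1 - s ^ 2) with ht
    have ht0 : 0 < t := Real.sqrt_pos.2 (by linarith)
    have ht2 : t ^ 2 = 1 - s ^ 2 := Real.sq_sqrt (by linarith)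
    have ht1 : t ≤ 1 := (abs_le.1 ((sq_le_one_iff_abs_le_one _).1 (by nlinarith [sq_nonneg s]))).2
    -- lam/t is the modulus of the phase at the top height t, π/2 absorbs ψ, and the last π absorbs
    -- the shift of the second sheet.
    refine ⟨lam / t + Real.pi / 2 + Real.pi, fun ρ hρ θ hθ => ?_⟩
    have hρ2 : ρ ^ 2 ≤ s ^ 2 := by have := hρ.1; have := hρ.2; gcongr
    set m := -ε * (θ - shift j) with hm
    have hm1 : lam / t + Real.pi / 2 ≤ m := by
      rcases eq_one_or_eq_neg_one hε with rfl | rfl <;> linarith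
    have hlt : 0 < lam / t := by positivity
    have hm2 : 0 < m + Real.pi / 2 := by linarith
    -- At height εy the phase has modulus m + π/2, so after the loss |ψ| < π/2 the angle is still
    -- beyond the prescribed one.
    set y := lam / (m + Real.pi / 2) with hy
    have hy0 : 0 < y := by positivity
    have hyt : y ≤ t := by
      rw [hy, div_le_iff₀ (by positivity)]
      rw [← div_le_iff₀' ht0]
      linarith
    have hly : lam / y = m + Real.pi / 2 := by rw [hy]; field_simp
    have hy2 : y ^ 2 ≤ t ^ 2 := by gcongr
    have ht' := abs_lt.1 (abs_ang_sub_lt phaseT 0 (ε * t) ρ)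
    have hy' := abs_lt.1 (abs_ang_sub_lt phaseT 0 (ε * y) ρ)
    rcases eq_one_or_eq_neg_one hε with h | h
    · subst h
      simp only [phaseT, one_mul] at ht' hy'
      refine mem_graphDom_of_between (x := y) (y := t) hρ.1
        (by simpa using mul_mem_heightsT hε hy0 (hyt.trans ht1))
        (by simpa using mul_mem_heightsT hε ht0 ht1) hyt ?_ ?_ ?_ ?_ (isPhase_phaseT hε)
      all_goals linarith
    · subst h
      simp only [phaseT, neg_one_mul, div_neg, neg_neg] at ht' hy'
      refine mem_graphDom_of_between (x := -t) (y := -y) hρ.1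
        (by simpa using mul_mem_heightsT hε ht0 ht1)
        (by simpa using mul_mem_heightsT hε hy0 (hyt.trans ht1)) (by linarith)
        ?_ ?_ ?_ ?_ (isPhase_phaseT hε)
      all_goals try rw [neg_sq]
      all_goals linarith
  · refine ⟨lam / η + 2 * Real.pi, ?_⟩
    rintro ⟨ρ, θ⟩ ⟨x, hx, h0, h1, h⟩ hΘ
    change θ = ang phaseT 0 x ρ + shift j at h
    subst h
    rw [graphFun_ang _ j hx h0 h1]
    simp only at hΘ
    have hx0 := hx.1
    have he := abs_lt.1 (abs_ang_sub_lt phaseT 0 x ρ)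
    have habs : |x| = ε * x := by
      rcases eq_one_or_eq_neg_one hε with rfl | rfl
      · rw [one_mul] at hx0 ⊢; exact abs_of_pos hx0
      · rw [neg_one_mul] at hx0 ⊢; exact abs_of_neg (by linarith)
    have hkey : lam / η < lam / (ε * x) := by
      rcases eq_one_or_eq_neg_one hε with rfl | rfl
      · simp only [phaseT, one_mul] at he hΘ ⊢
        linarith
      · simp only [phaseT, neg_one_mul, neg_neg, div_neg, one_mul] at he hΘ ⊢
        linarith
    rw [habs]
    exact (div_lt_div_iff_of_pos_left hl hη hx0).1 hkey

/-! ### The closure of a limit disk -/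

theorem mem_closure_of_spiralsIntoPlane {W : Set (ℝ × ℝ)} {u : ℝ × ℝ → ℝ}
    (h : SpiralsIntoPlane W u) {s : ℝ} (hs : s ∈ Ioo (0 : ℝ) 1) (α : ℝ) :
    !₂[s * Real.cos α, s * Real.sin α, 0] ∈ closure (graphPt u '' W) := by
  obtain ⟨σ, hσ, h1, h2⟩ := h
  obtain ⟨θ₀, hθ₀⟩ := h1 s hs
  rw [Metric.mem_closure_iff]
  intro e he
  obtain ⟨Θ, hΘ⟩ := h2 e he
  obtain ⟨n, hn⟩ := exists_nat_ge (max θ₀ Θ + |α|)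
  have hpi := Real.pi_gt_three
  have hn0 : (0 : ℝ) ≤ n := Nat.cast_nonneg n
  have hlarge : max θ₀ Θ ≤ σ * (α + σ * (n * (2 * Real.pi))) := by
    have e1 : σ * (α + σ * (n * (2 * Real.pi))) = σ * α + n * (2 * Real.pi) := by
      rcases hσ with rfl | rfl <;> ring
    have e2 : -|α| ≤ σ * α := by
      rcases hσ with rfl | rfl
      · rw [one_mul]; exact neg_abs_le α
      · rw [neg_one_mul]; exact neg_le_neg (le_abs_self α)
    rw [e1]
    nlinarith
  have hW := hθ₀ s ⟨hs.1, le_rfl⟩ _ ((le_max_left _ _).trans hlarge)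
  refine ⟨_, mem_image_of_mem _ hW, ?_⟩
  have hcos : Real.cos (α + σ * (n * (2 * Real.pi))) = Real.cos α := by
    rcases hσ with rfl | rfl
    · rw [one_mul, Real.cos_add_nat_mul_two_pi]
    · rw [neg_one_mul, ← sub_eq_add_neg, Real.cos_sub_nat_mul_two_pi]
  have hsin : Real.sin (α + σ * (n * (2 * Real.pi))) = Real.sin α := by
    rcases hσ with rfl | rfl
    · rw [one_mul, Real.sin_add_nat_mul_two_pi]
    · rw [neg_one_mul, ← sub_eq_add_neg, Real.sin_sub_nat_mul_two_pi]
  have hu := hΘ _ hW ((le_max_right _ _).trans hlarge)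
  rw [graphPt, EuclideanSpace.dist_eq, Fin.sum_univ_three]
  simp only [hcos, hsin]
  simpa [Real.dist_eq, Real.sqrt_sq_eq_abs] using hu

theorem exists_polar (x y : ℝ) : ∃ α, x = √(x ^ 2 + y ^ 2) * Real.cos α ∧
    y = √(x ^ 2 + y ^ 2) * Real.sin α := by
  have h : ‖(⟨x, y⟩ : ℂ)‖ = √(x ^ 2 + y ^ 2) := by
    rw [Complex.norm_def, Complex.normSq_mk, sq, sq]
  refine ⟨Complex.arg ⟨x, y⟩, ?_, ?_⟩
  · rw [← h, Complex.norm_mul_cos_arg]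
  · rw [← h, Complex.norm_mul_sin_arg]

/-- The spiralling sheet accumulates at every point of the plane at distance in (0, 1) from 0; the
origin and the unit circle follow by passing to the closure of this interval of radii. -/
theorem closedBall_inter_plane_subset_closure :
    Metric.closedBall 0 1 ∩ plane₀ ⊆ closure (diskT hε).carrier := by
  rintro p ⟨hp, h2 : p 2 = 0⟩
  rw [mem_closedBall_zero_iff] at hp
  obtain ⟨α, hα0, hα1⟩ := exists_polar (p 0) (p 1)
  have hax : axr p ≤ 1 := by
    have h := norm_space_sq p
    rw [h2] at h
    refine Real.sqrt_le_one.2 ?_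
    nlinarith [norm_nonneg p]
  have hcont : Continuous fun t : ℝ => (!₂[t * Real.cos α, t * Real.sin α, 0] : Space) := by
    fun_prop
  have hmem : axr p ∈ closure (Ioo (0 : ℝ) 1) := by
    rw [closure_Ioo zero_ne_one]
    exact ⟨axr_nonneg p, hax⟩
  have h := hcont.continuousAt.continuousWithinAt.mem_closure hmem
    (t := closure (diskT hε).carrier) fun t ht => by
      refine closure_mono ?_ (mem_closure_of_spiralsIntoPlane (spiralsIntoPlane_diskT hε 0) ht α)
      exact subset_union_left.trans
        ((isTwoMultivaluedGraphs_diskT hε).2.1.symm.subset.trans sdiff_subset)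
  rw [closure_closure] at h
  convert h using 1
  exact space_ext hα0 hα1 h2

/-- Off the plane x₃ = 0 the angle of the limit surface is continuous, so the implicit equation of
the disk passes to limits. -/
theorem closure_diskT_subset : closure (diskT hε).carrier ⊆
    (diskT hε).carrier ∪ Metric.closedBall 0 1 ∩ plane₀ := by
  intro p hp
  have hball : p ∈ Metric.closedBall 0 1 :=
    closure_minimal (spiralDisk_carrier_subset _ _) Metric.isClosed_closedBall hp
  have hle : 0 ≤ ε * p 2 := by
    have hcl : IsClosed {p : Space | 0 ≤ ε * p 2} :=
      isClosed_le continuous_const (by fun_prop)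
    refine closure_minimal (fun z hz => ?_) hcl hp
    exact ((mem_spiralDisk_carrier _ _).1 hz).1.1.1.le
  rcases hle.eq_or_lt with h | h
  · refine Or.inr ⟨hball, ?_⟩
    rcases mul_eq_zero.1 h.symm with h | h
    · rw [h] at hε; norm_num at hε
    · exact h
  · left
    have h1 : ‖p‖ ≤ 1 := mem_closedBall_zero_iff.1 hball
    have hn := norm_space_sq p
    have hp2 : p 2 ∈ heightsT ε := by
      refine ⟨h, ?_⟩
      have hsq : (ε * p 2) ^ 2 ≤ 1 := by
        rw [mul_pow, hε]
        nlinarith [norm_nonneg p, sq_nonneg (p 0), sq_nonneg (p 1)]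
      linarith [(sq_le_one_iff₀ h.le).1 hsq]
    have hax : axr p < 2 := by
      have := axr_sq p
      exact lt_of_abs_lt (abs_lt_of_sq_lt_sq (b := 2)
        (by nlinarith [norm_nonneg p, sq_nonneg (p 2)]) (by norm_num))
    refine (mem_spiralDisk_carrier _ _).2 ⟨⟨hp2, h1⟩, ?_⟩
    have hU := isPhase_phaseT hε
    have hmem : p ∈ surfRange (heightsT ε) := ⟨hp2, hax⟩
    have hopen : IsOpen (surfRange (heightsT ε)) :=
      (hU.isOpen.preimage (by fun_prop : Continuous fun p : Space => p 2)).inter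
        (isOpen_lt continuous_axr continuous_const)
    have hang := (continuousOn_ang_axr hU).continuousAt (hopen.mem_nhds hmem)
    have hc0 : Continuous fun p : Space => p 0 := by fun_prop
    have hc1 : Continuous fun p : Space => p 1 := by fun_prop
    have hcont : ContinuousAt (fun p : Space => p 1 * Real.cos (ang phaseT 0 (p 2) (axr p)) -
        p 0 * Real.sin (ang phaseT 0 (p 2) (axr p))) p :=
      (hc1.continuousAt.mul (Real.continuous_cos.continuousAt.comp hang)).sub
        (hc0.continuousAt.mul (Real.continuous_sin.continuousAt.comp hang))
    have := hcont.continuousWithinAt.mem_closure hp (t := {0}) fun z hz =>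
      ((mem_spiralDisk_carrier _ _).1 hz).2
    rwa [closure_singleton] at this

theorem closure_diskT_diff : closure (diskT hε).carrier \ (diskT hε).carrier =
    Metric.closedBall 0 1 ∩ plane₀ := by
  ext p
  constructor
  · rintro ⟨h1, h2⟩
    exact (closure_diskT_subset hε h1).resolve_left h2
  · refine fun h => ⟨closedBall_inter_plane_subset_closure hε h, fun h' => ?_⟩
    have := ((mem_spiralDisk_carrier _ _).1 h').1.1.1
    rw [show p 2 = 0 from h.2, mul_zero] at this
    exact lt_irrefl _ this

/-- The intersection with the closed unit ball is the whole disk, which is not closed. -/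
theorem not_isProperSet_diskT : ¬ IsProperSet (diskT hε).carrier := by
  intro h
  have h1 := h _ (isCompact_closedBall 0 1)
  rw [inter_eq_left.2 (show (diskT hε).carrier ⊆ _ from spiralDisk_carrier_subset _ _)] at h1
  have h2 := closure_diskT_diff hε
  rw [h1.isClosed.closure_eq, sdiff_self] at h2
  have : (0 : Space) ∈ Metric.closedBall 0 1 ∩ plane₀ := ⟨by simp, by simp [plane₀]⟩
  rw [← h2] at this
  exact this

end Limit

/-! ### Convergence -/

/-- The family of phases of the compact disks, up to a multiple of `2π`. -/
def phaseV (a x : ℝ) : ℝ := lam * avg (fun q : ℝ × ℝ => q.1 / (q.1 ^ 2 + q.2 ^ 2)) (x, a)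

theorem isOpen_fst_ne_zero : IsOpen {q : ℝ × ℝ | q.1 ≠ 0} := isOpen_ne.preimage continuous_fst

theorem vertStar_fst_ne_zero : VertStar {q : ℝ × ℝ | q.1 ≠ 0} := fun _ hq _ _ => hq

theorem contDiffOn_angularDensity :
    ContDiffOn ℝ ∞ (fun q : ℝ × ℝ => q.1 / (q.1 ^ 2 + q.2 ^ 2)) {q | q.1 ≠ 0} :=
  ContDiffOn.div (by fun_prop) (by fun_prop) fun q hq => by
    have : q.1 ≠ 0 := hq
    positivity

theorem contDiffOn_phaseV : ContDiffOn ℝ ∞ (fun q : ℝ × ℝ => phaseV q.1 q.2) {q | q.2 ≠ 0} :=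
  contDiffOn_const.mul ((contDiffOn_avg isOpen_fst_ne_zero vertStar_fst_ne_zero
    contDiffOn_angularDensity).comp (f := fun q : ℝ × ℝ => (q.2, q.1))
      (ContDiff.contDiffOn (by fun_prop)) fun q hq => hq)

theorem phaseV_zero (x : ℝ) : phaseV 0 x = lam / x := by
  have h : x / x ^ 2 = x⁻¹ := by
    rcases eq_or_ne x 0 with rfl | h
    · simp
    · field_simp
  simp [phaseV, avg, h, div_eq_mul_inv]

/-- x / (x² + a²) is the derivative of arctan(a/x) in a. Thus `phaseV` is (lam/a) arctan(a/x) with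
the division by a carried out under the integral, hence smooth across a = 0. -/
theorem mul_phaseV {a x : ℝ} (hx : x ≠ 0) : a * phaseV a x = lam * Real.arctan (a / x) := by
  have h := smul_avg_deriv_eq_sub vertStar_fst_ne_zero
    (ℓ := fun q : ℝ × ℝ => Real.arctan (q.2 / q.1)) contDiffOn_angularDensity.continuousOn
    (fun p hp => ?_) (p := (x, a)) hx
  · simp only [zero_div, Real.arctan_zero, sub_zero, smul_eq_mul] at h
    rw [← h, phaseV]
    ring
  · have hp' : p.1 ≠ 0 := hp
    refine ((hasDerivAt_id p.2).div_const p.1).arctan.congr_deriv ?_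
    simp only [id]
    field_simp

/-- From arctan(x/a) = ±π/2 - arctan(a/x): the term with π/2 diverges as a → 0, but along `seqA` it
is a multiple of 2π and is invisible on the surface. -/
theorem phaseS_eq {ε : ℝ} (hε : ε ^ 2 = 1) (i : ℕ) {x : ℝ} (hx : 0 < ε * x) :
    phaseS (seqA i) x = -phaseV (seqA i) x + ε * ((i + 2 ^ 20 : ℕ) * (2 * Real.pi)) := by
  have ha := seqA_pos i
  have hx0 : x ≠ 0 := by rintro rfl; simp at hx
  have h1 := mul_phaseV (a := seqA i) hx0
  have h2 : Real.arctan (x / seqA i) = ε * (Real.pi / 2) - Real.arctan (seqA i / x) := by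
    rw [← inv_div (seqA i) x]
    rcases eq_one_or_eq_neg_one hε with rfl | rfl
    · rw [Real.arctan_inv_of_pos (div_pos ha (by linarith)), one_mul]
    · rw [Real.arctan_inv_of_neg (div_neg_of_pos_of_neg ha (by linarith))]
      ring
  have h3 : phaseV (seqA i) x = lam / seqA i * Real.arctan (seqA i / x) := by
    field_simp
    linarith
  have h4 : (((i + 2 ^ 20 : ℕ) : ℝ)) = i + lam := by push_cast; norm_num [lam]
  rw [phaseS, h2, h3, mul_sub, lam_div_seqA, h4]
  ring

theorem surf_phaseS_eq {ε : ℝ} (hε : ε ^ 2 = 1) (i : ℕ) {q : Plane} (hq : 0 < ε * q 0) :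
    surf (phaseS (seqA i)) (seqA i) q = surf (fun x => -phaseV (seqA i) x) (seqA i) q := by
  have h : ang (phaseS (seqA i)) (seqA i) (q 0) (q 1) =
      ang (fun x => -phaseV (seqA i) x) (seqA i) (q 0) (q 1) +
        ε * ((i + 2 ^ 20 : ℕ) * (2 * Real.pi)) := by
    rw [ang, ang, phaseS_eq hε i hq]
    ring
  rw [surf, surf, h, spiralPt, spiralPt]
  rcases eq_one_or_eq_neg_one hε with rfl | rfl
  · rw [one_mul, Real.cos_add_nat_mul_two_pi, Real.sin_add_nat_mul_two_pi]
  · rw [neg_one_mul, ← sub_eq_add_neg, Real.cos_sub_nat_mul_two_pi, Real.sin_sub_nat_mul_two_pi]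

/-- The joint parametrization of the half disks, including the limit at parameter `0`. -/
def family (ε : ℝ) (p : ℝ × Plane) : Space :=
  surf (fun x => -phaseV p.1 x) p.1 (toHalf ε p.2)

/-- The parameter domain containing the domain of the limit. -/
def familyDom : Set Plane := {q | |q 1| < 1 ∧ 0 < q 0 + chord q ∧ q 0 + chord q < 3}

theorem isOpen_familyDom : IsOpen familyDom :=
  (isOpen_lt contDiff_proj_one.continuous.abs continuous_const).inter
    ((isOpen_lt continuous_const (contDiff_proj_zero.continuous.add continuous_chord)).inter
      (isOpen_lt (contDiff_proj_zero.continuous.add continuous_chord) continuous_const))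

section Convergence

variable {ε : ℝ} (hε : ε ^ 2 = 1)
include hε

theorem halfDom_subset_familyDom : halfDom ⊆ familyDom := fun q hq => by
  have h := (toHalf_mem hε hq).1.2
  rw [mul_toHalf_zero hε] at h
  exact ⟨hq.1.1, hq.1.2, by linarith⟩

theorem toHalf_mem_heightsT {q : Plane} (hq : q ∈ familyDom) : toHalf ε q 0 ∈ heightsT ε := by
  obtain ⟨-, h1, h2⟩ := hq
  refine ⟨?_, ?_⟩ <;> rw [mul_toHalf_zero hε] <;> linarith

/-- On a half space x ≠ 0, so sz = x² + a² stays positive at a = 0 and every ingredient is smooth in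
a neighbourhood of this parameter. -/
theorem contDiffOn_family :
    ContDiffOn ℝ ∞ (family ε) {p | |p.1| < 1 ∧ p.2 ∈ familyDom} := by
  set O : Set (ℝ × Plane) := {p | |p.1| < 1 ∧ p.2 ∈ familyDom} with hO
  have hH : ContDiffOn ℝ ∞ (fun p : ℝ × Plane => toHalf ε p.2) O :=
    (contDiffOn_toHalf ε).comp contDiffOn_snd fun p hp => hp.2.1
  have h0 : ContDiffOn ℝ ∞ (fun p : ℝ × Plane => toHalf ε p.2 0) O :=
    contDiff_proj_zero.comp_contDiffOn hH
  have h1 : ContDiffOn ℝ ∞ (fun p : ℝ × Plane => toHalf ε p.2 1) O :=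
    contDiff_proj_one.comp_contDiffOn hH
  have hV : ContDiffOn ℝ ∞ (fun p : ℝ × Plane => phaseV p.1 (toHalf ε p.2 0)) O :=
    contDiffOn_phaseV.comp (contDiffOn_fst.prodMk h0) fun p hp h => by
      have := (toHalf_mem_heightsT hε hp.2).1
      simp only at h
      rw [h, mul_zero] at this
      exact lt_irrefl _ this
  have hpsi : ContDiffOn ℝ ∞
      (fun p : ℝ × Plane => psiR ((p.1, toHalf ε p.2 0), toHalf ε p.2 1)) O :=
    contDiffOn_psiR.comp ((contDiffOn_fst.prodMk h0).prodMk h1) fun p hp => by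
      have hm := toHalf_mem_heightsT hε hp.2
      have hsq : toHalf ε p.2 0 ^ 2 = (ε * toHalf ε p.2 0) ^ 2 := by rw [mul_pow, hε, one_mul]
      have ha : p.1 ^ 2 < 1 := (sq_lt_one_iff_abs_lt_one _).2 hp.1
      refine ⟨⟨?_, ?_⟩, lt_trans (show |toHalf ε p.2 1| < 1 from hp.2.1) (by norm_num)⟩
      · change 0 < toHalf ε p.2 0 ^ 2 + p.1 ^ 2
        rw [hsq]
        have := hm.1
        positivity
      · change toHalf ε p.2 0 ^ 2 + p.1 ^ 2 < 4
        rw [hsq]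
        nlinarith [hm.1, hm.2]
  have hang := hV.neg.add hpsi
  exact contDiffOn_space (h1.mul (Real.contDiff_cos.comp_contDiffOn hang))
    (h1.mul (Real.contDiff_sin.comp_contDiffOn hang)) h0

omit hε in
theorem isOpen_familyDom_prod : IsOpen {p : ℝ × Plane | |p.1| < 1 ∧ p.2 ∈ familyDom} :=
  (isOpen_lt continuous_fst.abs continuous_const).inter (isOpen_familyDom.preimage continuous_snd)

theorem family_zero : (fun q => family ε (0, q)) = (diskT hε).toFun := by
  have : (fun x => -phaseV 0 x) = phaseT := funext fun x => by rw [phaseV_zero, phaseT]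
  ext1 q
  simp only [family, this]
  rfl

theorem family_seqA (i : ℕ) {q : Plane} (hq : 0 < ε * toHalf ε q 0) :
    family ε (seqA i, q) = surf (phaseS (seqA i)) (seqA i) (toHalf ε q) :=
  (surf_phaseS_eq hε i hq).symm

theorem smoothlyConverges_diskS : SmoothlyConverges diskS (halfSpace ε) (diskT hε) := by
  refine ⟨fun i q => family ε (seqA i, q), fun Q hQ _ => Eventually.of_forall fun i => ?_,
    fun k => ?_, fun K hK hKc => ?_⟩
  · have hQ' : Q ⊆ halfDom := hQ
    have ha : |seqA i| < 1 := by rw [abs_of_pos (seqA_pos i)]; exact seqA_lt_one i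
    refine ⟨⟨familyDom, isOpen_familyDom, hQ'.trans (halfDom_subset_familyDom hε),
      (contDiffOn_family hε).comp (ContDiff.contDiffOn (by fun_prop)) fun q hq => ⟨ha, hq⟩⟩,
      fun q hq z hz h => ?_, fun q hq => ?_⟩
    · have hq' := toHalf_mem hε (hQ' hq)
      have hz' := toHalf_mem hε (hQ' hz)
      have hS : ∀ {q}, ‖toHalf ε q‖ ≤ 1 → toHalf ε q ∈ surfDom heightsS := fun h =>
        mem_surfDom_of_norm_le (mem_heightsS_of_abs_le (abs_apply_zero_le h)) h
      simp only [family_seqA hε i hq'.1.1, family_seqA hε i hz'.1.1] at h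
      have := surf_injOn (isPhase_seqA i) (hS hq'.2) (hS hz'.2) h
      rw [← ofHalf_toHalf hε q, this, ofHalf_toHalf hε z]
    · have hq' := toHalf_mem hε (hQ' hq)
      simp only [family_seqA hε i hq'.1.1]
      refine ⟨?_, ?_⟩
      · rw [diskS_carrier]
        exact ⟨_, ⟨mem_heightsS_of_abs_le (abs_apply_zero_le hq'.2), hq'.2⟩, rfl⟩
      · exact hq'.1.1
  · rw [← family_zero hε]
    exact tendstoLocallyUniformlyOn_iteratedFDeriv isOpen_familyDom_prod
      (contDiffOn_family hε) tendsto_seqA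
      (fun q hq => ⟨by simp, halfDom_subset_familyDom hε hq⟩) k
  · obtain ⟨δ, hδ, hKδ⟩ : ∃ δ > 0, ∀ p ∈ K, δ ≤ ε * p 2 := by
      rcases K.eq_empty_or_nonempty with rfl | hne
      · exact ⟨1, one_pos, by simp⟩
      · have hc : Continuous fun p : Space => ε * p 2 := by fun_prop
        obtain ⟨p, hp, hmin⟩ := hKc.exists_isMinOn hne hc.continuousOn
        exact ⟨ε * p 2, hK hp, fun z hz => hmin hz⟩
    -- Compactness of K keeps it at height at least δ from the plane, and the part of the closed
    -- half disk at such heights is compact.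
    refine ⟨ofHalf ε '' (Metric.closedBall 0 1 ∩ {q | δ ≤ ε * q 0}), ?_, ?_, ?_⟩
    · rintro _ ⟨q, ⟨h1, h2⟩, rfl⟩
      exact ofHalf_mem hε (hδ.trans_le h2) (mem_closedBall_zero_iff.1 h1)
    · refine ((isCompact_closedBall 0 1).inter_right
        (isClosed_le continuous_const (contDiff_proj_zero.continuous.const_mul ε))).image ?_
      have := continuous_chord
      have := contDiff_proj_zero.continuous
      have := contDiff_proj_one.continuous
      unfold ofHalf
      fun_prop
    · refine Eventually.of_forall fun i => ?_
      rintro p ⟨hp, hpK⟩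
      rw [diskS_carrier] at hp
      obtain ⟨q, ⟨hJ, h1⟩, rfl⟩ := hp
      have h2 : δ ≤ ε * q 0 := hKδ _ hpK
      refine ⟨ofHalf ε q, ⟨q, ⟨mem_closedBall_zero_iff.2 h1, h2⟩, rfl⟩, ?_⟩
      have h3 := toHalf_ofHalf hε q
      simp only
      rw [family_seqA hε i (by rw [h3]; exact hδ.trans_le h2), h3]

theorem isSpiralingLimit_diskT : IsSpiralingLimit diskS ε (diskT hε) := by
  refine ⟨fun p hp => ⟨spiralDisk_carrier_subset _ _ hp, ?_⟩, spiralDisk_boundary _ _,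
    smoothlyConverges_diskS hε, closure_diskT_diff hε, _, _, isTwoMultivaluedGraphs_diskT hε,
    spiralsIntoPlane_diskT hε⟩
  exact ((mem_spiralDisk_carrier _ _).1 hp).1.1.1

end Convergence

/-! ### The leaves -/

/-- The part of the limit disk in the open ball. -/
def leafT {ε : ℝ} (hε : ε ^ 2 = 1) : Set Space := (diskT hε).carrier ∩ Metric.ball 0 1

/-- The punctured horizontal disk. -/
def leafPlane : Set Space := (Metric.ball 0 1 ∩ plane₀) \ {0}

theorem abs_apply_two_lt {p : Space} (h : ‖p‖ < 1) : |p 2| < 1 := by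
  have h1 := norm_space_sq p
  exact (sq_lt_one_iff_abs_lt_one _).1
    (by nlinarith [sq_nonneg (p 0), sq_nonneg (p 1), norm_nonneg p])

theorem axr_lt_one {p : Space} (h : ‖p‖ < 1) : axr p < 1 := by
  have h1 := norm_space_sq p
  have h2 := axr_sq p
  exact lt_of_abs_lt ((sq_lt_one_iff_abs_lt_one _).1
    (by nlinarith [sq_nonneg (p 2), norm_nonneg p]))

section LeafT

variable {ε : ℝ} (hε : ε ^ 2 = 1)

include hε in
theorem mul_le_abs (x : ℝ) : ε * x ≤ |x| := by
  rcases eq_one_or_eq_neg_one hε with rfl | rfl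
  · rw [one_mul]; exact le_abs_self x
  · rw [neg_one_mul]; exact neg_le_abs x

theorem mem_leafT {p : Space} (h : ‖p‖ < 1) : p ∈ leafT hε ↔ 0 < ε * p 2 ∧
    p 1 * Real.cos (ang phaseT 0 (p 2) (axr p)) -
      p 0 * Real.sin (ang phaseT 0 (p 2) (axr p)) = 0 := by
  have h2 := (mul_le_abs hε (p 2)).trans_lt (abs_apply_two_lt h)
  constructor
  · rintro ⟨h1, -⟩
    have := (mem_spiralDisk_carrier _ _).1 h1
    exact ⟨this.1.1.1, this.2⟩
  · rintro ⟨h3, h4⟩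
    exact ⟨(mem_spiralDisk_carrier _ _).2 ⟨⟨⟨h3, by linarith⟩, h.le⟩, h4⟩,
      mem_ball_zero_iff.2 h⟩

theorem mul_pos_of_mem_leafT {p : Space} (hp : p ∈ leafT hε) : 0 < ε * p 2 :=
  ((mem_leafT hε (mem_ball_zero_iff.1 hp.2)).1 hp).1

theorem leafT_eq : leafT hε = surf phaseT 0 '' {q | q 0 ∈ heightsT ε ∧ ‖q‖ < 1} := by
  rw [leafT, diskT_carrier]
  ext p
  constructor
  · rintro ⟨⟨q, hq, rfl⟩, h⟩
    rw [mem_ball_zero_iff, norm_surf] at h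
    exact ⟨q, ⟨hq.1, h⟩, rfl⟩
  · rintro ⟨q, hq, rfl⟩
    exact ⟨⟨q, ⟨hq.1, hq.2.le⟩, rfl⟩, by rw [mem_ball_zero_iff, norm_surf]; exact hq.2⟩

theorem isPathConnected_leafT : IsPathConnected (leafT hε) := by
  have hU := isPhase_phaseT hε
  rw [leafT_eq]
  refine IsPathConnected.image' (Convex.isPathConnected ?_ ?_)
    ((contDiffOn_surf hU).continuousOn.mono fun q hq => mem_surfDom_of_norm_le hq.1 hq.2.le)
  · intro q hq z hz s t hs ht hst
    exact ⟨hU.ordConnected.convex hq.1 hz.1 hs ht hst,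
      mem_ball_zero_iff.1 (convex_ball (0 : Plane) 1 (mem_ball_zero_iff.2 hq.2)
        (mem_ball_zero_iff.2 hz.2) hs ht hst)⟩
  · refine ⟨!₂[ε * (1 / 2), 0], mul_mem_heightsT hε (by norm_num) (by norm_num), ?_⟩
    rw [← sq_lt_one_iff₀ (norm_nonneg _), norm_plane_sq]
    simp only [Matrix.cons_val_zero, Matrix.cons_val_one, Matrix.cons_val_fin_one, mul_pow, hε]
    norm_num

end LeafT

/-- The inclusion of the horizontal plane. -/
def flat (q : Plane) : Space := !₂[q 0, q 1, 0]

theorem norm_flat (q : Plane) : ‖flat q‖ = ‖q‖ := by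
  rw [← sq_eq_sq₀ (norm_nonneg _) (norm_nonneg _), norm_plane_sq, norm_space_sq]
  simp [flat]

theorem contDiff_flat : ContDiff ℝ ∞ flat := by
  rw [← contDiffOn_univ]
  exact contDiffOn_space contDiff_proj_zero.contDiffOn contDiff_proj_one.contDiffOn
    contDiffOn_const

theorem isPathConnected_leafPlane : IsPathConnected leafPlane := by
  have himg : leafPlane = (fun q : ℝ × ℝ => (!₂[q.1 * Real.cos q.2, q.1 * Real.sin q.2, 0] : Space))
      '' (Ioo (0 : ℝ) 1 ×ˢ univ) := by
    have hn : ∀ q : ℝ × ℝ, ‖(!₂[q.1 * Real.cos q.2, q.1 * Real.sin q.2, 0] : Space)‖ ^ 2 =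
        q.1 ^ 2 := fun q => by
      rw [norm_space_sq]
      simp
      linear_combination q.1 ^ 2 * Real.sin_sq_add_cos_sq q.2
    ext p
    constructor
    · rintro ⟨⟨h1, h2 : p 2 = 0⟩, h0⟩
      obtain ⟨α, hα0, hα1⟩ := exists_polar (p 0) (p 1)
      refine ⟨(axr p, α), ⟨⟨(axr_nonneg p).lt_of_ne fun h => h0 ?_,
        axr_lt_one (mem_ball_zero_iff.1 h1)⟩, trivial⟩, (space_ext hα0 hα1 h2).symm⟩
      change 0 = √(p 0 ^ 2 + p 1 ^ 2) at h
      rw [← h, zero_mul] at hα0 hα1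
      exact space_ext hα0 hα1 h2
    · rintro ⟨q, ⟨⟨h0, h1⟩, -⟩, rfl⟩
      have := hn q
      refine ⟨⟨?_, ?_⟩, fun h => ?_⟩
      · rw [mem_ball_zero_iff, ← sq_lt_one_iff₀ (norm_nonneg _), hn]
        nlinarith
      · simp [plane₀]
      · simp only [mem_singleton_iff] at h
        rw [h, norm_zero] at this
        nlinarith
  rw [himg]
  have hne : (Ioo (0 : ℝ) 1 ×ˢ (univ : Set ℝ)).Nonempty :=
    ⟨(1 / 2, 0), ⟨by norm_num, by norm_num⟩, trivial⟩
  refine IsPathConnected.image (((convex_Ioo 0 1).prod convex_univ).isPathConnected hne) ?_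
  fun_prop

theorem contDiff_affine (q : Plane) (r : ℝ) : ContDiff ℝ ∞ fun z : Plane => q + r • z := by
  fun_prop

theorem affine_leftInverse (q : Plane) {r : ℝ} (hr : r ≠ 0) (z : Plane) :
    r⁻¹ • (q + r • z - q) = z := by
  rw [add_sub_cancel_left, smul_smul, inv_mul_cancel₀ hr, one_smul]

theorem exists_affine_mapsTo {O : Set Plane} (hO : IsOpen O) {q : Plane} (hq : q ∈ O) :
    ∃ r : ℝ, r ≠ 0 ∧ MapsTo (fun z : Plane => q + r • z) (Metric.ball 0 1) O := by
  obtain ⟨r, hr, h⟩ := Metric.isOpen_iff.1 hO q hq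
  refine ⟨r, hr.ne', fun z hz => h ?_⟩
  rw [mem_ball_zero_iff] at hz
  rw [mem_ball_iff_norm, add_sub_cancel_left, norm_smul, Real.norm_of_nonneg hr.le]
  exact mul_lt_of_lt_one_right hr hz

theorem exists_isSmoothEmbeddingOn_leafT {ε : ℝ} (hε : ε ^ 2 = 1) {p : Space}
    (hp : p ∈ leafT hε) : ∃ f : Plane → Space,
    IsSmoothEmbeddingOn f (Metric.ball 0 1) ∧ f 0 = p ∧ f '' Metric.ball 0 1 ⊆ leafT hε := by
  have hU := isPhase_phaseT hε
  rw [leafT_eq] at hp ⊢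
  obtain ⟨q, hq, rfl⟩ := hp
  have hO : IsOpen {q : Plane | q 0 ∈ heightsT ε ∧ ‖q‖ < 1} :=
    (hU.isOpen.preimage contDiff_proj_zero.continuous).inter
      (isOpen_lt continuous_norm continuous_const)
  obtain ⟨r, hr, hm⟩ := exists_affine_mapsTo hO hq
  have hκ := contDiff_affine q r
  have hm' : MapsTo (fun z : Plane => q + r • z) (Metric.ball 0 1) (surfDom (heightsT ε)) :=
    fun z hz => mem_surfDom_of_norm_le (hm hz).1 (hm hz).2.le
  refine ⟨surf phaseT 0 ∘ fun z => q + r • z, ⟨⟨(fun z : Plane => q + r • z) ⁻¹'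
    surfDom (heightsT ε), (isOpen_surfDom hU).preimage hκ.continuous, hm',
    (contDiffOn_surf hU).comp hκ.contDiffOn fun z hz => hz⟩, fun z hz => ?_, ?_⟩, by simp, ?_⟩
  · refine injective_fderiv_surf_comp hU hκ.contDiffAt (hm' hz) ?_
    refine injective_fderiv_of_leftInverse (χ := fun w => r⁻¹ • (w - q))
      (hκ.contDiffAt.differentiableAt (by simp)) (by fun_prop)
      (Eventually.of_forall (affine_leftInverse q hr))
  · refine isEmbedding_domRestrict (T := surfRange (heightsT ε))
      (g := (fun w => r⁻¹ • (w - q)) ∘ unsurf phaseT 0)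
      ((contDiffOn_surf hU).continuousOn.comp hκ.continuous.continuousOn hm')
      ((by fun_prop : Continuous fun w : Plane => r⁻¹ • (w - q)).comp_continuousOn
        (continuousOn_unsurf hU)) (fun z hz => surf_mem_surfRange (hm' hz)) fun z hz => ?_
    simp only [Function.comp_apply]
    rw [unsurf_surf hU (hm' hz), affine_leftInverse q hr]
  · rintro _ ⟨z, hz, rfl⟩
    exact ⟨_, hm hz, rfl⟩

theorem exists_isSmoothEmbeddingOn_leafPlane {p : Space} (hp : p ∈ leafPlane) :
    ∃ f : Plane → Space,
      IsSmoothEmbeddingOn f (Metric.ball 0 1) ∧ f 0 = p ∧ f '' Metric.ball 0 1 ⊆ leafPlane := by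
  obtain ⟨⟨h1, h2 : p 2 = 0⟩, h0⟩ := hp
  have hpe : flat !₂[p 0, p 1] = p := space_ext rfl rfl h2.symm
  have hO : IsOpen (Metric.ball (0 : Plane) 1 \ {0}) := Metric.isOpen_ball.sdiff isClosed_singleton
  have hq : (!₂[p 0, p 1] : Plane) ∈ Metric.ball (0 : Plane) 1 \ {0} := by
    refine ⟨?_, fun h => h0 ?_⟩
    · rw [mem_ball_zero_iff, ← norm_flat, hpe]
      exact mem_ball_zero_iff.1 h1
    · rw [mem_singleton_iff, ← norm_eq_zero, ← norm_flat, hpe] at h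
      exact norm_eq_zero.1 h
  obtain ⟨r, hr, hm⟩ := exists_affine_mapsTo hO hq
  set q : Plane := !₂[p 0, p 1]
  have hκ := contDiff_affine q r
  have hχ : ContDiff ℝ ∞ fun z : Space => r⁻¹ • ((!₂[z 0, z 1] : Plane) - q) := by
    have h : ContDiff ℝ ∞ fun z : Space => (!₂[z 0, z 1] : Plane) := by
      rw [contDiff_euclidean]
      intro i
      fin_cases i
      exacts [contDiff_piLp_apply (𝕜 := ℝ) (i := (0 : Fin 3)) 2,
        contDiff_piLp_apply (𝕜 := ℝ) (i := (1 : Fin 3)) 2]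
    exact (contDiff_const (c := r⁻¹)).smul (h.sub (contDiff_const (c := q)))
  have hl : ∀ z : Plane, r⁻¹ • ((!₂[flat (q + r • z) 0, flat (q + r • z) 1] : Plane) - q) = z :=
    fun z => by
      rw [show (!₂[flat (q + r • z) 0, flat (q + r • z) 1] : Plane) = q + r • z from
        plane_ext rfl rfl, affine_leftInverse q hr]
  have hs := contDiff_flat.comp hκ
  refine ⟨flat ∘ fun z => q + r • z, ⟨⟨univ, isOpen_univ, subset_univ _, hs.contDiffOn⟩,
    fun z _ => ?_, ?_⟩, by simp [hpe], ?_⟩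
  · exact injective_fderiv_of_leftInverse (hs.contDiffAt.differentiableAt (by simp))
      (hχ.contDiffAt.differentiableAt (by simp)) (Eventually.of_forall hl)
  · exact isEmbedding_domRestrict (T := univ) hs.continuous.continuousOn
      hχ.continuous.continuousOn (mapsTo_univ _ _) fun z _ => hl z
  · rintro _ ⟨z, hz, rfl⟩
    obtain ⟨e1, e2⟩ := hm hz
    refine ⟨⟨?_, by simp [plane₀, flat]⟩, fun h => e2 ?_⟩
    · rw [Function.comp_apply, mem_ball_zero_iff, norm_flat]
      exact mem_ball_zero_iff.1 e1
    · rw [mem_singleton_iff, ← norm_eq_zero, Function.comp_apply, norm_flat] at h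
      exact norm_eq_zero.1 h

/-! ### Charts around points off the horizontal plane -/

theorem image_inter_eq_of_iff {X : Type} [TopologicalSpace X]
    (Φ : OpenPartialHomeomorph X (Plane × ℝ)) {Λ : Set X} {T : Set ℝ}
    (h : ∀ p ∈ Φ.source, p ∈ Λ ↔ (Φ p).2 ∈ T) :
    Φ '' (Φ.source ∩ Λ) = {y | y ∈ Φ.target ∧ y.2 ∈ T} := by
  ext y
  constructor
  · rintro ⟨p, ⟨hp, hΛ⟩, rfl⟩
    exact ⟨Φ.map_source hp, (h p hp).1 hΛ⟩
  · rintro ⟨hy, hT⟩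
    have h1 := Φ.map_target hy
    have h2 := Φ.right_inv hy
    exact ⟨Φ.symm y, ⟨h1, (h _ h1).2 (by rwa [h2])⟩, h2⟩

/-- The rotation by `-φ` about the axis. -/
def rot (φ : ℝ) (p : Space) : Plane × ℝ :=
  (!₂[p 2, p 0 * Real.cos φ + p 1 * Real.sin φ], p 1 * Real.cos φ - p 0 * Real.sin φ)

/-- The inverse of `rot`. -/
def unrot (φ : ℝ) (y : Plane × ℝ) : Space :=
  !₂[y.1 1 * Real.cos φ - y.2 * Real.sin φ, y.1 1 * Real.sin φ + y.2 * Real.cos φ, y.1 0]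

theorem unrot_rot (φ : ℝ) (p : Space) : unrot φ (rot φ p) = p := by
  refine space_ext ?_ ?_ rfl
  · simp only [unrot, rot, Matrix.cons_val_zero, Matrix.cons_val_one, Matrix.cons_val_fin_one]
    linear_combination p 0 * Real.sin_sq_add_cos_sq φ
  · simp only [unrot, rot, Matrix.cons_val_one, Matrix.cons_val_fin_one, Matrix.cons_val_zero]
    linear_combination p 1 * Real.sin_sq_add_cos_sq φ

theorem rot_unrot (φ : ℝ) (y : Plane × ℝ) : rot φ (unrot φ y) = y := by
  refine Prod.ext (plane_ext rfl ?_) ?_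
  · simp only [unrot, rot, Matrix.cons_val_zero, Matrix.cons_val_one, Matrix.cons_val_fin_one]
    linear_combination y.1 1 * Real.sin_sq_add_cos_sq φ
  · simp only [unrot, rot, Matrix.cons_val_zero, Matrix.cons_val_one]
    linear_combination y.2 * Real.sin_sq_add_cos_sq φ

/-- The distance to the axis in the coordinates of `rot`. -/
def axr' (y : Plane × ℝ) : ℝ := √(y.1 1 ^ 2 + y.2 ^ 2)

theorem axr_unrot (φ : ℝ) (y : Plane × ℝ) : axr (unrot φ y) = axr' y := by
  rw [axr, axr']
  congr 1
  simp only [unrot, Matrix.cons_val_zero, Matrix.cons_val_one]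
  linear_combination (y.1 1 ^ 2 + y.2 ^ 2) * Real.sin_sq_add_cos_sq φ

theorem axr'_rot (φ : ℝ) (p : Space) : axr' (rot φ p) = axr p := by
  rw [← axr_unrot φ, unrot_rot]

theorem norm_unrot_sq (φ : ℝ) (y : Plane × ℝ) :
    ‖unrot φ y‖ ^ 2 = y.1 0 ^ 2 + y.1 1 ^ 2 + y.2 ^ 2 := by
  rw [norm_space_sq]
  simp only [unrot, Matrix.cons_val_zero, Matrix.cons_val_one, Matrix.cons_val]
  linear_combination (y.1 1 ^ 2 + y.2 ^ 2) * Real.sin_sq_add_cos_sq φ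

section Untwist

variable {ε : ℝ} (hε : ε ^ 2 = 1)

/-- The rotation of each horizontal plane that straightens the limit disk. -/
def untwist : OpenPartialHomeomorph Space (Plane × ℝ) where
  toFun p := rot (ang phaseT 0 (p 2) (axr p)) p
  invFun y := unrot (ang phaseT 0 (y.1 0) (axr' y)) y
  source := {p | 0 < ε * p 2 ∧ ‖p‖ < 1}
  target := {y | 0 < ε * y.1 0 ∧ y.1 0 ^ 2 + y.1 1 ^ 2 + y.2 ^ 2 < 1}
  map_source' p hp := by
    refine ⟨hp.1, ?_⟩
    rw [← norm_unrot_sq, unrot_rot]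
    exact pow_lt_one₀ (norm_nonneg _) hp.2 two_ne_zero
  map_target' y hy := by
    refine ⟨hy.1, ?_⟩
    rw [← sq_lt_one_iff₀ (norm_nonneg _), norm_unrot_sq]
    exact hy.2
  left_inv' p hp := by
    rw [axr'_rot]
    exact unrot_rot _ _
  right_inv' y hy := by
    rw [axr_unrot]
    exact rot_unrot _ _
  open_source := by
    have h : Continuous fun p : Space => ε * p 2 := by fun_prop
    exact (isOpen_lt continuous_const h).inter (isOpen_lt continuous_norm continuous_const)
  open_target := by
    have h1 : Continuous fun y : Plane × ℝ => ε * y.1 0 := by fun_prop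
    have h2 : Continuous fun y : Plane × ℝ => y.1 0 ^ 2 + y.1 1 ^ 2 + y.2 ^ 2 := by fun_prop
    exact (isOpen_lt continuous_const h1).inter (isOpen_lt h2 continuous_const)
  continuousOn_toFun := by
    have hφ : ContinuousOn (fun p : Space => ang phaseT 0 (p 2) (axr p))
        {p | 0 < ε * p 2 ∧ ‖p‖ < 1} :=
      (continuousOn_ang_axr (isPhase_phaseT hε)).mono fun p hp =>
        ⟨⟨hp.1, by linarith [(mul_le_abs hε (p 2)).trans_lt (abs_apply_two_lt hp.2)]⟩,
          by linarith [axr_lt_one hp.2]⟩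
    unfold rot
    fun_prop
  continuousOn_invFun := by
    have hφ : ContinuousOn (fun y : Plane × ℝ => ang phaseT 0 (y.1 0) (axr' y))
        {y | 0 < ε * y.1 0 ∧ y.1 0 ^ 2 + y.1 1 ^ 2 + y.2 ^ 2 < 1} := by
      have hc : Continuous fun y : Plane × ℝ => (y.1 0, axr' y) := by
        unfold axr'
        fun_prop
      refine (contDiffOn_ang (isPhase_phaseT hε)).continuousOn.comp hc.continuousOn
        fun y hy => ?_
      have hn := norm_unrot_sq 0 y
      have h1 : ‖unrot 0 y‖ < 1 := by
        rw [← sq_lt_one_iff₀ (norm_nonneg _), hn]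
        exact hy.2
      have h2 : |y.1 0| < 1 := abs_apply_two_lt h1
      have h3 := axr_lt_one h1
      rw [axr_unrot] at h3
      refine ⟨⟨hy.1, by linarith [(mul_le_abs hε (y.1 0)).trans_lt h2]⟩, ?_⟩
      change |axr' y| < 2
      rw [abs_of_nonneg (show 0 ≤ axr' y from Real.sqrt_nonneg _)]
      exact h3.trans (by norm_num)
    unfold unrot
    fun_prop

theorem mem_leafT_iff_untwist {p : Space} (hp : p ∈ (untwist hε).source) :
    p ∈ leafT hε ↔ (untwist hε p).2 ∈ ({0} : Set ℝ) := by
  rw [mem_leafT hε hp.2]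
  exact ⟨fun h => h.2, fun h => ⟨hp.1, h⟩⟩

end Untwist

/-! ### Charts around points of the punctured horizontal disk -/

/-- Rotation by `-α₀`, followed by the splitting into horizontal and vertical part. -/
def rotHomeo (α₀ : ℝ) : Space ≃ₜ Plane × ℝ where
  toFun p := (!₂[p 0 * Real.cos α₀ + p 1 * Real.sin α₀, p 1 * Real.cos α₀ - p 0 * Real.sin α₀], p 2)
  invFun y := !₂[y.1 0 * Real.cos α₀ - y.1 1 * Real.sin α₀,
    y.1 0 * Real.sin α₀ + y.1 1 * Real.cos α₀, y.2]
  left_inv p := by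
    refine space_ext ?_ ?_ rfl
    · simp only [Matrix.cons_val_zero, Matrix.cons_val_one, Matrix.cons_val_fin_one]
      linear_combination p 0 * Real.sin_sq_add_cos_sq α₀
    · simp only [Matrix.cons_val_zero, Matrix.cons_val_one, Matrix.cons_val_fin_one]
      linear_combination p 1 * Real.sin_sq_add_cos_sq α₀
  right_inv y := by
    refine Prod.ext (plane_ext ?_ ?_) rfl
    · simp only [Matrix.cons_val_zero, Matrix.cons_val_one]
      linear_combination y.1 0 * Real.sin_sq_add_cos_sq α₀
    · simp only [Matrix.cons_val_zero, Matrix.cons_val_one, Matrix.cons_val_fin_one]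
      linear_combination y.1 1 * Real.sin_sq_add_cos_sq α₀
  continuous_toFun := by fun_prop
  continuous_invFun := by fun_prop

theorem norm_rotHomeo_fst (α₀ : ℝ) (p : Space) : ‖(rotHomeo α₀ p).1‖ = axr p := by
  rw [← sq_eq_sq₀ (norm_nonneg _) (axr_nonneg _), norm_plane_sq, axr_sq]
  change (p 0 * Real.cos α₀ + p 1 * Real.sin α₀) ^ 2 +
    (p 1 * Real.cos α₀ - p 0 * Real.sin α₀) ^ 2 = _
  linear_combination (p 0 ^ 2 + p 1 ^ 2) * Real.sin_sq_add_cos_sq α₀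

/-- The part of the half ball in which the chart is defined. -/
def transDom : Set (Plane × ℝ) := {q | 0 < q.1 0 ∧ ‖q.1‖ ^ 2 + q.2 ^ 2 < 1}

theorem isOpen_transDom : IsOpen transDom := by
  have h1 : Continuous fun q : Plane × ℝ => q.1 0 := by fun_prop
  have h2 : Continuous fun q : Plane × ℝ => ‖q.1‖ ^ 2 + q.2 ^ 2 := by fun_prop
  exact (isOpen_lt continuous_const h1).inter (isOpen_lt h2 continuous_const)

/-- The angle between the limit surface and the point `q`. -/
def angGap (α₀ : ℝ) (q : Plane × ℝ) : ℝ :=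
  ang phaseT 0 q.2 ‖q.1‖ - (α₀ + Real.arctan (q.1 1 / q.1 0))

/-- The transverse coordinate. -/
def transCoord (α₀ : ℝ) (q : Plane × ℝ) : ℝ := if q.2 = 0 then 0 else -(angGap α₀ q)⁻¹

section Trans

variable {α₀ : ℝ} {q : Plane × ℝ} (hα : |α₀| ≤ Real.pi) (hq : q ∈ transDom)

include hq in
theorem transDom_bounds : |q.2| < 1 ∧ 0 < ‖q.1‖ ∧ ‖q.1‖ < 1 := by
  have h0 : q.1 ≠ 0 := by
    intro h
    have := hq.1
    rw [h] at this
    simp at this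
  have h1 : 0 < ‖q.1‖ := norm_pos_iff.2 h0
  have h2 := hq.2
  exact ⟨(sq_lt_one_iff_abs_lt_one _).1 (by nlinarith),
    h1, (sq_lt_one_iff₀ h1.le).1 (by nlinarith [sq_nonneg q.2])⟩

include hα in
-- The error is at most π/2 from ψ, π from α₀ and π/2 from the arctangent: 2π < 7 in total.
theorem abs_angGap_sub_lt : |angGap α₀ q - phaseT q.2| < 7 := by
  have h1 := abs_lt.1 (abs_ang_sub_lt phaseT 0 q.2 ‖q.1‖)
  have h2 := Real.neg_pi_div_two_lt_arctan (q.1 1 / q.1 0)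
  have h3 := Real.arctan_lt_pi_div_two (q.1 1 / q.1 0)
  have h4 := abs_le.1 hα
  have h5 := Real.pi_lt_d2
  unfold angGap
  rw [abs_lt]
  constructor <;> linarith

include hα hq in
-- As 0 < x₃ < 1, the term lam / x₃ absorbs the error 7 with plenty to spare. So the gap has a
-- definite sign and is at least 1/x₃ in modulus.
theorem angGap_le (h : 0 < q.2) : angGap α₀ q ≤ -q.2⁻¹ := by
  have h1 := (abs_lt.1 (abs_angGap_sub_lt (q := q) hα)).2
  have h2 := (abs_lt.1 (transDom_bounds hq).1).2
  have h3 : 1 < q.2⁻¹ := (one_lt_inv₀ h).2 h2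
  have h4 : phaseT q.2 = -(2 ^ 20 * q.2⁻¹) := by rw [phaseT, lam, div_eq_mul_inv]
  rw [h4] at h1
  linarith

include hα hq in
theorem le_angGap (h : q.2 < 0) : -q.2⁻¹ ≤ angGap α₀ q := by
  have h1 := (abs_lt.1 (abs_angGap_sub_lt (q := q) hα)).1
  have h2 := (abs_lt.1 (transDom_bounds hq).1).1
  have h3 : 1 < -q.2⁻¹ := by
    rw [← inv_neg]
    exact (one_lt_inv₀ (by linarith)).2 (by linarith)
  have h4 : phaseT q.2 = -(2 ^ 20 * q.2⁻¹) := by rw [phaseT, lam, div_eq_mul_inv]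
  rw [h4] at h1
  linarith

include hα hq in
theorem angGap_neg (h : 0 < q.2) : angGap α₀ q < 0 :=
  (angGap_le hα hq h).trans_lt (by have := inv_pos.2 h; linarith)

include hα hq in
theorem angGap_pos (h : q.2 < 0) : 0 < angGap α₀ q :=
  (by have := inv_lt_zero.2 h; linarith : 0 < -q.2⁻¹).trans_le (le_angGap hα hq h)

include hα hq in
theorem trans_pos (h : 0 < q.2) : 0 < transCoord α₀ q := by
  rw [transCoord, if_neg h.ne']
  exact neg_pos.2 (inv_lt_zero.2 (angGap_neg hα hq h))

include hα hq in
theorem trans_neg (h : q.2 < 0) : transCoord α₀ q < 0 := by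
  rw [transCoord, if_neg h.ne]
  exact neg_lt_zero.2 (inv_pos.2 (angGap_pos hα hq h))

include hα hq in
-- This gives continuity of the coordinate at x₃ = 0, where the gap itself blows up.
theorem abs_trans_le : |transCoord α₀ q| ≤ |q.2| := by
  rcases lt_trichotomy q.2 0 with h | h | h
  · rw [transCoord, if_neg h.ne, abs_neg, abs_inv, abs_of_pos (angGap_pos hα hq h), abs_of_neg h]
    refine inv_le_of_inv_le₀ (by linarith) ?_
    rw [inv_neg]
    exact le_angGap hα hq h
  · rw [transCoord, if_pos h, h]
  · rw [transCoord, if_neg h.ne', abs_neg, abs_inv, abs_of_neg (angGap_neg hα hq h), abs_of_pos h]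
    refine inv_le_of_inv_le₀ h ?_
    linarith [angGap_le hα hq h]

theorem exists_sign {x : ℝ} (hx : x ≠ 0) : ∃ ε : ℝ, ε ^ 2 = 1 ∧ 0 < ε * x := by
  rcases lt_or_gt_of_ne hx with h | h
  · exact ⟨-1, by norm_num, by linarith⟩
  · exact ⟨1, by norm_num, by linarith⟩

include hq in
theorem continuousAt_angGap (h : q.2 ≠ 0) : ContinuousAt (angGap α₀) q := by
  obtain ⟨ε, hε, hx⟩ := exists_sign h
  obtain ⟨b1, b2, b3⟩ := transDom_bounds hq
  have hU := isPhase_phaseT hε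
  have hopen : IsOpen {z : ℝ × ℝ | z.1 ∈ heightsT ε ∧ |z.2| < 2} :=
    (hU.isOpen.preimage continuous_fst).inter (isOpen_lt continuous_snd.abs continuous_const)
  have hmem : ((q.2, ‖q.1‖) : ℝ × ℝ) ∈ {z : ℝ × ℝ | z.1 ∈ heightsT ε ∧ |z.2| < 2} :=
    ⟨⟨hx, by linarith [mul_le_abs hε q.2]⟩, by simp only [abs_norm]; linarith⟩
  have h1 : ContinuousAt (fun z : ℝ × ℝ => ang phaseT 0 z.1 z.2) (q.2, ‖q.1‖) :=
    (contDiffOn_ang hU).continuousOn.continuousAt (hopen.mem_nhds hmem)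
  have h2 : ContinuousAt (fun q : Plane × ℝ => ang phaseT 0 q.2 ‖q.1‖) q :=
    ContinuousAt.comp (f := fun q : Plane × ℝ => (q.2, ‖q.1‖)) h1 (by fun_prop)
  have h3 : ContinuousAt (fun q : Plane × ℝ => q.1 1 / q.1 0) q :=
    ContinuousAt.div (by fun_prop) (by fun_prop) hq.1.ne'
  exact h2.sub (continuousAt_const.add (Real.continuous_arctan.continuousAt.comp h3))

include hα in
theorem continuousOn_trans : ContinuousOn (transCoord α₀) transDom := by
  intro q hq
  by_cases h : q.2 = 0
  · have h0 : transCoord α₀ q = 0 := by rw [transCoord, if_pos h]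
    rw [ContinuousWithinAt, h0]
    refine squeeze_zero_norm' (a := fun z : Plane × ℝ => |z.2|) ?_ ?_
    · filter_upwards [self_mem_nhdsWithin] with z hz
      exact abs_trans_le hα hz
    · have : Tendsto (fun z : Plane × ℝ => |z.2|) (𝓝 q) (𝓝 |q.2|) :=
        (continuous_snd.abs).tendsto q
      rw [h, abs_zero] at this
      exact this.mono_left nhdsWithin_le_nhds
  · refine ContinuousAt.continuousWithinAt ?_
    have hne : angGap α₀ q ≠ 0 := by
      rcases lt_or_gt_of_ne h with h | h
      · exact (angGap_pos hα hq h).ne'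
      · exact (angGap_neg hα hq h).ne
    refine ((continuousAt_angGap hq h).inv₀ hne).neg.congr ?_
    filter_upwards [continuous_snd.continuousAt.eventually_ne h] with z hz
    rw [transCoord, if_neg hz]
    rfl

include hα in
-- On each side of the plane the gap increases with x₃ and has constant sign, so minus its
-- reciprocal increases. The coordinate is negative below, zero on and positive above the plane,
-- which joins the two sides.
theorem strictMonoOn_trans (m : Plane) :
    StrictMonoOn (fun x => transCoord α₀ (m, x)) {x | (m, x) ∈ transDom} := by
  have hgap : ∀ {ε x y : ℝ}, ε ^ 2 = 1 → (m, x) ∈ transDom → (m, y) ∈ transDom → 0 < ε * x →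
      0 < ε * y → x < y → angGap α₀ (m, x) < angGap α₀ (m, y) := by
    intro ε x y hε hx hy hx0 hy0 hxy
    obtain ⟨b1, b2, b3⟩ := transDom_bounds hx
    obtain ⟨d1, -⟩ := transDom_bounds hy
    simp only at b1 b2 b3 d1
    have := ang_strictMonoOn (isPhase_phaseT hε) (r := ‖m‖) (by rw [abs_norm]; linarith) b2.ne'
      ⟨hx0, by linarith [mul_le_abs hε x]⟩ ⟨hy0, by linarith [mul_le_abs hε y]⟩ hxy
    simp only at this
    unfold angGap
    simp only
    linarith
  intro x hx y hy hxy
  simp only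
  rcases lt_trichotomy x 0 with h | h | h
  · rcases lt_trichotomy y 0 with h' | h' | h'
    · have := hgap (ε := -1) (by norm_num) hx hy (by linarith) (by linarith) hxy
      rw [transCoord, transCoord, if_neg h.ne, if_neg h'.ne, neg_lt_neg_iff]
      exact inv_strictAnti₀ (angGap_pos hα hx h) this
    · rw [transCoord.eq_def α₀ (m, y), if_pos h']
      exact trans_neg hα hx h
    · exact (trans_neg hα hx h).trans (trans_pos hα hy h')
  · rw [transCoord, if_pos h]
    exact trans_pos hα hy (by change 0 < y; linarith)
  · have h' : 0 < y := h.trans hxy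
    have := hgap (ε := 1) (by norm_num) hx hy (by linarith) (by linarith) hxy
    rw [transCoord, transCoord, if_neg h.ne', if_neg h'.ne', neg_lt_neg_iff]
    exact (inv_lt_inv_of_neg (angGap_neg hα hy h') (angGap_neg hα hx h)).2 this

/-- The chart around the point with polar angle `α₀` of the horizontal disk. -/
def transChart (hα : |α₀| ≤ Real.pi) : OpenPartialHomeomorph Space (Plane × ℝ) :=
  (rotHomeo α₀).toOpenPartialHomeomorph.trans
    (fiberHomeo (transCoord α₀) transDom isOpen_transDom (continuousOn_trans hα)
      (strictMonoOn_trans hα))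

theorem mem_transChart_source {p : Space} :
    p ∈ (transChart hα).source ↔ rotHomeo α₀ p ∈ transDom := by
  simp [transChart, fiberHomeo]

theorem norm_lt_of_mem_transDom {p : Space} (hp : rotHomeo α₀ p ∈ transDom) : ‖p‖ < 1 := by
  have := hp.2
  rw [norm_rotHomeo_fst, axr_sq] at this
  rw [← sq_lt_one_iff₀ (norm_nonneg _), norm_space_sq]
  exact this

/-- With β the arctangent, the point has polar angle α₀ + β, and it lies on one of the two sheets
exactly when this differs from the angle of the surface by a multiple of π. -/
theorem sheet_eq_zero_iff {p : Space} (hp : rotHomeo α₀ p ∈ transDom) :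
    p 1 * Real.cos (ang phaseT 0 (p 2) (axr p)) - p 0 * Real.sin (ang phaseT 0 (p 2) (axr p)) = 0 ↔
      Real.sin (angGap α₀ (rotHomeo α₀ p)) = 0 := by
  rw [angGap, norm_rotHomeo_fst]
  set φ := ang phaseT 0 (p 2) (axr p)
  have hφ : ang phaseT 0 (rotHomeo α₀ p).2 (axr p) = φ := rfl
  rw [hφ]
  have hc : 0 < (rotHomeo α₀ p).1 0 := hp.1
  have hpp := (rotHomeo α₀).left_inv p
  set c := (rotHomeo α₀ p).1 0 with hcdef
  set d := (rotHomeo α₀ p).1 1 with hddef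
  have h0 : p 0 = c * Real.cos α₀ - d * Real.sin α₀ := (congrArg (fun z : Space => z 0) hpp).symm
  have h1 : p 1 = c * Real.sin α₀ + d * Real.cos α₀ := (congrArg (fun z : Space => z 1) hpp).symm
  set β := Real.arctan (d / c) with hβ
  have hcos : 0 < Real.cos β := Real.cos_arctan_pos _
  have htan : c * Real.sin β = d * Real.cos β := by
    have := Real.tan_arctan (d / c)
    rw [← hβ, Real.tan_eq_sin_div_cos] at this
    field_simp at this
    linarith
  have key : Real.cos β * (p 1 * Real.cos φ - p 0 * Real.sin φ) =
      -(c * Real.sin (φ - (α₀ + β))) := by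
    rw [h0, h1, Real.sin_sub, Real.sin_add, Real.cos_add]
    linear_combination
      -(Real.cos φ * Real.cos α₀ + Real.sin φ * Real.sin α₀) * htan
  constructor
  · intro h
    rw [h, mul_zero] at key
    exact (mul_eq_zero.1 (neg_eq_zero.1 key.symm)).resolve_left hc.ne'
  · intro h
    rw [h, mul_zero, neg_zero] at key
    exact (mul_eq_zero.1 key).resolve_left hcos.ne'

/-- The transverse coordinates of the sheets of the limit disk. -/
def sheetHeights (ε : ℝ) : Set ℝ := {t | 0 < ε * t ∧ ∃ k : ℤ, (k * Real.pi)⁻¹ = t}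

theorem countable_sheetHeights (ε : ℝ) : (sheetHeights ε).Countable :=
  (countable_range fun k : ℤ => (k * Real.pi)⁻¹).mono fun _ ht => ht.2

include hα hq in
theorem mul_trans_pos_iff {ε : ℝ} (hε : ε ^ 2 = 1) : 0 < ε * transCoord α₀ q ↔ 0 < ε * q.2 := by
  have h0 : q.2 = 0 → transCoord α₀ q = 0 := fun h => by rw [transCoord, if_pos h]
  have h1 := trans_pos hα hq
  have h2 := trans_neg hα hq
  rcases eq_one_or_eq_neg_one hε with rfl | rfl <;> rcases lt_trichotomy q.2 0 with h | h | h
  · have := h2 h; constructor <;> intro <;> linarith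
  · rw [h0 h, h]
  · have := h1 h; constructor <;> intro <;> linarith
  · have := h2 h; constructor <;> intro <;> linarith
  · rw [h0 h, h]
  · have := h1 h; constructor <;> intro <;> linarith

/-- The sheets are where the gap is kπ, that is, at transverse coordinates ±1/(kπ): a countable set
accumulating only at the slice 0 of the horizontal leaf. -/
theorem mem_leafT_iff_transChart {ε : ℝ} (hε : ε ^ 2 = 1) {p : Space}
    (hp : p ∈ (transChart hα).source) :
    p ∈ leafT hε ↔ (transChart hα p).2 ∈ sheetHeights ε := by
  rw [mem_transChart_source] at hp
  rw [mem_leafT hε (norm_lt_of_mem_transDom hp), sheet_eq_zero_iff hp]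
  change _ ↔ 0 < ε * transCoord α₀ (rotHomeo α₀ p) ∧ ∃ k : ℤ, (k * Real.pi)⁻¹ = transCoord α₀ (rotHomeo α₀ p)
  rw [mul_trans_pos_iff hα hp hε]
  refine and_congr_right fun h => ?_
  have h0 : (rotHomeo α₀ p).2 ≠ 0 := by
    intro h0
    change p 2 = 0 at h0
    rw [h0, mul_zero] at h
    exact lt_irrefl _ h
  rw [transCoord, if_neg h0, Real.sin_eq_zero_iff]
  constructor
  · rintro ⟨k, hk⟩
    exact ⟨-k, by rw [← hk, ← inv_neg]; push_cast; ring_nf⟩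
  · rintro ⟨k, hk⟩
    refine ⟨-k, ?_⟩
    rw [← inv_neg, inv_inj] at hk
    push_cast
    linarith

theorem mem_leafPlane_iff_transChart {p : Space} (hp : p ∈ (transChart hα).source) :
    p ∈ leafPlane ↔ (transChart hα p).2 ∈ ({0} : Set ℝ) := by
  rw [mem_transChart_source] at hp
  change _ ↔ transCoord α₀ (rotHomeo α₀ p) = 0
  have h0 : (rotHomeo α₀ p).2 = p 2 := rfl
  constructor
  · rintro ⟨⟨-, h⟩, -⟩
    rw [transCoord, if_pos (h0.trans h)]
  · intro h
    have h2 : p 2 = 0 := by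
      by_contra hne
      rcases lt_or_gt_of_ne hne with h' | h'
      · exact (trans_neg hα hp h').ne h
      · exact (trans_pos hα hp h').ne' h
    refine ⟨⟨mem_ball_zero_iff.2 (norm_lt_of_mem_transDom hp), h2⟩, ?_⟩
    rintro rfl
    have := hp.1
    simp [rotHomeo] at this

end Trans

/-! ### The lamination -/

theorem limitLeaves_eq {ε ε' : ℝ} (hε : ε ^ 2 = 1) (hε' : ε' ^ 2 = 1) :
    limitLeaves (diskT hε) (diskT hε') = {leafT hε, leafT hε', leafPlane} := rfl

theorem isLamination_limitLeaves {ε ε' : ℝ} (hε : ε ^ 2 = 1) (hε' : ε' = -ε)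
    (hε'2 : ε' ^ 2 = 1) :
    IsLamination (Metric.ball 0 1 \ {0}) (limitLeaves (diskT hε) (diskT hε'2)) where
  subset := by
    have h : ∀ {ε : ℝ} (hε : ε ^ 2 = 1), leafT hε ⊆ Metric.ball 0 1 \ {0} := by
      intro ε hε p hp
      refine ⟨hp.2, ?_⟩
      rintro rfl
      simpa using mul_pos_of_mem_leafT hε hp
    rw [limitLeaves_eq]
    rintro _ (rfl | rfl | rfl)
    · exact h _
    · exact h _
    · exact fun p hp => ⟨hp.1.1, hp.2⟩
  connected := by
    rw [limitLeaves_eq]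
    rintro _ (rfl | rfl | rfl)
    · exact isPathConnected_leafT _
    · exact isPathConnected_leafT _
    · exact isPathConnected_leafPlane
  smooth := by
    rw [limitLeaves_eq]
    rintro _ (rfl | rfl | rfl) p hp
    · exact exists_isSmoothEmbeddingOn_leafT _ hp
    · exact exists_isSmoothEmbeddingOn_leafT _ hp
    · exact exists_isSmoothEmbeddingOn_leafPlane hp
  disjoint := by
    have h1 : Disjoint (leafT hε) (leafT hε'2) := disjoint_left.2 fun p h h' => by
      have e1 := mul_pos_of_mem_leafT _ h
      have e2 := mul_pos_of_mem_leafT _ h'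
      rw [hε'] at e2
      linarith
    have h2 : ∀ {ε : ℝ} (hε : ε ^ 2 = 1), Disjoint (leafT hε) leafPlane := fun hε =>
      disjoint_left.2 fun p h h' => by
        have e1 := mul_pos_of_mem_leafT _ h
        rw [show p 2 = 0 from h'.1.2, mul_zero] at e1
        exact lt_irrefl _ e1
    rw [limitLeaves_eq]
    rintro _ (rfl | rfl | rfl) _ (rfl | rfl | rfl) hne
    · exact absurd rfl hne
    · exact h1
    · exact h2 _
    · exact h1.symm
    · exact absurd rfl hne
    · exact h2 _
    · exact (h2 _).symm
    · exact (h2 _).symm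
    · exact absurd rfl hne
  closed := by
    rw [limitLeaves_eq]
    simp only [sUnion_insert, sUnion_singleton, closure_union]
    have h : ∀ {ε : ℝ} (hε : ε ^ 2 = 1) {p : Space}, p ∈ closure (leafT hε) →
        p ∈ Metric.ball 0 1 \ {0} → p ∈ leafT hε ∨ p ∈ leafPlane := by
      intro ε hε p hp hM
      rcases closure_diskT_subset hε (closure_mono inter_subset_left hp) with h | h
      · exact Or.inl ⟨h, hM.1⟩
      · exact Or.inr ⟨⟨hM.1, h.2⟩, hM.2⟩
    rintro p ⟨hp | hp | hp, hM⟩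
    · rcases h hε hp hM with h | h
      · exact Or.inl h
      · exact Or.inr (Or.inr h)
    · exact Or.inr (h hε'2 hp hM)
    · have hcl : IsClosed (plane₀ : Set Space) := isClosed_eq (by fun_prop) continuous_const
      exact Or.inr (Or.inr ⟨⟨hM.1, closure_minimal (fun q hq => hq.1.2) hcl hp⟩, hM.2⟩)
  chart := by
    rw [limitLeaves_eq]
    -- Stated for either sign, so that the lower half ball follows by exchanging the two limit
    -- disks.
    have hoff : ∀ {ε ε' : ℝ} (hε : ε ^ 2 = 1) (hε'2 : ε' ^ 2 = 1) (_ : ε' = -ε) (p : Space),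
        p ∈ Metric.ball (0 : Space) 1 → 0 < ε * p 2 →
        ∃ Φ : OpenPartialHomeomorph Space (Plane × ℝ), p ∈ Φ.source ∧
          Φ.source ⊆ Metric.ball 0 1 \ {0} ∧
          ∀ Λ ∈ ({leafT hε, leafT hε'2, leafPlane} : Set (Set Space)), ∃ T : Set ℝ, T.Countable ∧
            Φ '' (Φ.source ∩ Λ) = {y | y ∈ Φ.target ∧ y.2 ∈ T} := by
      intro ε ε' hε hε'2 hε' p hp h0
      refine ⟨untwist hε, ⟨h0, mem_ball_zero_iff.1 hp⟩, fun q hq => ⟨mem_ball_zero_iff.2 hq.2, ?_⟩,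
        ?_⟩
      · rintro rfl
        simpa using hq.1
      · rintro _ (rfl | rfl | rfl)
        · exact ⟨{0}, countable_singleton 0, image_inter_eq_of_iff _ fun q hq =>
            mem_leafT_iff_untwist hε hq⟩
        · refine ⟨∅, countable_empty, image_inter_eq_of_iff _ fun q hq => ?_⟩
          refine iff_of_false (fun h => ?_) (notMem_empty _)
          have e1 := mul_pos_of_mem_leafT _ h
          have e2 := hq.1
          rw [hε'] at e1
          linarith
        · refine ⟨∅, countable_empty, image_inter_eq_of_iff _ fun q hq => ?_⟩
          refine iff_of_false (fun h => ?_) (notMem_empty _)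
          have e2 := hq.1
          rw [show q 2 = 0 from h.1.2, mul_zero] at e2
          exact lt_irrefl _ e2
    rintro p ⟨hp, hp0⟩
    by_cases h2 : p 2 = 0
    · obtain ⟨α, hα0, hα1⟩ : ∃ α, p 0 = axr p * Real.cos α ∧ p 1 = axr p * Real.sin α :=
        exists_polar (p 0) (p 1)
      -- The polar angle is normalized to modulus at most π, on which the bounds for the gap depend.
      obtain ⟨α, hαpi, hα0, hα1⟩ : ∃ α, |α| ≤ Real.pi ∧
          p 0 = axr p * Real.cos α ∧ p 1 = axr p * Real.sin α := by
        refine ⟨(α : Real.Angle).toReal, Real.Angle.abs_toReal_le_pi _, ?_, ?_⟩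
        · rw [Real.Angle.cos_toReal, Real.Angle.cos_coe]; exact hα0
        · rw [Real.Angle.sin_toReal, Real.Angle.sin_coe]; exact hα1
      have hax : 0 < axr p := (axr_nonneg p).lt_of_ne fun h => hp0 (by
        rw [← h, zero_mul] at hα0 hα1
        exact space_ext hα0 hα1 h2)
      have hmem : rotHomeo α p ∈ transDom := by
        refine ⟨?_, ?_⟩
        · change 0 < p 0 * Real.cos α + p 1 * Real.sin α
          rw [hα0, hα1]
          nlinarith [Real.sin_sq_add_cos_sq α]
        · rw [norm_rotHomeo_fst, axr_sq]
          change p 0 ^ 2 + p 1 ^ 2 + p 2 ^ 2 < 1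
          rw [← norm_space_sq]
          exact pow_lt_one₀ (norm_nonneg _) (mem_ball_zero_iff.1 hp) two_ne_zero
      refine ⟨transChart hαpi, (mem_transChart_source _).2 hmem, fun q hq => ?_, ?_⟩
      · rw [mem_transChart_source] at hq
        refine ⟨mem_ball_zero_iff.2 (norm_lt_of_mem_transDom hq), ?_⟩
        rintro rfl
        have := hq.1
        simp [rotHomeo] at this
      · rintro _ (rfl | rfl | rfl)
        · exact ⟨_, countable_sheetHeights ε, image_inter_eq_of_iff _ fun q hq =>
            mem_leafT_iff_transChart _ _ hq⟩
        · exact ⟨_, countable_sheetHeights ε', image_inter_eq_of_iff _ fun q hq =>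
            mem_leafT_iff_transChart _ _ hq⟩
        · exact ⟨{0}, countable_singleton 0, image_inter_eq_of_iff _ fun q hq =>
            mem_leafPlane_iff_transChart _ hq⟩
    · by_cases h0 : 0 < ε * p 2
      · exact hoff hε hε'2 hε' p hp h0
      · have hne : ε * p 2 ≠ 0 := by
          refine mul_ne_zero ?_ h2
          rintro rfl
          norm_num at hε
        obtain ⟨Φ, a1, a2, a3⟩ := hoff hε'2 hε (by rw [hε', neg_neg]) p hp (by
          rw [hε', neg_mul, neg_pos]
          exact lt_of_le_of_ne (not_lt.1 h0) hne)
        refine ⟨Φ, a1, a2, fun Λ hΛ => a3 Λ ?_⟩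
        rcases hΛ with rfl | rfl | rfl
        · exact Or.inr (Or.inl rfl)
        · exact Or.inl rfl
        · exact Or.inr (Or.inr rfl)

/-! ### The lamination does not extend -/

/-- A leaf that contains a half axis contains the origin. -/
theorem IsLamination.zero_mem {L : Set (Set Space)} (hL : IsLamination (Metric.ball 0 1) L)
    {Λ : Set Space} (hΛ : Λ ∈ L) {ε : ℝ} (h : ∀ t ∈ Ioo (0 : ℝ) 1, !₂[0, 0, ε * t] ∈ Λ) :
    (0 : Space) ∈ Λ := by
  obtain ⟨Φ, h0, -, hΦ⟩ := hL.chart 0 (by simp)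
  obtain ⟨T, hT, hTe⟩ := hΦ Λ hΛ
  have hγ : Continuous fun t : ℝ => (!₂[0, 0, ε * t] : Space) := by fun_prop
  have hγ0 : (!₂[0, 0, ε * 0] : Space) = 0 := space_ext rfl rfl (mul_zero ε)
  have hnhds : (fun t : ℝ => (!₂[0, 0, ε * t] : Space)) ⁻¹' Φ.source ∈ 𝓝 (0 : ℝ) := by
    refine hγ.continuousAt.preimage_mem_nhds ?_
    rw [hγ0]
    exact Φ.open_source.mem_nhds h0
  obtain ⟨r, hr, hball⟩ := Metric.mem_nhds_iff.1 hnhds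
  set s := min r 1 with hs
  have hs0 : 0 < s := lt_min hr one_pos
  have hsrc : ∀ t ∈ Ico (0 : ℝ) s, (!₂[0, 0, ε * t] : Space) ∈ Φ.source := fun t ht => hball (by
    rw [mem_ball_zero_iff, Real.norm_of_nonneg ht.1]
    exact ht.2.trans_le (min_le_left _ _))
  have hcont : ContinuousOn (fun t : ℝ => (Φ !₂[0, 0, ε * t]).2) (Ico 0 s) :=
    continuous_snd.comp_continuousOn (Φ.continuousOn.comp hγ.continuousOn hsrc)
  have hmem : ∀ t ∈ Ioo (0 : ℝ) s, (Φ !₂[0, 0, ε * t]).2 ∈ T := fun t ht => by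
    have : Φ !₂[0, 0, ε * t] ∈ Φ '' (Φ.source ∩ Λ) := mem_image_of_mem _
      ⟨hsrc t ⟨ht.1.le, ht.2⟩, h t ⟨ht.1, ht.2.trans_le (min_le_right _ _)⟩⟩
    rw [hTe] at this
    exact this.2
  -- The transverse coordinate is continuous along the half axis and takes values in a countable,
  -- hence totally disconnected, set; so it is constant.
  have hconst : ∀ t ∈ Ioo (0 : ℝ) s, (Φ !₂[0, 0, ε * t]).2 = (Φ !₂[0, 0, ε * (s / 2)]).2 :=
    fun t ht => hT.isTotallyDisconnected
      ((fun t : ℝ => (Φ !₂[0, 0, ε * t]).2) '' Ioo 0 s)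
      (by rintro _ ⟨t, ht, rfl⟩; exact hmem t ht)
      (isPreconnected_Ioo.image _ (hcont.mono Ioo_subset_Ico_self))
      (mem_image_of_mem _ ht) (mem_image_of_mem _ ⟨by linarith, by linarith⟩)
  -- By continuity the origin has the same transverse coordinate, and a slice with this coordinate
  -- belongs entirely to the leaf within the chart.
  have hlim : (Φ !₂[0, 0, ε * 0]).2 ∈ closure {(Φ !₂[0, 0, ε * (s / 2)]).2} := by
    refine ((hcont 0 ⟨le_rfl, hs0⟩).mono Ioo_subset_Ico_self).mem_closure ?_ hconst
    rw [closure_Ioo hs0.ne]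
    exact ⟨le_rfl, hs0.le⟩
  rw [closure_singleton, mem_singleton_iff, hγ0] at hlim
  have h0T : Φ 0 ∈ {y | y ∈ Φ.target ∧ y.2 ∈ T} :=
    ⟨Φ.map_source h0, hlim ▸ hmem _ ⟨by linarith, by linarith⟩⟩
  rw [← hTe] at h0T
  obtain ⟨p, ⟨hp, hpΛ⟩, he⟩ := h0T
  rwa [Φ.injOn hp h0 he] at hpΛ

theorem axis_mem_leafT {ε : ℝ} (hε : ε ^ 2 = 1) {t : ℝ} (ht : t ∈ Ioo (0 : ℝ) 1) :
    !₂[0, 0, ε * t] ∈ leafT hε := by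
  have hn : ‖(!₂[0, 0, ε * t] : Space)‖ < 1 := by
    rw [← sq_lt_one_iff₀ (norm_nonneg _), norm_space_sq]
    simp [mul_pow, hε]
    rw [abs_of_pos ht.1]
    exact ht.2
  refine (mem_leafT hε hn).2 ⟨?_, by simp⟩
  simp only [Matrix.cons_val]
  rw [← mul_assoc, ← sq, hε, one_mul]
  exact ht.1

/-- The origin would lie in the leaves extending both limit disks. Disjointness makes these leaves
equal, yet without 0 one lies above the plane and the other below. -/
theorem not_extends {ε ε' : ℝ} (hε : ε ^ 2 = 1) (hε' : ε' = -ε) (hε'2 : ε' ^ 2 = 1) :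
    ¬ ∃ L : Set (Set Space), IsLamination (Metric.ball 0 1) L ∧
      (fun Λ : Set Space => Λ \ {0}) '' L = limitLeaves (diskT hε) (diskT hε'2) := by
  rintro ⟨L, hL, he⟩
  rw [limitLeaves_eq] at he
  have key : ∀ {δ : ℝ} (hδ : δ ^ 2 = 1), leafT hδ ∈ (fun Λ : Set Space => Λ \ {0}) '' L →
      ∃ Λ ∈ L, Λ \ {0} = leafT hδ ∧ (0 : Space) ∈ Λ := by
    rintro δ hδ ⟨Λ, hΛ, h⟩
    refine ⟨Λ, hΛ, h, hL.zero_mem hΛ (ε := δ) fun t ht => ?_⟩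
    have := axis_mem_leafT hδ ht
    rw [← h] at this
    exact this.1
  obtain ⟨Λ, hΛ, h1, h2⟩ := key hε (he ▸ Or.inl rfl)
  obtain ⟨Λ', hΛ', h1', h2'⟩ := key hε'2 (he ▸ Or.inr (Or.inl rfl))
  have heq : Λ = Λ' := hL.disjoint.elim hΛ hΛ' fun hd => disjoint_left.1 hd h2 h2'
  subst heq
  have hp := axis_mem_leafT hε (t := 1 / 2) ⟨by norm_num, by norm_num⟩
  have hp' := hp
  rw [← h1, h1'] at hp'
  have e1 := mul_pos_of_mem_leafT hε hp
  have e2 := mul_pos_of_mem_leafT hε'2 hp'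
  rw [hε'] at e2
  linarith

end SpiralDisk

end

theorem theorem1 :
    ∃ S : ℕ → EmbeddedMinimalDisk,
      -- compact embedded minimal disks in the unit ball with boundary in its boundary,
      -- containing the vertical segment
      (∀ i, IsCompact (S i).carrier ∧
        (S i).carrier ⊆ Metric.closedBall 0 1 ∧
        (S i).boundary ⊆ Metric.sphere 0 1 ∧
        ∀ t : ℝ, |t| < 1 → !₂[0, 0, t] ∈ (S i).carrier) ∧
      -- (1)
      Tendsto (fun i => (S i).curvSq 0) atTop atTop ∧
      -- (2)
      (∀ δ > 0, ∃ C : ℝ, ∀ i, ∀ p ∈ (S i).carrier \ Metric.ball 0 δ, (S i).curvSq p ≤ C) ∧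
      -- (3)
      (∃ (W : ℕ → Fin 2 → Set (ℝ × ℝ)) (u : ℕ → Fin 2 → ℝ × ℝ → ℝ),
        (∀ i, IsTwoMultivaluedGraphs (S i).carrier (W i) (u i)) ∧
        ∀ N : ℝ, ∀ s ∈ Ioo (0 : ℝ) 1, ∀ᶠ i in atTop, ∀ j, ContainsNValued (W i j) N s) ∧
      -- (4)
      ∃ Tp Tm : EmbeddedMinimalDisk,
        IsSpiralingLimit S 1 Tp ∧ IsSpiralingLimit S (-1) Tm ∧
        -- the limit is not proper
        ¬ IsProperSet Tp.carrier ∧ ¬ IsProperSet Tm.carrier ∧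
        -- away from `0`, the disks also converge (with their tangent planes) to the plane
        -- `x₃ = 0` where they approach it
        (∀ δ > 0, ∀ η > 0, ∃ h > 0, ∀ᶠ i in atTop, ∀ p ∈ (S i).carrier \ Metric.ball 0 δ,
          |p 2| < h → 1 - η < |(S i).normal p 2|) ∧
        -- the limit is a lamination of the punctured ball, and does not extend across `0`
        IsLamination (Metric.ball 0 1 \ {0}) (limitLeaves Tp Tm) ∧
        ¬ ∃ L : Set (Set Space), IsLamination (Metric.ball 0 1) L ∧
          (fun Λ : Set Space => Λ \ {0}) '' L = limitLeaves Tp Tm := by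
  refine ⟨diskS, fun i => ⟨isCompact_diskS i, spiralDisk_carrier_subset _ _,
    spiralDisk_boundary _ _, fun t => axis_mem_diskS i⟩, tendsto_curvSq_diskS_zero,
    fun δ hδ => ⟨_, curvSq_diskS_le hδ⟩, ⟨_, _, isTwoMultivaluedGraphs_diskS,
      fun N s hs => eventually_containsNValued N hs⟩,
    diskT (one_pow 2), diskT (neg_one_sq (R := ℝ)), isSpiralingLimit_diskT _,
    isSpiralingLimit_diskT _, not_isProperSet_diskT _, not_isProperSet_diskT _,
    fun δ hδ η hη => eventually_lt_normal_diskS hδ hη, isLamination_limitLeaves _ rfl _,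
    not_extends _ rfl _⟩
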